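/- For an oriented knot $K$ in $S^3$ and an integer $n\ge 1$ let $J_K(n)\in\mathbb Z[q^{\pm1}]$ be the colored Jones polynomial of $K$, i.e. the $\mathfrak{sl}_2$ quantum invariant of the zero-framed knot $K$ colored with the $n$-dimensional irreducible representation, normalized so that it equals $1$ for the unknot. Concretely, $J_K(n)$ is computed from a planar diagram of a long knot (a $(1,1)$-tangle with one component) whose closure is $K$, drawn with all crossings pointing upwards: put $v=q^{1/2}$, $\{a\}=v^a-v^{-a}$, $\{a\}_k=\prod_{i=0}^{k-1}\{a-i\}$, $\{m\}!=\{m\}_m$, $\binom{m}{k}_{\!q}=\frac{\{m\}!}{\{k\}!\,\{m-k\}!}$, and $$R_+(n;a,b,k)=(-1)^k v^{-((n-1-2a)(n-1-2b)+k(k-1))/2}\tbinom{b+k}{k}_{\!q}\{n-1+k-a\}_k,$$ $$R_-(n;a,b,k)=v^{((n-1-2a-2k)(n-1-2b+2k)+k(k-1))/2}\tbinom{a+k}{k}_{\!q}\{n-1+k-b\}_k .$$ Color the arcs between crossings by $0,\dots,n-1$, with color $0$ on the two ends; a positive crossing with colors $a,b$ below and $b+k,a-k$ above (from left to right) has weight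 $R_+(n;a,b,k)$, and a negative crossing with colors $a,b$ below and $b-k,a+k$ above has weight $R_-(n;a,b,k)$ (with $k\ge 0$; all other colorings have weight $0$); a local maximum that turns from an upward to a downward strand when read from left to right has weight $v^{-(n-1-2a)}$, a local minimum with a downward left and an upward right leg has weight $v^{\,n-1-2a}$, where $a$ is the color, and the other extrema have weight $1$. Then $J_K(n)$ is $v^{w(n^2-1)/2}$ times the sum over all colorings of the products of the local weights, where $w$ is the writhe of the diagram. For a Laurent polynomial $f=\sum_k c_kq^k$ let $\|f\|_1=\sum_k|c_k|$. Theorem. Let $c\ge 0$ and $n\ge 1$ be integers, and let $K$ be a knot presented by a diagram with $c+2$ crossings. Then $$\|J_K(n)\|_1\le n^c\,4^{cn}.$$ -/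

import Mathlib

open scoped LaurentPolynomial

noncomputable section

namespace ColoredJones

/-! ### Laurent polynomials

All computations take place in `ℤ[T;T⁻¹]`, whose variable `T 1` stands for
`v ^ (1/2) = q ^ (1/4)`, where `v = q ^ (1/2)`.  Thus `v ^ m` is `T (2 * m)`, `v ^ (m / 2)` is
`T m`, and `q ^ m` is `T (4 * m)`.  Substituting a power of the variable does not change the
list of nonzero coefficients, so the `l¹`-norm is the same in each of these variables. -/

/-- The `l¹`-norm `∑ |c_k|` of a Laurent polynomial `∑ c_k T ^ k`. -/
def l1Norm (f : ℤ[T;T⁻¹]) : ℤ :=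
  ∑ k ∈ f.coeff.support, |f.coeff k|

/-- `{a} = v ^ a - v ^ (-a)`. -/
def qInt (a : ℤ) : ℤ[T;T⁻¹] :=
  LaurentPolynomial.T (2 * a) - LaurentPolynomial.T (-(2 * a))

/-- `{a}_k = {a} {a - 1} ⋯ {a - k + 1}`, which is `{a}! / {a - k}!` for `0 ≤ k ≤ a`. -/
def qFalling (a : ℤ) (k : ℕ) : ℤ[T;T⁻¹] :=
  ∏ i ∈ Finset.range k, qInt (a - i)

/-- `{m}! = {1} {2} ⋯ {m}`. -/
def qFactorial (m : ℕ) : ℤ[T;T⁻¹] :=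
  ∏ i ∈ Finset.range m, qInt (i + 1)

/-- The balanced quantum binomial coefficient, as a Laurent polynomial, through the quantum
Pascal rule; `qBinom_mul` shows that it is `{m}! / ({k}! {m - k}!)`. -/
def qBinom : ℕ → ℕ → ℤ[T;T⁻¹]
  | _, 0 => 1
  | 0, _ + 1 => 0
  | m + 1, k + 1 =>
      LaurentPolynomial.T (2 * ((k : ℤ) + 1)) * qBinom m (k + 1)
        + LaurentPolynomial.T (-(2 * ((m : ℤ) - k))) * qBinom m k

theorem qBinom_zero_right (m : ℕ) : qBinom m 0 = 1 := by
  cases m <;> rfl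

theorem qBinom_eq_zero (m : ℕ) : ∀ k : ℕ, m < k → qBinom m k = 0 := by
  induction m with
  | zero =>
    intro k hk
    cases k with
    | zero => omega
    | succ k => rfl
  | succ m ih =>
    intro k hk
    cases k with
    | zero => omega
    | succ k => simp [qBinom, ih (k + 1) (by omega), ih k (by omega)]

theorem qFactorial_succ (m : ℕ) : qFactorial (m + 1) = qFactorial m * qInt (m + 1) := by
  simp [qFactorial, Finset.prod_range_succ]

/-- `qBinom (k + j) k = {k + j}! / ({k}! {j}!)`. -/
theorem qBinom_mul (k j : ℕ) :
    qBinom (k + j) k * (qFactorial k * qFactorial j) = qFactorial (k + j) := by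
  induction hm : k + j generalizing k j with
  | zero =>
    obtain rfl : k = 0 := by omega
    obtain rfl : j = 0 := by omega
    simp [qBinom, qFactorial]
  | succ m ih =>
    cases k with
    | zero =>
      obtain rfl : j = m + 1 := by omega
      rw [qBinom_zero_right]; simp [qFactorial]
    | succ k =>
      have h2 := ih k j (by omega)
      have hmk : ((m : ℤ) - k) = j := by
        have : m = k + j := by omega
        subst this; push_cast; ring
      have key : LaurentPolynomial.T (2 * ((k : ℤ) + 1)) * qInt j
          + LaurentPolynomial.T (-(2 * (j : ℤ))) * qInt (k + 1) = qInt (m + 1) := by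
        have : (m : ℤ) = k + j := by omega
        simp only [qInt, mul_sub, ← LaurentPolynomial.T_add, this]
        ring_nf
      rw [qBinom, hmk, qFactorial_succ m, qFactorial_succ k, ← key]
      cases j with
      | zero =>
        rw [qBinom_eq_zero m (k + 1) (by omega)]
        have h0 : qInt ((0 : ℕ) : ℤ) = 0 := by simp [qInt]
        rw [h0, ← h2]; ring
      | succ j =>
        have h1 := ih (k + 1) j (by omega)
        rw [qFactorial_succ k] at h1
        rw [qFactorial_succ j] at h2 ⊢
        push_cast at h1 h2 ⊢
        linear_combination
          (LaurentPolynomial.T (2 * ((k : ℤ) + 1)) * qInt ((j : ℤ) + 1)) * h1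
            + (LaurentPolynomial.T (-(2 * ((j : ℤ) + 1))) * qInt ((k : ℤ) + 1)) * h2

/-! ### Weights of the `R`-matrices -/

/-- `R₊(n; a, b, k)`. -/
def Rplus (n a b k : ℕ) : ℤ[T;T⁻¹] :=
  (-1) ^ k
    * LaurentPolynomial.T (-(((n : ℤ) - 1 - 2 * a) * ((n : ℤ) - 1 - 2 * b) + (k : ℤ) * (k - 1)))
    * qBinom (b + k) k * qFalling ((n : ℤ) - 1 + k - a) k

/-- `R₋(n; a, b, k)`. -/
def Rminus (n a b k : ℕ) : ℤ[T;T⁻¹] :=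
  LaurentPolynomial.T
      (((n : ℤ) - 1 - 2 * a - 2 * k) * ((n : ℤ) - 1 - 2 * b + 2 * k) + (k : ℤ) * (k - 1))
    * qBinom (a + k) k * qFalling ((n : ℤ) - 1 + k - b) k

/-! ### Knot diagrams in Morse position

A generic height function cuts an oriented planar diagram into horizontal slices, each of which
holds one crossing, one local maximum or one local minimum, next to vertical strands.  After a
planar isotopy, which creates extrema but no crossings, both strands of each crossing point
upwards. -/

/-- The direction in which a strand passes through a horizontal line. -/
inductive Dir
  | up
  | down

/-- The elementary pieces of an oriented diagram: the two crossings with both strands pointing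
upwards (in the positive one, the overstrand goes from the lower left to the upper right), the
local maxima (caps) and the local minima (cups) with their two orientations; the suffix lists the
directions of the left and of the right leg. -/
inductive Elem
  | posCrossing
  | negCrossing
  | capUpDown
  | capDownUp
  | cupUpDown
  | cupDownUp

/-- The directions of the strands, from left to right, on the lower side of a piece. -/
def Elem.src : Elem → List Dir
  | posCrossing => [Dir.up, Dir.up]
  | negCrossing => [Dir.up, Dir.up]
  | capUpDown => [Dir.up, Dir.down]
  | capDownUp => [Dir.down, Dir.up]
  | cupUpDown => []
  | cupDownUp => []

/-- The directions of the strands, from left to right, on the upper side of a piece. -/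
def Elem.tgt : Elem → List Dir
  | posCrossing => [Dir.up, Dir.up]
  | negCrossing => [Dir.up, Dir.up]
  | capUpDown => []
  | capDownUp => []
  | cupUpDown => [Dir.up, Dir.down]
  | cupDownUp => [Dir.down, Dir.up]

/-- The number of crossings in a piece. -/
def Elem.crossings : Elem → ℕ
  | posCrossing => 1
  | negCrossing => 1
  | _ => 0

/-- The sum of the signs of the crossings in a piece. -/
def Elem.sign : Elem → ℤ
  | posCrossing => 1
  | negCrossing => -1
  | _ => 0

/-- A slice: an elementary piece with vertical strands to its left and to its right. -/
structure Slice where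
  left : List Dir
  elem : Elem
  right : List Dir

/-- The strands through the lower boundary line of a slice. -/
def Slice.src (x : Slice) : List Dir := x.left ++ x.elem.src ++ x.right

/-- The strands through the upper boundary line of a slice. -/
def Slice.tgt (x : Slice) : List Dir := x.left ++ x.elem.tgt ++ x.right

/-- The slices, listed from bottom to top, fit together to a diagram whose lower boundary is `s`
and whose upper boundary is `t`. -/
def Composable : List Dir → List Slice → List Dir → Prop
  | s, [], t => s = t
  | s, x :: D, t => x.src = s ∧ Composable x.tgt D t

/-- In the diagram `D`, the point `(i, j)` is the `j`-th point from the left on the `i`-th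
horizontal line from below (slice `i` lies between the lines `i` and `i + 1`).  Two such points
are related if they are the two ends of a piece of strand in some slice. -/
inductive StrandPiece (D : List Slice) : ℕ × ℕ → ℕ × ℕ → Prop
  | left {i j : ℕ} {x : Slice} (hx : D[i]? = some x) (hj : j < x.left.length) :
      StrandPiece D (i, j) (i + 1, j)
  | right {i j : ℕ} {x : Slice} (hx : D[i]? = some x) (hj : j < x.right.length) :
      StrandPiece D (i, x.left.length + x.elem.src.length + j)
        (i + 1, x.left.length + x.elem.tgt.length + j)
  | crossingRight {i : ℕ} {x : Slice} (hx : D[i]? = some x)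
      (hc : x.elem = Elem.posCrossing ∨ x.elem = Elem.negCrossing) :
      StrandPiece D (i, x.left.length) (i + 1, x.left.length + 1)
  | crossingLeft {i : ℕ} {x : Slice} (hx : D[i]? = some x)
      (hc : x.elem = Elem.posCrossing ∨ x.elem = Elem.negCrossing) :
      StrandPiece D (i, x.left.length + 1) (i + 1, x.left.length)
  | cap {i : ℕ} {x : Slice} (hx : D[i]? = some x)
      (hc : x.elem = Elem.capUpDown ∨ x.elem = Elem.capDownUp) :
      StrandPiece D (i, x.left.length) (i, x.left.length + 1)
  | cup {i : ℕ} {x : Slice} (hx : D[i]? = some x)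
      (hc : x.elem = Elem.cupUpDown ∨ x.elem = Elem.cupDownUp) :
      StrandPiece D (i + 1, x.left.length) (i + 1, x.left.length + 1)

/-- A diagram of a long knot: a `(1,1)`-tangle diagram from one upward strand to one upward
strand that consists of a single component.  It presents the oriented knot that is its closure;
conversely each diagram of a knot on the sphere, broken at any of its points, gives such a
diagram with the same crossings, because the point may be moved to infinity. -/
structure LongKnotDiagram where
  /-- the slices, from bottom to top -/
  slices : List Slice
  /-- consecutive slices fit together, and the lower and the upper end is one upward strand -/
  composable : Composable [Dir.up] slices [Dir.up]
  /-- each strand point of the diagram lies on the component of the lower end `(0, 0)` -/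
  single_component : ∀ (i j : ℕ) (x : Slice), slices[i]? = some x → j < x.src.length →
    Relation.EqvGen (StrandPiece slices) (0, 0) (i, j)

/-- The number of crossings. -/
def LongKnotDiagram.crossings (K : LongKnotDiagram) : ℕ :=
  (K.slices.map fun x => x.elem.crossings).sum

/-- The writhe: the number of positive crossings minus the number of negative crossings. -/
def LongKnotDiagram.writhe (K : LongKnotDiagram) : ℤ :=
  (K.slices.map fun x => x.elem.sign).sum

/-! ### The state sum

Strands are colored by `0, 1, …, n - 1`, the indices of a weight basis `e_0, …, e_{n-1}` of the
`n`-dimensional irreducible representation of quantum `sl₂` (upward strands) and of the dual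
basis of its dual (downward strands); `e_a` has weight `n - 1 - 2 a`. -/

/-- The local weight of an elementary piece, given the colors below and above it.
A positive crossing maps `e_a ⊗ e_b` to the sum of `R₊(n; a, b, k) e_{b+k} ⊗ e_{a-k}`, a negative
one to the sum of `R₋(n; a, b, k) e_{b-k} ⊗ e_{a+k}`.  The color is constant along caps and cups;
two of these are the (co)evaluation of the dual, and the other two carry the power of `v` that
comes from the action of the pivotal element. -/
def Elem.weight (n : ℕ) : Elem → List ℕ → List ℕ → ℤ[T;T⁻¹]
  | posCrossing, [a, b], [c, d] =>
      ∑ k ∈ Finset.range n, if c = b + k ∧ a = d + k then Rplus n a b k else 0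
  | negCrossing, [a, b], [c, d] =>
      ∑ k ∈ Finset.range n, if b = c + k ∧ d = a + k then Rminus n a b k else 0
  | capUpDown, [a, b], [] =>
      if a = b then LaurentPolynomial.T (-(2 * ((n : ℤ) - 1 - 2 * a))) else 0
  | capDownUp, [a, b], [] => if a = b then 1 else 0
  | cupUpDown, [], [c, d] => if c = d then 1 else 0
  | cupDownUp, [], [c, d] =>
      if c = d then LaurentPolynomial.T (2 * ((n : ℤ) - 1 - 2 * c)) else 0
  | _, _, _ => 0

/-- The weight of a slice, given the colors on its lower and on its upper boundary line: colors
are constant along the vertical strands. -/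
def Slice.weight (n : ℕ) (s : Slice) (x y : List ℕ) : ℤ[T;T⁻¹] :=
  if x.take s.left.length = y.take s.left.length ∧
      x.drop (s.left.length + s.elem.src.length) = y.drop (s.left.length + s.elem.tgt.length) then
    s.elem.weight n ((x.drop s.left.length).take s.elem.src.length)
      ((y.drop s.left.length).take s.elem.tgt.length)
  else 0

/-- The state sum of a diagram with the colors `x` on its lower and `y` on its upper boundary: the
sum, over all colorings by `0, …, n - 1` of the horizontal lines in between, of the product of the
weights of the slices. -/
def stateSum (n : ℕ) : List Slice → List ℕ → List ℕ → ℤ[T;T⁻¹]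
  | [], x, y => if x = y then 1 else 0
  | s :: D, x, y =>
      ∑ z : Fin s.tgt.length → Fin n,
        s.weight n x (List.ofFn fun i => (z i : ℕ))
          * stateSum n D (List.ofFn fun i => (z i : ℕ)) y

/-- The `n`-th colored Jones polynomial, for `n ≥ 1`, with value `1` at the unknot: the state sum
with color `0` on both ends of the long knot, times `v ^ (w (n² - 1) / 2)`, where `w` is the
writhe, which makes it independent of the framing of the diagram. -/
def LongKnotDiagram.coloredJones (K : LongKnotDiagram) (n : ℕ) : ℤ[T;T⁻¹] :=
  LaurentPolynomial.T (K.writhe * ((n : ℤ) ^ 2 - 1)) * stateSum n K.slices [0] [0]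

end ColoredJones

end

open LaurentPolynomial (T)

noncomputable section

namespace ColoredJones

/-! ### The `l¹`-norm -/

/-! A crossing at which the colors change by `k` contributes, up to a sign and a monomial, a quantum
binomial coefficient of norm at most `2 ^ n` times `k` factors `{·}` of norm at most `2`. So its
norm is at most `4 ^ n`, and it is exactly `1` when `k = 0`. Caps and cups contribute monomials.
Along the knot the color changes only at crossings, hence a state is determined by its color at one
point and by the changes `k < n` at the crossings. Counting states in the given state sum would lead
to the exponent `c + 2`; two crossings are saved by cutting the knot at a better place, with a
better color.

That the cut and its color are free is `stateSum_eq_cut`. The local weights commute with one raising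
generator `E` of quantum `sl₂`, with coproduct `E ⊗ 1 + G ⊗ E`, and preserve weights
(`Slice.op_comm`, `Slice.lineWeight_eq`). For an operator `B` commuting with `E`, the trace of `B
[Y, E]` vanishes for every `Y`. Choosing `Y` as a matrix unit on one strand, twisted by `G⁻¹` on the
strands to its right, shows that the partial quantum trace over all other strands does not depend on
the color of that strand (`partialTrace_succ`). Neither the lowering generator nor Schur's lemma is
needed. Consequently left and right quantum traces agree, both being the quantum dimension times the
partial trace; cyclicity of the trace, followed by cancelling the quantum dimension, moves the cut.

The cut is chosen in `exists_forcing`. The knot passes each crossing twice, once with a decrease and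
once with an increase of the color by the same `k`. Between an increase at one crossing and a
decrease at another, the color `0` forces both changes to vanish; between a decrease and an increase
at different crossings the color `n - 1` does so. If no such place exists, a decrease is followed by
an increase at the same crossing, and then by an increase at a second one; the color `n - 1` after
the decrease kills both changes. Thus at most `n ^ c` states remain, each of norm at most `4 ^ (c *
n)`. -/

theorem l1Norm_eq_sum {f : ℤ[T;T⁻¹]} {s : Finset ℤ} (h : f.coeff.support ⊆ s) :
    l1Norm f = ∑ k ∈ s, |f.coeff k| := by
  refine Finset.sum_subset h fun k _ hk => ?_
  simpa using hk

theorem l1Norm_nonneg (f : ℤ[T;T⁻¹]) : 0 ≤ l1Norm f :=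
  Finset.sum_nonneg fun _ _ => abs_nonneg _

@[simp] theorem l1Norm_zero : l1Norm 0 = 0 := by simp [l1Norm]

theorem l1Norm_add_le (f g : ℤ[T;T⁻¹]) : l1Norm (f + g) ≤ l1Norm f + l1Norm g := by
  have hs : (f + g).coeff.support ⊆ f.coeff.support ∪ g.coeff.support := by
    rw [AddMonoidAlgebra.coeff_add]; exact Finsupp.support_add
  rw [l1Norm_eq_sum hs, l1Norm_eq_sum (Finset.subset_union_left (s₂ := g.coeff.support)),
    l1Norm_eq_sum (Finset.subset_union_right (s₁ := f.coeff.support)), ← Finset.sum_add_distrib]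
  exact Finset.sum_le_sum fun k _ => abs_add_le _ _

theorem l1Norm_sum_le {ι : Type*} (s : Finset ι) (f : ι → ℤ[T;T⁻¹]) :
    l1Norm (∑ i ∈ s, f i) ≤ ∑ i ∈ s, l1Norm (f i) :=
  Finset.le_sum_of_subadditive l1Norm l1Norm_zero.le l1Norm_add_le s f

/-- A monomial factor translates the exponents. Only an inclusion of supports is used, so `c = 0`
needs no separate treatment. -/
theorem l1Norm_single_mul (m c : ℤ) (f : ℤ[T;T⁻¹]) :
    l1Norm (AddMonoidAlgebra.single m c * f) = |c| * l1Norm f := by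
  have hs : (AddMonoidAlgebra.single m c * f).coeff.support ⊆
      f.coeff.support.map (addLeftEmbedding m) := by
    intro k hk
    rw [Finsupp.mem_support_iff, AddMonoidAlgebra.coeff_single_mul_apply] at hk
    refine Finset.mem_map.2 ⟨-m + k, ?_, by simp⟩
    exact Finsupp.mem_support_iff.2 (right_ne_zero_of_mul hk)
  rw [l1Norm_eq_sum hs, Finset.sum_map, l1Norm, Finset.mul_sum]
  refine Finset.sum_congr rfl fun k _ => ?_
  rw [AddMonoidAlgebra.coeff_single_mul_apply, abs_mul, addLeftEmbedding_apply, neg_add_cancel_left]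

theorem l1Norm_mul_le (f g : ℤ[T;T⁻¹]) : l1Norm (f * g) ≤ l1Norm f * l1Norm g := by
  have hf : f = ∑ k ∈ f.coeff.support, AddMonoidAlgebra.single k (f.coeff k) :=
    (AddMonoidAlgebra.sum_coeff_single f).symm
  calc l1Norm (f * g)
      = l1Norm (∑ k ∈ f.coeff.support, AddMonoidAlgebra.single k (f.coeff k) * g) := by
        rw [← Finset.sum_mul, ← hf]
    _ ≤ _ := l1Norm_sum_le _ _
    _ = l1Norm f * l1Norm g := by simp_rw [l1Norm_single_mul, ← Finset.sum_mul]; rfl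

@[simp] theorem l1Norm_T_mul (m : ℤ) (f : ℤ[T;T⁻¹]) : l1Norm (T m * f) = l1Norm f := by
  rw [T, l1Norm_single_mul, abs_one, one_mul]

@[simp] theorem l1Norm_one : l1Norm 1 = 1 := by
  have hs : (1 : ℤ[T;T⁻¹]).coeff.support ⊆ {0} := by
    rw [AddMonoidAlgebra.one_def, AddMonoidAlgebra.coeff_single]
    exact Finsupp.support_single_subset
  rw [l1Norm_eq_sum hs, Finset.sum_singleton, AddMonoidAlgebra.coeff_one_zero, abs_one]

@[simp] theorem l1Norm_T (m : ℤ) : l1Norm (T m) = 1 := by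
  rw [← mul_one (T m), l1Norm_T_mul, l1Norm_one]

@[simp] theorem l1Norm_neg (f : ℤ[T;T⁻¹]) : l1Norm (-f) = l1Norm f := by
  simp [l1Norm]

theorem l1Norm_qInt_le (a : ℤ) : l1Norm (qInt a) ≤ 2 := by
  rw [qInt, sub_eq_add_neg]
  refine (l1Norm_add_le _ _).trans ?_
  simp

theorem l1Norm_qFalling_le (a : ℤ) (k : ℕ) : l1Norm (qFalling a k) ≤ 2 ^ k := by
  induction k with
  | zero => simp [qFalling]
  | succ k ih =>
    rw [qFalling, Finset.prod_range_succ, pow_succ]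
    exact (l1Norm_mul_le _ _).trans
      (mul_le_mul ih (l1Norm_qInt_le _) (l1Norm_nonneg _) (by positivity))

/-- The quantum Pascal rule differs from the ordinary one only by monomial factors, which do not
affect the norm. -/
theorem l1Norm_qBinom_le (m : ℕ) : ∀ k, l1Norm (qBinom m k) ≤ m.choose k := by
  induction m with
  | zero => intro k; cases k <;> simp [qBinom]
  | succ m ih =>
    intro k
    cases k with
    | zero => simp [qBinom]
    | succ k =>
      rw [qBinom, Nat.choose_succ_succ, add_comm, Nat.cast_add]
      refine (l1Norm_add_le _ _).trans ?_
      rw [l1Norm_T_mul, l1Norm_T_mul]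
      exact add_le_add (ih k) (ih (k + 1))

/-! ### Norms of the `R`-matrix weights -/

theorem l1Norm_qBinom_mul_qFalling_le {n m k : ℕ} (a : ℤ) (hm : m < n) (hk : k < n) :
    l1Norm (qBinom m k * qFalling a k) ≤ 4 ^ n := by
  have h1 : l1Norm (qBinom m k) ≤ 2 ^ n := by
    refine (l1Norm_qBinom_le m k).trans ?_
    exact_mod_cast (Nat.choose_le_two_pow m k).trans (Nat.pow_le_pow_right (by norm_num) hm.le)
  have h2 : l1Norm (qFalling a k) ≤ 2 ^ n :=
    (l1Norm_qFalling_le a k).trans (pow_le_pow_right₀ (by norm_num) hk.le)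
  calc _ ≤ _ := l1Norm_mul_le _ _
    _ ≤ 2 ^ n * 2 ^ n := mul_le_mul h1 h2 (l1Norm_nonneg _) (by positivity)
    _ = 4 ^ n := by rw [← mul_pow]; norm_num

/-- The hypothesis says that the outgoing color `b + k` is admissible; it bounds both the binomial
coefficient and the number `k` of factors in the falling product. -/
theorem l1Norm_Rplus_le {n a b k : ℕ} (hm : b + k < n) : l1Norm (Rplus n a b k) ≤ 4 ^ n := by
  rw [Rplus, mul_assoc, mul_assoc]
  rcases neg_one_pow_eq_or ℤ[T;T⁻¹] k with h | h <;> rw [h]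
  · rw [one_mul, l1Norm_T_mul]
    exact l1Norm_qBinom_mul_qFalling_le _ hm (by omega)
  · rw [neg_one_mul, l1Norm_neg, l1Norm_T_mul]
    exact l1Norm_qBinom_mul_qFalling_le _ hm (by omega)

theorem l1Norm_Rminus_le {n a b k : ℕ} (hm : a + k < n) : l1Norm (Rminus n a b k) ≤ 4 ^ n := by
  rw [Rminus, mul_assoc, l1Norm_T_mul]
  exact l1Norm_qBinom_mul_qFalling_le _ hm (by omega)

/-- Without a change of colors the weight is a monomial; this is why a forced crossing costs
nothing. -/
theorem l1Norm_Rplus_zero (n a b : ℕ) : l1Norm (Rplus n a b 0) = 1 := by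
  simp [Rplus, qFalling, qBinom_zero_right]

theorem l1Norm_Rminus_zero (n a b : ℕ) : l1Norm (Rminus n a b 0) = 1 := by
  simp [Rminus, qFalling, qBinom_zero_right]

/-! ### Quantum binomial identities -/

theorem qInt_ne_zero {a : ℤ} (ha : a ≠ 0) : qInt a ≠ 0 := by
  intro h
  have := congrArg (fun f : ℤ[T;T⁻¹] => f.coeff (2 * a)) h
  simp only [qInt, AddMonoidAlgebra.coeff_sub, Finsupp.coe_sub, Pi.sub_apply,
    LaurentPolynomial.T_apply, AddMonoidAlgebra.coeff_zero, Finsupp.coe_zero, Pi.zero_apply] at this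
  norm_num [show -(2 * a) ≠ 2 * a by omega] at this

theorem qInt_zero : qInt 0 = 0 := by simp [qInt]

theorem qFactorial_ne_zero (m : ℕ) : qFactorial m ≠ 0 :=
  Finset.prod_ne_zero_iff.2 fun i _ => qInt_ne_zero (by omega)

/-- The second quantum Pascal rule. -/
theorem qBinom_succ_succ' (b k : ℕ) :
    qBinom (b + k + 1) (k + 1) =
      T (-(2 * ((k : ℤ) + 1))) * qBinom (b + k) (k + 1) + T (2 * (b : ℤ)) * qBinom (b + k) k := by
  have h0 := qBinom_mul k b
  have h1 := qBinom_mul (k + 1) b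
  have key : T (-(2 * ((k : ℤ) + 1))) * qInt b + T (2 * (b : ℤ)) * qInt (k + 1)
      = qInt (b + k + 1) := by
    simp only [qInt, mul_sub, ← LaurentPolynomial.T_add]
    ring_nf
  refine mul_right_cancel₀
    (mul_ne_zero (qFactorial_ne_zero (k + 1)) (qFactorial_ne_zero b)) ?_
  rw [show b + k + 1 = k + 1 + b by omega, h1, show k + 1 + b = k + b + 1 by omega, qFactorial_succ,
    show b + k = k + b by omega]
  have hc : (((k + b : ℕ) : ℤ) + 1) = b + k + 1 := by push_cast; ring
  rw [hc, ← key]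
  cases b with
  | zero =>
    rw [qBinom_eq_zero (k + 0) (k + 1) (by omega)]
    have h0' : qInt ((0 : ℕ) : ℤ) = 0 := by simp [qInt]
    rw [h0', ← h0, qFactorial_succ k]; ring
  | succ b =>
    have h2 := qBinom_mul (k + 1) b
    rw [show k + 1 + b = k + (b + 1) by omega] at h2
    rw [qFactorial_succ k] at h2 ⊢
    rw [qFactorial_succ b] at h0 ⊢
    push_cast at h0 h2 ⊢
    linear_combination
      -(T (-(2 * ((k : ℤ) + 1))) * qInt ((b : ℤ) + 1)) * h2
        - (T (2 * ((b : ℤ) + 1)) * qInt ((k : ℤ) + 1)) * h0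

theorem qBinom_succ_succ (b k : ℕ) :
    qBinom (b + k + 1) (k + 1) =
      T (2 * ((k : ℤ) + 1)) * qBinom (b + k) (k + 1) + T (-(2 * (b : ℤ))) * qBinom (b + k) k := by
  rw [qBinom]
  push_cast
  rw [add_sub_cancel_right]

theorem qFalling_succ (a : ℤ) (k : ℕ) : qFalling a (k + 1) = qFalling a k * qInt (a - k) := by
  rw [qFalling, Finset.prod_range_succ]; rfl

theorem qFalling_succ' (a : ℤ) (k : ℕ) :
    qFalling (a + 1) (k + 1) = qInt (a + 1) * qFalling a k := by
  rw [qFalling, Finset.prod_range_succ', mul_comm]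
  congr 1
  · simp
  · refine Finset.prod_congr rfl fun i _ => ?_
    push_cast; congr 1; ring

/-- The two powers of `v` in the quantum integer on the left are expanded by the two different
Pascal rules; the resulting exponents are opposite to each other and recombine to quantum integers.
-/
theorem qInt_mul_qBinom (N : ℤ) (b k : ℕ) :
    qInt (N - (b + k + 1)) * qBinom (b + k + 1) (k + 1) =
      qInt (N - b) * qBinom (b + k) (k + 1) + qInt (N - 2 * b - k - 1) * qBinom (b + k) k := by
  conv_lhs => rw [qInt, sub_mul]
  rw [show T (2 * (N - (b + k + 1))) * qBinom (b + k + 1) (k + 1) = _ from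
    congrArg _ (qBinom_succ_succ b k), qBinom_succ_succ' b k]
  simp only [mul_add, ← mul_assoc, ← LaurentPolynomial.T_add, qInt, sub_mul]
  ring_nf

/-! ### Commutation of the `R`-matrices with the raising operator -/

/-- This is the matrix entry of the commutation of the positive crossing with `E ⊗ 1 + G ⊗ E`, for
colors `a + k + 1, b` below and `b + k, a` above. All four terms share a falling product and, up to
units, a power of `v`; what remains is `qInt_mul_qBinom`. -/
theorem Rplus_comm (n a b k : ℕ) :
    qInt (n - (a + k + 1 : ℕ)) * Rplus n (a + k) b k
      + T (2 * ((n : ℤ) - 1 - 2 * (a + k + 1 : ℕ)))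
        * (if b = 0 then 0 else qInt (n - b) * Rplus n (a + k + 1) (b - 1) (k + 1)) =
    Rplus n (a + k + 1) b (k + 1) * qInt (n - (b + k + 1 : ℕ))
      + Rplus n (a + k + 1) b k
        * (T (2 * ((n : ℤ) - 1 - 2 * (b + k : ℕ))) * qInt (n - (a + 1 : ℕ))) := by
  -- The case distinction disappears because the binomial coefficient `qBinom k (k + 1)` vanishes
  -- for `b = 0`.
  have hW : (if b = 0 then 0 else qInt (n - b) * Rplus n (a + k + 1) (b - 1) (k + 1)) =
      qInt (n - b) * ((-1) ^ (k + 1) * T (-(((n : ℤ) - 1 - 2 * (a + k + 1 : ℕ)) *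
        ((n : ℤ) - 1 - 2 * (b - 1)) + ((k + 1 : ℕ) : ℤ) * ((k + 1 : ℕ) - 1)))
        * qBinom (b + k) (k + 1)
        * qFalling ((n : ℤ) - 1 + (k + 1 : ℕ) - (a + k + 1 : ℕ)) (k + 1)) := by
    cases b with
    | zero => rw [qBinom_eq_zero (0 + k) (k + 1) (by omega)]; simp
    | succ b =>
      rw [if_neg (by omega), Rplus, show b + 1 - 1 = b by omega,
        show b + 1 + k = b + (k + 1) by omega]
      push_cast
      simp only [add_sub_cancel_right]
  rw [hW]
  simp only [Rplus]
  have f1 : (n : ℤ) - 1 + (k + 1 : ℕ) - (a + k + 1 : ℕ) = n - 1 - a := by push_cast; ring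
  have f2 : (n : ℤ) - 1 + k - (a + k : ℕ) = n - 1 - a := by push_cast; ring
  have f3 : (n : ℤ) - 1 + k - (a + k + 1 : ℕ) = n - 2 - a := by push_cast; ring
  rw [f1, f2, f3]
  have g1 : qFalling ((n : ℤ) - 1 - a) k * qInt (n - (a + k + 1 : ℕ)) =
      qFalling ((n : ℤ) - 1 - a) (k + 1) := by
    rw [qFalling_succ]; congr 2; push_cast; ring
  have g2 : qInt (n - (a + 1 : ℕ)) * qFalling ((n : ℤ) - 2 - a) k =
      qFalling ((n : ℤ) - 1 - a) (k + 1) := by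
    rw [show (n : ℤ) - 1 - a = (n - 2 - a) + 1 by ring, qFalling_succ']
    congr 2; push_cast; ring
  have hB := qInt_mul_qBinom n b k
  generalize qFalling ((n : ℤ) - 1 - a) (k + 1) = Q at *
  set u : ℤ := -(((n : ℤ) - 1 - 2 * (a + k + 1 : ℕ)) * ((n : ℤ) - 1 - 2 * b)
    + ((k + 1 : ℕ) : ℤ) * ((k + 1 : ℕ) - 1)) with hu
  have t1 : T (2 * ((n : ℤ) - 1 - 2 * (a + k + 1 : ℕ))) *
      T (-(((n : ℤ) - 1 - 2 * (a + k + 1 : ℕ)) * ((n : ℤ) - 1 - 2 * (b - 1))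
        + ((k + 1 : ℕ) : ℤ) * ((k + 1 : ℕ) - 1))) = (T u : ℤ[T;T⁻¹]) := by
    rw [← LaurentPolynomial.T_add, hu]; congr 1; push_cast; ring
  -- The two terms with shift `k` carry the same binomial coefficient; the difference of their
  -- powers of `v` is the second quantum integer in `qInt_mul_qBinom`.
  have t2 : T (-(((n : ℤ) - 1 - 2 * (a + k : ℕ)) * ((n : ℤ) - 1 - 2 * b) + (k : ℤ) * (k - 1)))
      - T (2 * ((n : ℤ) - 1 - 2 * (b + k : ℕ))) *
        T (-(((n : ℤ) - 1 - 2 * (a + k + 1 : ℕ)) * ((n : ℤ) - 1 - 2 * b) + (k : ℤ) * (k - 1)))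
      = - (T u * qInt (n - 2 * b - k - 1)) := by
    rw [qInt, mul_sub (T u), ← LaurentPolynomial.T_add, ← LaurentPolynomial.T_add,
      ← LaurentPolynomial.T_add, neg_sub, hu]
    congr 2 <;> push_cast <;> ring
  rw [show b + (k + 1) = b + k + 1 by omega]
  push_cast at *
  generalize (T u : ℤ[T;T⁻¹]) = U at *
  linear_combination
    (-1) ^ k * T (-(((n : ℤ) - 1 - 2 * (a + k)) * ((n : ℤ) - 1 - 2 * b) + (k : ℤ) * (k - 1)))
        * qBinom (b + k) k * g1
      - (-1) ^ k * T (-(((n : ℤ) - 1 - 2 * (a + k + 1)) * ((n : ℤ) - 1 - 2 * b)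
        + (k : ℤ) * (k - 1))) * T (2 * ((n : ℤ) - 1 - 2 * (b + k))) * qBinom (b + k) k * g2
      + (-1) ^ k * qBinom (b + k) k * Q * t2
      - (-1) ^ k * qInt (n - b) * qBinom (b + k) (k + 1) * Q * t1
      + (-1) ^ k * U * Q * hB

/-- The analogous matrix entry for the negative crossing, with colors `a, b + k + 1` below and `b, a
+ k` above. -/
theorem Rminus_comm (n a b k : ℕ) :
    (if a = 0 then 0 else qInt (n - a) * Rminus n (a - 1) (b + k + 1) (k + 1))
      + T (2 * ((n : ℤ) - 1 - 2 * a))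
        * (qInt (n - (b + k + 1 : ℕ)) * Rminus n a (b + k) k) =
    Rminus n a (b + k + 1) k * qInt (n - (b + 1 : ℕ))
      + Rminus n a (b + k + 1) (k + 1)
        * (T (2 * ((n : ℤ) - 1 - 2 * b)) * qInt (n - (a + k + 1 : ℕ))) := by
  have hW : (if a = 0 then 0 else qInt (n - a) * Rminus n (a - 1) (b + k + 1) (k + 1)) =
      qInt (n - a) * (T (((n : ℤ) - 1 - 2 * (a - 1) - 2 * (k + 1 : ℕ)) *
        ((n : ℤ) - 1 - 2 * (b + k + 1 : ℕ) + 2 * (k + 1 : ℕ))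
          + ((k + 1 : ℕ) : ℤ) * ((k + 1 : ℕ) - 1))
        * qBinom (a + k) (k + 1)
        * qFalling ((n : ℤ) - 1 + (k + 1 : ℕ) - (b + k + 1 : ℕ)) (k + 1)) := by
    cases a with
    | zero => rw [qBinom_eq_zero (0 + k) (k + 1) (by omega)]; simp
    | succ a =>
      rw [if_neg (by omega), Rminus, show a + 1 - 1 = a by omega,
        show a + 1 + k = a + (k + 1) by omega]
      push_cast
      simp only [add_sub_cancel_right]
  rw [hW]
  simp only [Rminus]
  have f1 : (n : ℤ) - 1 + (k + 1 : ℕ) - (b + k + 1 : ℕ) = n - 1 - b := by push_cast; ring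
  have f2 : (n : ℤ) - 1 + k - (b + k : ℕ) = n - 1 - b := by push_cast; ring
  have f3 : (n : ℤ) - 1 + k - (b + k + 1 : ℕ) = n - 2 - b := by push_cast; ring
  rw [f1, f2, f3]
  have g1 : qFalling ((n : ℤ) - 1 - b) k * qInt (n - (b + k + 1 : ℕ)) =
      qFalling ((n : ℤ) - 1 - b) (k + 1) := by
    rw [qFalling_succ]; congr 2; push_cast; ring
  have g2 : qInt (n - (b + 1 : ℕ)) * qFalling ((n : ℤ) - 2 - b) k =
      qFalling ((n : ℤ) - 1 - b) (k + 1) := by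
    rw [show (n : ℤ) - 1 - b = (n - 2 - b) + 1 by ring, qFalling_succ']
    congr 2; push_cast; ring
  have hB := qInt_mul_qBinom n a k
  generalize qFalling ((n : ℤ) - 1 - b) (k + 1) = Q at *
  set u : ℤ := ((n : ℤ) - 1 - 2 * (a - 1) - 2 * (k + 1 : ℕ)) *
        ((n : ℤ) - 1 - 2 * (b + k + 1 : ℕ) + 2 * (k + 1 : ℕ))
          + ((k + 1 : ℕ) : ℤ) * ((k + 1 : ℕ) - 1) with hu
  have t1 : T (((n : ℤ) - 1 - 2 * a - 2 * (k + 1 : ℕ)) *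
        ((n : ℤ) - 1 - 2 * (b + k + 1 : ℕ) + 2 * (k + 1 : ℕ))
          + ((k + 1 : ℕ) : ℤ) * ((k + 1 : ℕ) - 1)) * T (2 * ((n : ℤ) - 1 - 2 * b))
      = (T u : ℤ[T;T⁻¹]) := by
    rw [← LaurentPolynomial.T_add, hu]; congr 1; push_cast; ring
  have t2 : T (((n : ℤ) - 1 - 2 * a - 2 * k) *
        ((n : ℤ) - 1 - 2 * (b + k + 1 : ℕ) + 2 * k) + (k : ℤ) * (k - 1))
      - T (2 * ((n : ℤ) - 1 - 2 * a)) *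
        T (((n : ℤ) - 1 - 2 * a - 2 * k) *
          ((n : ℤ) - 1 - 2 * (b + k : ℕ) + 2 * k) + (k : ℤ) * (k - 1))
      = - (T u * qInt (n - 2 * a - k - 1)) := by
    rw [qInt, mul_sub (T u), ← LaurentPolynomial.T_add, ← LaurentPolynomial.T_add,
      ← LaurentPolynomial.T_add, neg_sub, hu]
    congr 2 <;> push_cast <;> ring
  rw [show a + (k + 1) = a + k + 1 by omega]
  push_cast at *
  generalize (T u : ℤ[T;T⁻¹]) = U at *
  linear_combination
    T (2 * ((n : ℤ) - 1 - 2 * a)) * T (((n : ℤ) - 1 - 2 * a - 2 * k) *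
          ((n : ℤ) - 1 - 2 * (b + k) + 2 * k) + (k : ℤ) * (k - 1)) * qBinom (a + k) k * g1
      - T (((n : ℤ) - 1 - 2 * a - 2 * k) *
        ((n : ℤ) - 1 - 2 * (b + k + 1) + 2 * k) + (k : ℤ) * (k - 1)) * qBinom (a + k) k * g2
      - qBinom (a + k) k * Q * t2
      - qInt (n - (a + k + 1)) * qBinom (a + k + 1) (k + 1) * Q * t1
      - U * Q * hB

/-! ### Colorings of a horizontal line -/

/-- The colorings of `m` points by `0, …, n - 1`. -/
def colorings (n m : ℕ) : Finset (List ℕ) :=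
  Finset.univ.image fun z : Fin m → Fin n => List.ofFn fun i => (z i : ℕ)

theorem mem_colorings {n m : ℕ} {x : List ℕ} :
    x ∈ colorings n m ↔ x.length = m ∧ ∀ a ∈ x, a < n := by
  simp only [colorings, Finset.mem_image, Finset.mem_univ, true_and]
  constructor
  · rintro ⟨z, rfl⟩
    refine ⟨by simp, fun a ha => ?_⟩
    obtain ⟨i, rfl⟩ := (List.mem_ofFn' _ _).1 ha
    exact (z i).2
  · rintro ⟨rfl, h⟩
    exact ⟨fun i => ⟨x[i], h _ (List.getElem_mem _)⟩, by simp⟩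

/-- Colorings as a finite set of lists can be concatenated and split without casts between `Fin`
types. -/
theorem sum_ofFn_eq_sum_colorings {M : Type*} [AddCommMonoid M] (n m : ℕ) (F : List ℕ → M) :
    ∑ z : Fin m → Fin n, F (List.ofFn fun i => (z i : ℕ)) = ∑ z ∈ colorings n m, F z := by
  rw [colorings, Finset.sum_image]
  intro z _ z' _ h
  funext i
  exact Fin.ext (congrFun (List.ofFn_injective h) i)

@[simp] theorem colorings_zero (n : ℕ) : colorings n 0 = {[]} := by
  ext x
  simp only [mem_colorings, List.length_eq_zero_iff, Finset.mem_singleton]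
  exact ⟨fun h => h.1, fun h => ⟨h, by simp [h]⟩⟩

theorem cons_mem_colorings {n m a : ℕ} {x : List ℕ} :
    a :: x ∈ colorings n (m + 1) ↔ a < n ∧ x ∈ colorings n m := by
  simp [mem_colorings]; tauto

theorem append_mem_colorings {n m k : ℕ} {x y : List ℕ} (hx : x ∈ colorings n m)
    (hy : y ∈ colorings n k) : x ++ y ∈ colorings n (m + k) := by
  rw [mem_colorings] at *
  refine ⟨by simp [hx.1, hy.1], fun a ha => ?_⟩
  rcases List.mem_append.1 ha with h | h
  exacts [hx.2 a h, hy.2 a h]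

theorem exists_append_of_mem_colorings {n m k : ℕ} {x : List ℕ} (hx : x ∈ colorings n (m + k)) :
    ∃ y ∈ colorings n m, ∃ z ∈ colorings n k, x = y ++ z := by
  rw [mem_colorings] at hx
  refine ⟨x.take m, mem_colorings.2 ⟨by simp [hx.1], fun a ha => hx.2 a (List.mem_of_mem_take ha)⟩,
    x.drop m, mem_colorings.2 ⟨by simp [hx.1], fun a ha => hx.2 a (List.mem_of_mem_drop ha)⟩,
    (List.take_append_drop m x).symm⟩

theorem sum_colorings_succ {M : Type*} [AddCommMonoid M] (n m : ℕ) (F : List ℕ → M) :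
    ∑ z ∈ colorings n (m + 1), F z = ∑ a ∈ Finset.range n, ∑ x ∈ colorings n m, F (a :: x) := by
  rw [← Finset.sum_product']
  symm
  refine Finset.sum_bij (fun p _ => p.1 :: p.2) ?_ ?_ ?_ ?_
  · rintro ⟨a, x⟩ h
    simpa [cons_mem_colorings] using h
  · rintro ⟨a, x⟩ _ ⟨b, y⟩ _ h
    simpa using h
  · intro z hz
    cases z with
    | nil => simp [mem_colorings] at hz
    | cons a x => exact ⟨(a, x), by simpa [cons_mem_colorings] using hz, rfl⟩
  · intros; rfl

theorem sum_colorings_add {M : Type*} [AddCommMonoid M] (n m k : ℕ) (F : List ℕ → M) :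
    ∑ z ∈ colorings n (m + k), F z =
      ∑ x ∈ colorings n m, ∑ y ∈ colorings n k, F (x ++ y) := by
  induction m generalizing F with
  | zero => simp
  | succ m ih =>
    rw [show m + 1 + k = m + k + 1 by omega, sum_colorings_succ, sum_colorings_succ]
    exact Finset.sum_congr rfl fun a _ => by rw [ih]; rfl

theorem sum_colorings_one {M : Type*} [AddCommMonoid M] (n : ℕ) (F : List ℕ → M) :
    ∑ z ∈ colorings n 1, F z = ∑ a ∈ Finset.range n, F [a] := by
  rw [sum_colorings_succ]; simp

theorem sum_colorings_two {M : Type*} [AddCommMonoid M] (n : ℕ) (F : List ℕ → M) :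
    ∑ z ∈ colorings n 2, F z = ∑ a ∈ Finset.range n, ∑ b ∈ Finset.range n, F [a, b] := by
  rw [sum_colorings_succ]; simp [sum_colorings_one]

/-! ### The action of the quantum group

Functions of the colors are the dual of the space spanned by the colorings.  The operators below
describe the action of one raising generator, with coproduct `E ⊗ 1 + G ⊗ E`, and the weights,
which give the action of the group-like generator `G`. -/

/-- The weight of a color on a strand. -/
def strandWeight (n : ℕ) : Dir → ℕ → ℤ
  | Dir.up, a => (n : ℤ) - 1 - 2 * a
  | Dir.down, a => -((n : ℤ) - 1 - 2 * a)

/-- The weight of a coloring of a horizontal line. -/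
def lineWeight (n : ℕ) : List Dir → List ℕ → ℤ
  | d :: s, a :: x => strandWeight n d a + lineWeight n s x
  | _, _ => 0

/-- The action of the raising generator on functions of the color of one strand. -/
def raiseStrand (n : ℕ) : Dir → (ℕ → ℤ[T;T⁻¹]) → ℕ → ℤ[T;T⁻¹]
  | Dir.up, _, 0 => 0
  | Dir.up, g, a + 1 => qInt ((n : ℤ) - (a + 1 : ℕ)) * g a
  | Dir.down, g, a => -(T (-(2 * ((n : ℤ) - 1 - 2 * a))) * qInt ((n : ℤ) - (a + 1 : ℕ)) * g (a + 1))

/-- The action of the raising generator on functions of the colors of a horizontal line. -/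
def raiseLine (n : ℕ) : List Dir → (List ℕ → ℤ[T;T⁻¹]) → List ℕ → ℤ[T;T⁻¹]
  | d :: s, f, a :: x =>
      raiseStrand n d (fun b => f (b :: x)) a
        + T (2 * strandWeight n d a) * raiseLine n s (fun y => f (a :: y)) x
  | _, _, _ => 0

theorem raiseStrand_congr {n : ℕ} {d : Dir} {g g' : ℕ → ℤ[T;T⁻¹]} {a : ℕ} (ha : a < n)
    (h : ∀ b < n, g b = g' b) : raiseStrand n d g a = raiseStrand n d g' a := by
  cases d with
  | up =>
    cases a with
    | zero => rfl
    | succ a => simp only [raiseStrand]; rw [h a (by omega)]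
  | down =>
    simp only [raiseStrand]
    rcases Nat.lt_or_ge (a + 1) n with h1 | h1
    · rw [h _ h1]
    -- On a downward strand of color `n - 1` the generator would look at the inadmissible color `n`,
    -- but the coefficient is `{0} = 0`.
    · have : (n : ℤ) - (a + 1 : ℕ) = 0 := by omega
      rw [this, qInt_zero]; simp

theorem raiseStrand_mul_left (n : ℕ) (d : Dir) (c : ℤ[T;T⁻¹]) (g : ℕ → ℤ[T;T⁻¹]) (a : ℕ) :
    raiseStrand n d (fun b => c * g b) a = c * raiseStrand n d g a := by
  cases d with
  | up => cases a <;> simp only [raiseStrand] <;> ring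
  | down => simp only [raiseStrand]; ring

theorem raiseStrand_sum {ι : Type*} (n : ℕ) (d : Dir) (s : Finset ι) (g : ι → ℕ → ℤ[T;T⁻¹])
    (a : ℕ) : raiseStrand n d (fun b => ∑ i ∈ s, g i b) a = ∑ i ∈ s, raiseStrand n d (g i) a := by
  cases d with
  | up => cases a <;> simp [raiseStrand, Finset.mul_sum]
  | down => simp [raiseStrand, Finset.mul_sum]

/-- Functions are defined on all lists, but the action never leaves the admissible colorings, so it
descends to functions on these. -/
theorem raiseLine_congr {n : ℕ} {s : List Dir} {f f' : List ℕ → ℤ[T;T⁻¹]} {x : List ℕ}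
    (hx : x ∈ colorings n s.length) (h : ∀ y ∈ colorings n s.length, f y = f' y) :
    raiseLine n s f x = raiseLine n s f' x := by
  induction s generalizing f f' x with
  | nil => rfl
  | cons d s ih =>
    cases x with
    | nil => rfl
    | cons a x =>
      rw [List.length_cons, cons_mem_colorings] at hx
      simp only [raiseLine]
      congr 1
      · exact raiseStrand_congr hx.1 fun b hb => h _ (cons_mem_colorings.2 ⟨hb, hx.2⟩)
      · rw [ih hx.2 fun y hy => h _ (cons_mem_colorings.2 ⟨hx.1, hy⟩)]

theorem raiseLine_mul_left (n : ℕ) (s : List Dir) (c : ℤ[T;T⁻¹]) (f : List ℕ → ℤ[T;T⁻¹])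
    (x : List ℕ) : raiseLine n s (fun y => c * f y) x = c * raiseLine n s f x := by
  induction s generalizing f x with
  | nil => simp [raiseLine]
  | cons d s ih =>
    cases x with
    | nil => simp [raiseLine]
    | cons a x => simp only [raiseLine]; rw [raiseStrand_mul_left, ih]; ring

theorem raiseLine_sum {ι : Type*} (n : ℕ) (s : List Dir) (I : Finset ι)
    (f : ι → List ℕ → ℤ[T;T⁻¹]) (x : List ℕ) :
    raiseLine n s (fun y => ∑ i ∈ I, f i y) x = ∑ i ∈ I, raiseLine n s (f i) x := by
  induction s generalizing f x with
  | nil => simp [raiseLine]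
  | cons d s ih =>
    cases x with
    | nil => simp [raiseLine]
    | cons a x =>
      simp only [raiseLine]
      rw [raiseStrand_sum, ih, Finset.mul_sum, Finset.sum_add_distrib]

theorem lineWeight_append (n : ℕ) {s t : List Dir} {x y : List ℕ} (h : x.length = s.length) :
    lineWeight n (s ++ t) (x ++ y) = lineWeight n s x + lineWeight n t y := by
  induction s generalizing x with
  | nil => rw [List.length_eq_zero_iff.1 h]; simp [lineWeight]
  | cons d s ih =>
    cases x with
    | nil => simp at h
    | cons a x =>
      simp only [List.cons_append, lineWeight]
      rw [ih (by simpa using h)]; ring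

/-- Coassociativity: the coproduct `E ⊗ 1 + G ⊗ E` holds for any division of a line into two blocks.
-/
theorem raiseLine_append (n : ℕ) {s t : List Dir} (f : List ℕ → ℤ[T;T⁻¹]) {x y : List ℕ}
    (h : x.length = s.length) :
    raiseLine n (s ++ t) f (x ++ y) = raiseLine n s (fun z => f (z ++ y)) x
      + T (2 * lineWeight n s x) * raiseLine n t (fun z => f (x ++ z)) y := by
  induction s generalizing x f with
  | nil => rw [List.length_eq_zero_iff.1 h]; simp [lineWeight, raiseLine]
  | cons d s ih =>
    cases x with
    | nil => simp at h
    | cons a x =>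
      simp only [List.cons_append, lineWeight, raiseLine]
      rw [ih _ (by simpa using h), mul_add (2 : ℤ), LaurentPolynomial.T_add]
      ring

/-! ### Equivariance of the elementary pieces -/

/-- The operator of an elementary piece. -/
def Elem.op (n : ℕ) (e : Elem) (f : List ℕ → ℤ[T;T⁻¹]) (x : List ℕ) : ℤ[T;T⁻¹] :=
  ∑ y ∈ colorings n e.tgt.length, e.weight n x y * f y

/-- Shifting the summation index moves `E` from `g` to the matrix `V`. Neither end leaves a boundary
term: `E` gives zero at color `0`, and the term with color `n` has coefficient `{0}`. -/
theorem sum_mul_raiseStrand_up (n : ℕ) (V g : ℕ → ℤ[T;T⁻¹]) :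
    ∑ c ∈ Finset.range n, V c * raiseStrand n Dir.up g c =
      ∑ c ∈ Finset.range n, V (c + 1) * qInt ((n : ℤ) - (c + 1 : ℕ)) * g c := by
  cases n with
  | zero => simp
  | succ n =>
    rw [Finset.sum_range_succ', Finset.sum_range_succ]
    have : ((n + 1 : ℕ) : ℤ) - (n + 1 : ℕ) = 0 := sub_self _
    rw [this, qInt_zero]
    simp [raiseStrand, mul_assoc]

/-- Reduces equivariance of an operator on two upward strands to an identity between its matrix
entries, by transposing `E` on the upper side. -/
theorem crossing_comm {n : ℕ} (W : ℕ → ℕ → ℕ → ℕ → ℤ[T;T⁻¹])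
    (hW : ∀ a b c d : ℕ,
      raiseStrand n Dir.up (fun a' => W a' b c d) a
        + T (2 * strandWeight n Dir.up a) * raiseStrand n Dir.up (fun b' => W a b' c d) b =
      W a b (c + 1) d * qInt ((n : ℤ) - (c + 1 : ℕ))
        + W a b c (d + 1) * (T (2 * strandWeight n Dir.up c) * qInt ((n : ℤ) - (d + 1 : ℕ))))
    (f : List ℕ → ℤ[T;T⁻¹]) (a b : ℕ) :
    raiseStrand n Dir.up (fun a' => ∑ c ∈ Finset.range n, ∑ d ∈ Finset.range n,
        W a' b c d * f [c, d]) a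
      + T (2 * strandWeight n Dir.up a) * raiseStrand n Dir.up
        (fun b' => ∑ c ∈ Finset.range n, ∑ d ∈ Finset.range n, W a b' c d * f [c, d]) b =
    ∑ c ∈ Finset.range n, ∑ d ∈ Finset.range n, W a b c d *
      (raiseStrand n Dir.up (fun c' => f [c', d]) c
        + T (2 * strandWeight n Dir.up c) * raiseStrand n Dir.up (fun d' => f [c, d']) d) := by
  have h1 : ∑ c ∈ Finset.range n, ∑ d ∈ Finset.range n,
      W a b c d * raiseStrand n Dir.up (fun c' => f [c', d]) c =
      ∑ c ∈ Finset.range n, ∑ d ∈ Finset.range n,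
        W a b (c + 1) d * qInt ((n : ℤ) - (c + 1 : ℕ)) * f [c, d] := by
    rw [Finset.sum_comm]
    conv_rhs => rw [Finset.sum_comm]
    exact Finset.sum_congr rfl fun d _ =>
      sum_mul_raiseStrand_up n (fun c => W a b c d) (fun c => f [c, d])
  have h2 : ∑ c ∈ Finset.range n, ∑ d ∈ Finset.range n,
      W a b c d * (T (2 * strandWeight n Dir.up c) *
        raiseStrand n Dir.up (fun d' => f [c, d']) d) =
      ∑ c ∈ Finset.range n, ∑ d ∈ Finset.range n,
        W a b c (d + 1) * (T (2 * strandWeight n Dir.up c) * qInt ((n : ℤ) - (d + 1 : ℕ)))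
          * f [c, d] := by
    refine Finset.sum_congr rfl fun c _ => ?_
    have := sum_mul_raiseStrand_up n (fun d => W a b c d * T (2 * strandWeight n Dir.up c))
      (fun d => f [c, d])
    simp only [mul_assoc] at this ⊢
    exact this
  simp only [mul_add, Finset.sum_add_distrib]
  rw [h1, h2, ← Finset.sum_add_distrib]
  simp only [raiseStrand_sum, Finset.mul_sum, ← Finset.sum_add_distrib]
  refine Finset.sum_congr rfl fun c _ => Finset.sum_congr rfl fun d _ => ?_
  rw [← add_mul, ← hW a b c d, add_mul]
  have h3 : ∀ (V : ℕ → ℤ[T;T⁻¹]) (j : ℕ), raiseStrand n Dir.up (fun i => V i * f [c, d]) j =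
      raiseStrand n Dir.up V j * f [c, d] := by
    intro V j
    rw [mul_comm, ← raiseStrand_mul_left]
    simp only [mul_comm]
  rw [h3, h3, mul_assoc]

/-- The weight of a positive crossing as a matrix. -/
def posMatrix (n a b c d : ℕ) : ℤ[T;T⁻¹] :=
  if b ≤ c ∧ a = d + (c - b) then Rplus n a b (c - b) else 0

/-- The weight of a negative crossing as a matrix. -/
def negMatrix (n a b c d : ℕ) : ℤ[T;T⁻¹] :=
  if c ≤ b ∧ d = a + (b - c) then Rminus n a b (b - c) else 0

/-- The sum over `k` has at most one nonzero term, `k = c - b`; the bound on `c` keeps it in the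
range of summation. -/
theorem weight_posCrossing {n a b c d : ℕ} (hc : c < n) :
    Elem.posCrossing.weight n [a, b] [c, d] = posMatrix n a b c d := by
  simp only [Elem.weight, posMatrix]
  split_ifs with h
  · rw [Finset.sum_eq_single (c - b)]
    · rw [if_pos (by omega)]
    · intro k _ hk; rw [if_neg (by omega)]
    · intro hk; simp at hk; omega
  · exact Finset.sum_eq_zero fun k _ => if_neg (by omega)

theorem weight_negCrossing {n a b c d : ℕ} (hb : b < n) :
    Elem.negCrossing.weight n [a, b] [c, d] = negMatrix n a b c d := by
  simp only [Elem.weight, negMatrix]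
  split_ifs with h
  · rw [Finset.sum_eq_single (b - c)]
    · rw [if_pos (by omega)]
    · intro k _ hk; rw [if_neg (by omega)]
    · intro hk; simp at hk; omega
  · exact Finset.sum_eq_zero fun k _ => if_neg (by omega)

theorem posMatrix_comm (n a b c d : ℕ) :
    raiseStrand n Dir.up (fun a' => posMatrix n a' b c d) a
      + T (2 * strandWeight n Dir.up a) * raiseStrand n Dir.up (fun b' => posMatrix n a b' c d) b =
    posMatrix n a b (c + 1) d * qInt ((n : ℤ) - (c + 1 : ℕ))
      + posMatrix n a b c (d + 1)
        * (T (2 * strandWeight n Dir.up c) * qInt ((n : ℤ) - (d + 1 : ℕ))) := by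
  -- Every entry involved conserves the sum of the colors, so both sides vanish unless this relation
  -- holds.
  by_cases hs : a + b = c + d + 1
  swap
  · have e1 : raiseStrand n Dir.up (fun a' => posMatrix n a' b c d) a = 0 := by
      cases a with
      | zero => rfl
      | succ a => simp only [raiseStrand, posMatrix]; rw [if_neg (by omega), mul_zero]
    have e2 : raiseStrand n Dir.up (fun b' => posMatrix n a b' c d) b = 0 := by
      cases b with
      | zero => rfl
      | succ b => simp only [raiseStrand, posMatrix]; rw [if_neg (by omega), mul_zero]
    rw [e1, e2, posMatrix, posMatrix, if_neg (by omega), if_neg (by omega)]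
    simp
  rcases Nat.lt_trichotomy b (c + 1) with h | h | h
  · obtain ⟨k, rfl⟩ : ∃ k, c = b + k := ⟨c - b, by omega⟩
    obtain rfl : a = d + k + 1 := by omega
    have hR := Rplus_comm n d b k
    have e2 : raiseStrand n Dir.up (fun b' => posMatrix n (d + k + 1) b' (b + k) d) b =
        if b = 0 then 0 else qInt (n - b) * Rplus n (d + k + 1) (b - 1) (k + 1) := by
      cases b with
      | zero => rfl
      | succ b =>
        simp only [raiseStrand, posMatrix]
        rw [if_pos (by omega), if_neg (by omega), show b + 1 + k - b = k + 1 by omega,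
          show b + 1 - 1 = b by omega]
    rw [e2]
    generalize (if b = 0 then (0 : ℤ[T;T⁻¹]) else _) = w at hR ⊢
    simp only [raiseStrand, posMatrix, strandWeight]
    rw [if_pos (by omega), if_pos (by omega), if_pos (by omega),
      show b + k - b = k by omega, show b + k + 1 - b = k + 1 by omega]
    exact hR
  -- The boundary case: the only surviving entries have shift `0`, one on each side, and both are
  -- monomials times the same quantum integer.
  · subst h
    obtain rfl : a = d := by omega
    have e1 : raiseStrand n Dir.up (fun a' => posMatrix n a' (c + 1) c a) a = 0 := by
      cases a with
      | zero => rfl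
      | succ a => simp only [raiseStrand, posMatrix]; rw [if_neg (by omega), mul_zero]
    rw [e1]
    simp only [raiseStrand, posMatrix, strandWeight]
    rw [if_pos (by omega), if_pos (by omega), if_neg (by omega), Nat.sub_self, Nat.sub_self]
    simp only [Rplus, qFalling, qBinom_zero_right, pow_zero, Finset.range_zero, Finset.prod_empty,
      one_mul, mul_one, zero_mul, zero_add, add_zero]
    rw [mul_left_comm, ← LaurentPolynomial.T_add, mul_comm]
    congr 2; push_cast; ring
  · have e1 : raiseStrand n Dir.up (fun a' => posMatrix n a' b c d) a = 0 := by
      cases a with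
      | zero => rfl
      | succ a => simp only [raiseStrand, posMatrix]; rw [if_neg (by omega), mul_zero]
    have e2 : raiseStrand n Dir.up (fun b' => posMatrix n a b' c d) b = 0 := by
      cases b with
      | zero => rfl
      | succ b => simp only [raiseStrand, posMatrix]; rw [if_neg (by omega), mul_zero]
    rw [e1, e2, posMatrix, posMatrix, if_neg (by omega), if_neg (by omega)]
    simp

theorem negMatrix_comm (n a b c d : ℕ) :
    raiseStrand n Dir.up (fun a' => negMatrix n a' b c d) a
      + T (2 * strandWeight n Dir.up a) * raiseStrand n Dir.up (fun b' => negMatrix n a b' c d) b =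
    negMatrix n a b (c + 1) d * qInt ((n : ℤ) - (c + 1 : ℕ))
      + negMatrix n a b c (d + 1)
        * (T (2 * strandWeight n Dir.up c) * qInt ((n : ℤ) - (d + 1 : ℕ))) := by
  by_cases hs : a + b = c + d + 1 ∧ c ≤ b
  swap
  · have e1 : raiseStrand n Dir.up (fun a' => negMatrix n a' b c d) a = 0 := by
      cases a with
      | zero => rfl
      | succ a => simp only [raiseStrand, negMatrix]; rw [if_neg (by omega), mul_zero]
    have e2 : raiseStrand n Dir.up (fun b' => negMatrix n a b' c d) b = 0 := by
      cases b with
      | zero => rfl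
      | succ b => simp only [raiseStrand, negMatrix]; rw [if_neg (by omega), mul_zero]
    rw [e1, e2, negMatrix, negMatrix, if_neg (by omega), if_neg (by omega)]
    simp
  obtain ⟨hs, hcb⟩ := hs
  rcases hcb.lt_or_eq with h | rfl
  · obtain ⟨k, rfl⟩ : ∃ k, b = c + k + 1 := ⟨b - c - 1, by omega⟩
    obtain rfl : d = a + k := by omega
    have hR := Rminus_comm n a c k
    have e1 : raiseStrand n Dir.up (fun a' => negMatrix n a' (c + k + 1) c (a + k)) a =
        if a = 0 then 0 else qInt (n - a) * Rminus n (a - 1) (c + k + 1) (k + 1) := by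
      cases a with
      | zero => rfl
      | succ a =>
        simp only [raiseStrand, negMatrix]
        rw [if_pos (by omega), if_neg (by omega), show c + k + 1 - c = k + 1 by omega,
          show a + 1 - 1 = a by omega]
    rw [e1]
    generalize (if a = 0 then (0 : ℤ[T;T⁻¹]) else _) = w at hR ⊢
    simp only [raiseStrand, negMatrix, strandWeight]
    rw [if_pos (by omega), if_pos (by omega), if_pos (by omega),
      show c + k - c = k by omega, show c + k + 1 - c = k + 1 by omega,
      show c + k + 1 - (c + 1) = k by omega]
    exact hR
  · obtain rfl : a = d + 1 := by omega
    have e2 : raiseStrand n Dir.up (fun b' => negMatrix n (d + 1) b' c d) c = 0 := by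
      cases c with
      | zero => rfl
      | succ c => simp only [raiseStrand, negMatrix]; rw [if_neg (by omega), mul_zero]
    rw [e2]
    simp only [raiseStrand, negMatrix, strandWeight]
    rw [if_pos (by omega), if_neg (by omega), if_pos (by omega), Nat.sub_self]
    simp only [Rminus, qFalling, qBinom_zero_right, Finset.range_zero, Finset.prod_empty,
      mul_one, mul_zero, zero_mul, zero_add, add_zero]
    rw [← mul_assoc, ← LaurentPolynomial.T_add, mul_comm]
    congr 2; push_cast; ring

theorem raiseLine_nil (n : ℕ) (f : List ℕ → ℤ[T;T⁻¹]) (x : List ℕ) : raiseLine n [] f x = 0 := rfl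

theorem raiseLine_two (n : ℕ) (d d' : Dir) (f : List ℕ → ℤ[T;T⁻¹]) (a b : ℕ) :
    raiseLine n [d, d'] f [a, b] = raiseStrand n d (fun a' => f [a', b]) a
      + T (2 * strandWeight n d a) * raiseStrand n d' (fun b' => f [a, b']) b := by
  simp [raiseLine]

theorem mem_colorings_two {n : ℕ} {x : List ℕ} :
    x ∈ colorings n 2 ↔ ∃ a < n, ∃ b < n, x = [a, b] := by
  constructor
  · intro h
    match x, h with
    | [], h => simp [mem_colorings] at h
    | [_], h => simp [mem_colorings] at h
    | [a, b], h => exact ⟨a, (mem_colorings.1 h).2 a (by simp), b,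
        (mem_colorings.1 h).2 b (by simp), rfl⟩
    | _ :: _ :: _ :: _, h => simp [mem_colorings] at h
  · rintro ⟨a, ha, b, hb, rfl⟩
    simp [mem_colorings, ha, hb]

theorem sum_raiseStrand_cup (n : ℕ) (f : List ℕ → ℤ[T;T⁻¹]) :
    ∑ c ∈ Finset.range n, raiseStrand n Dir.up (fun a => f [a, c]) c =
      ∑ c ∈ Finset.range n, qInt ((n : ℤ) - (c + 1 : ℕ)) * f [c, c + 1] := by
  cases n with
  | zero => simp
  | succ n =>
    rw [Finset.sum_range_succ', Finset.sum_range_succ]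
    have : ((n + 1 : ℕ) : ℤ) - (n + 1 : ℕ) = 0 := sub_self _
    rw [this, qInt_zero]
    simp [raiseStrand]

theorem sum_mul_raiseStrand_cup (n : ℕ) (f : List ℕ → ℤ[T;T⁻¹]) :
    ∑ c ∈ Finset.range n, raiseStrand n Dir.up (fun a => f [c, a]) c =
      ∑ c ∈ Finset.range n, qInt ((n : ℤ) - (c + 1 : ℕ)) * f [c + 1, c] := by
  cases n with
  | zero => simp
  | succ n =>
    rw [Finset.sum_range_succ', Finset.sum_range_succ]
    have : ((n + 1 : ℕ) : ℤ) - (n + 1 : ℕ) = 0 := sub_self _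
    rw [this, qInt_zero]
    simp [raiseStrand]

/-- On the empty line `E` acts by zero. So for caps and cups the two terms of the coproduct must
cancel, which is what the powers of `v` at two of the four extrema achieve. -/
theorem Elem.op_comm {n : ℕ} (e : Elem) (f : List ℕ → ℤ[T;T⁻¹]) {x : List ℕ}
    (hx : x ∈ colorings n e.src.length) :
    raiseLine n e.src (e.op n f) x = e.op n (raiseLine n e.tgt f) x := by
  cases e with
  | posCrossing =>
    obtain ⟨a, ha, b, hb, rfl⟩ := mem_colorings_two.1 hx
    have hop : ∀ g : List ℕ → ℤ[T;T⁻¹], ∀ a b : ℕ, Elem.posCrossing.op n g [a, b] =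
        ∑ c ∈ Finset.range n, ∑ d ∈ Finset.range n, posMatrix n a b c d * g [c, d] := by
      intro g a b
      simp only [Elem.op, Elem.tgt, List.length_cons, List.length_nil, Nat.reduceAdd,
        sum_colorings_two]
      refine Finset.sum_congr rfl fun c hc => Finset.sum_congr rfl fun d _ => ?_
      rw [weight_posCrossing (Finset.mem_range.1 hc)]
    simp only [Elem.src, Elem.tgt, raiseLine_two, hop]
    exact crossing_comm _ (posMatrix_comm n) f a b
  | negCrossing =>
    obtain ⟨a, ha, b, hb, rfl⟩ := mem_colorings_two.1 hx
    have hop : ∀ g : List ℕ → ℤ[T;T⁻¹], ∀ a b : ℕ, b < n → Elem.negCrossing.op n g [a, b] =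
        ∑ c ∈ Finset.range n, ∑ d ∈ Finset.range n, negMatrix n a b c d * g [c, d] := by
      intro g a b hb
      simp only [Elem.op, Elem.tgt, List.length_cons, List.length_nil, Nat.reduceAdd,
        sum_colorings_two]
      refine Finset.sum_congr rfl fun c hc => Finset.sum_congr rfl fun d _ => ?_
      rw [weight_negCrossing hb]
    simp only [Elem.src, Elem.tgt, raiseLine_two]
    rw [hop _ a b hb, raiseStrand_congr ha fun a' _ => hop f a' b hb,
      raiseStrand_congr hb fun b' hb' => hop f a b' hb']
    simp only [raiseLine_two]
    exact crossing_comm _ (negMatrix_comm n) f a b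
  | capUpDown =>
    obtain ⟨a, ha, b, hb, rfl⟩ := mem_colorings_two.1 hx
    simp only [Elem.src, Elem.tgt, raiseLine_two, Elem.op, List.length_nil, colorings_zero,
      Finset.sum_singleton, Elem.weight, raiseLine, mul_zero]
    cases a with
    | zero => simp [raiseStrand]
    | succ a =>
      simp only [raiseStrand, strandWeight, add_left_inj]
      by_cases h : a = b
      · subst h
        simp only [if_true]
        rw [show ∀ A B C D E F : ℤ[T;T⁻¹], A * (B * C) + D * -(E * A * (F * C)) =
          A * C * (B - D * E * F) by intros; ring, ← LaurentPolynomial.T_add,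
          ← LaurentPolynomial.T_add]
        refine mul_eq_zero_of_right _ (sub_eq_zero.2 ?_)
        congr 1; push_cast; ring
      · simp [h]
  | capDownUp =>
    obtain ⟨a, ha, b, hb, rfl⟩ := mem_colorings_two.1 hx
    simp only [Elem.src, Elem.tgt, raiseLine_two, Elem.op, List.length_nil, colorings_zero,
      Finset.sum_singleton, Elem.weight, raiseLine, mul_zero]
    cases b with
    | zero => simp [raiseStrand]
    | succ b =>
      simp only [raiseStrand, strandWeight, add_left_inj]
      by_cases h : a = b
      · subst h
        simp only [if_true]
        rw [mul_neg]
        ring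
      · simp [h]
  | cupUpDown =>
    obtain rfl : x = [] := by simpa [Elem.src] using hx
    simp only [Elem.src, Elem.tgt, Elem.op, List.length_cons, List.length_nil, Nat.reduceAdd,
      sum_colorings_two, raiseLine_two, Elem.weight, raiseLine_nil, ite_mul, one_mul, zero_mul]
    rw [Finset.sum_congr rfl fun c hc => Finset.sum_ite_eq_of_mem _ c _ hc,
      Finset.sum_add_distrib, sum_raiseStrand_cup, ← Finset.sum_add_distrib]
    refine (Finset.sum_eq_zero fun c _ => ?_).symm
    simp only [raiseStrand, strandWeight]
    rw [mul_neg, ← mul_assoc, ← mul_assoc, ← LaurentPolynomial.T_add, add_neg_cancel,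
      LaurentPolynomial.T_zero, one_mul, add_neg_cancel]
  | cupDownUp =>
    obtain rfl : x = [] := by simpa [Elem.src] using hx
    simp only [Elem.src, Elem.tgt, Elem.op, List.length_cons, List.length_nil, Nat.reduceAdd,
      sum_colorings_two, raiseLine_two, Elem.weight, raiseLine_nil, ite_mul, zero_mul]
    rw [Finset.sum_congr rfl fun c hc => Finset.sum_ite_eq_of_mem _ c _ hc]
    simp only [mul_add, Finset.sum_add_distrib, ← mul_assoc, strandWeight,
      ← LaurentPolynomial.T_add]
    have h0 : ∀ c : ℕ, 2 * ((n : ℤ) - 1 - 2 * c) + 2 * -((n : ℤ) - 1 - 2 * c) = 0 := by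
      intro c; ring
    simp only [h0, LaurentPolynomial.T_zero, one_mul]
    rw [sum_mul_raiseStrand_cup, ← Finset.sum_add_distrib]
    refine (Finset.sum_eq_zero fun c _ => ?_).symm
    simp only [raiseStrand]
    rw [mul_neg, ← mul_assoc, ← mul_assoc, ← LaurentPolynomial.T_add, add_neg_cancel,
      LaurentPolynomial.T_zero, one_mul, neg_add_cancel]

/-- Conservation of weight, that is, commutation with `G`. It lets the factor `G` of the coproduct
pass through a piece, and later lets the twist of a quantum trace do so. -/
theorem Elem.lineWeight_eq {n : ℕ} (e : Elem) {x y : List ℕ}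
    (hx : x ∈ colorings n e.src.length) (hy : y ∈ colorings n e.tgt.length)
    (h : e.weight n x y ≠ 0) : lineWeight n e.src x = lineWeight n e.tgt y := by
  cases e with
  | posCrossing =>
    obtain ⟨a, ha, b, hb, rfl⟩ := mem_colorings_two.1 hx
    obtain ⟨c, hc, d, hd, rfl⟩ := mem_colorings_two.1 hy
    rw [weight_posCrossing hc, posMatrix] at h
    have := (ite_ne_right_iff.1 h).1
    simp only [Elem.src, Elem.tgt, lineWeight, strandWeight]
    omega
  | negCrossing =>
    obtain ⟨a, ha, b, hb, rfl⟩ := mem_colorings_two.1 hx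
    obtain ⟨c, hc, d, hd, rfl⟩ := mem_colorings_two.1 hy
    rw [weight_negCrossing hb, negMatrix] at h
    have := (ite_ne_right_iff.1 h).1
    simp only [Elem.src, Elem.tgt, lineWeight, strandWeight]
    omega
  | capUpDown =>
    obtain ⟨a, ha, b, hb, rfl⟩ := mem_colorings_two.1 hx
    obtain rfl : y = [] := by simpa [Elem.tgt] using hy
    have := (ite_ne_right_iff.1 h).1
    simp only [Elem.src, Elem.tgt, lineWeight, strandWeight]
    omega
  | capDownUp =>
    obtain ⟨a, ha, b, hb, rfl⟩ := mem_colorings_two.1 hx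
    obtain rfl : y = [] := by simpa [Elem.tgt] using hy
    have := (ite_ne_right_iff.1 h).1
    simp only [Elem.src, Elem.tgt, lineWeight, strandWeight]
    omega
  | cupUpDown =>
    obtain ⟨a, ha, b, hb, rfl⟩ := mem_colorings_two.1 hy
    obtain rfl : x = [] := by simpa [Elem.src] using hx
    have := (ite_ne_right_iff.1 h).1
    simp only [Elem.src, Elem.tgt, lineWeight, strandWeight]
    omega
  | cupDownUp =>
    obtain ⟨a, ha, b, hb, rfl⟩ := mem_colorings_two.1 hy
    obtain rfl : x = [] := by simpa [Elem.src] using hx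
    have := (ite_ne_right_iff.1 h).1
    simp only [Elem.src, Elem.tgt, lineWeight, strandWeight]
    omega

/-! ### Equivariance of diagrams -/

/-- The operator of a slice. -/
def Slice.op (n : ℕ) (s : Slice) (f : List ℕ → ℤ[T;T⁻¹]) (x : List ℕ) : ℤ[T;T⁻¹] :=
  ∑ z ∈ colorings n s.tgt.length, s.weight n x z * f z

theorem Slice.src_eq (s : Slice) : s.src = s.left ++ (s.elem.src ++ s.right) :=
  List.append_assoc _ _ _

theorem Slice.tgt_eq (s : Slice) : s.tgt = s.left ++ (s.elem.tgt ++ s.right) :=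
  List.append_assoc _ _ _

theorem Slice.weight_append (n : ℕ) (s : Slice) {l l' m m' r r' : List ℕ}
    (hl : l.length = s.left.length) (hl' : l'.length = s.left.length)
    (hm : m.length = s.elem.src.length) (hm' : m'.length = s.elem.tgt.length) :
    s.weight n (l ++ (m ++ r)) (l' ++ (m' ++ r')) =
      if l = l' ∧ r = r' then s.elem.weight n m m' else 0 := by
  have h1 : (l ++ (m ++ r)).drop (s.left.length + s.elem.src.length) = r := by
    rw [← List.append_assoc, List.drop_left' (by simp [hl, hm])]
  have h2 : (l' ++ (m' ++ r')).drop (s.left.length + s.elem.tgt.length) = r' := by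
    rw [← List.append_assoc, List.drop_left' (by simp [hl', hm'])]
  rw [Slice.weight, h1, h2, List.take_left' hl, List.take_left' hl', List.drop_left' hl,
    List.drop_left' hl', List.take_left' hm, List.take_left' hm']

/-- A slice acts as identity, elementary piece and identity on the three blocks of strands. -/
theorem Slice.op_append {n : ℕ} (s : Slice) (f : List ℕ → ℤ[T;T⁻¹]) {l m r : List ℕ}
    (hl : l ∈ colorings n s.left.length) (hm : m ∈ colorings n s.elem.src.length)
    (hr : r ∈ colorings n s.right.length) :
    s.op n f (l ++ (m ++ r)) = s.elem.op n (fun y => f (l ++ (y ++ r))) m := by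
  rw [Slice.op, Slice.tgt_eq, List.length_append, List.length_append, sum_colorings_add]
  simp only [sum_colorings_add]
  rw [Finset.sum_eq_single_of_mem l hl]
  · refine Finset.sum_congr rfl fun m' hm' => ?_
    rw [Finset.sum_eq_single_of_mem r hr]
    · rw [Slice.weight_append n s (mem_colorings.1 hl).1 (mem_colorings.1 hl).1
        (mem_colorings.1 hm).1 (mem_colorings.1 hm').1, if_pos ⟨rfl, rfl⟩]
    · intro r' _ hne
      rw [Slice.weight_append n s (mem_colorings.1 hl).1 (mem_colorings.1 hl).1
        (mem_colorings.1 hm).1 (mem_colorings.1 hm').1, if_neg (fun h => hne h.2.symm), zero_mul]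
  · intro l' hl' hne
    refine Finset.sum_eq_zero fun m' hm' => Finset.sum_eq_zero fun r' _ => ?_
    rw [Slice.weight_append n s (mem_colorings.1 hl).1 (mem_colorings.1 hl').1
      (mem_colorings.1 hm).1 (mem_colorings.1 hm').1, if_neg (fun h => hne h.1.symm), zero_mul]

theorem Slice.exists_of_mem_colorings_src {n : ℕ} {s : Slice} {x : List ℕ}
    (hx : x ∈ colorings n s.src.length) : ∃ l ∈ colorings n s.left.length,
      ∃ m ∈ colorings n s.elem.src.length, ∃ r ∈ colorings n s.right.length,
        x = l ++ (m ++ r) := by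
  rw [Slice.src_eq, List.length_append, List.length_append] at hx
  obtain ⟨l, hl, y, hy, rfl⟩ := exists_append_of_mem_colorings hx
  obtain ⟨m, hm, r, hr, rfl⟩ := exists_append_of_mem_colorings hy
  exact ⟨l, hl, m, hm, r, hr, rfl⟩

theorem Slice.exists_of_mem_colorings_tgt {n : ℕ} {s : Slice} {x : List ℕ}
    (hx : x ∈ colorings n s.tgt.length) : ∃ l ∈ colorings n s.left.length,
      ∃ m ∈ colorings n s.elem.tgt.length, ∃ r ∈ colorings n s.right.length,
        x = l ++ (m ++ r) := by
  rw [Slice.tgt_eq, List.length_append, List.length_append] at hx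
  obtain ⟨l, hl, y, hy, rfl⟩ := exists_append_of_mem_colorings hx
  obtain ⟨m, hm, r, hr, rfl⟩ := exists_append_of_mem_colorings hy
  exact ⟨l, hl, m, hm, r, hr, rfl⟩

theorem Slice.op_comm {n : ℕ} (s : Slice) (f : List ℕ → ℤ[T;T⁻¹]) {x : List ℕ}
    (hx : x ∈ colorings n s.src.length) :
    raiseLine n s.src (s.op n f) x = s.op n (raiseLine n s.tgt f) x := by
  obtain ⟨l, hl, m, hm, r, hr, rfl⟩ := Slice.exists_of_mem_colorings_src hx
  rw [Slice.op_append s _ hl hm hr, Slice.src_eq, Slice.tgt_eq,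
    raiseLine_append n _ (mem_colorings.1 hl).1, raiseLine_append n _ (mem_colorings.1 hm).1]
  have e1 : raiseLine n s.left (fun z => s.op n f (z ++ (m ++ r))) l =
      s.elem.op n (fun y => raiseLine n s.left (fun z => f (z ++ (y ++ r))) l) m := by
    rw [raiseLine_congr hl fun z hz => Slice.op_append s f hz hm hr]
    simp only [Elem.op]
    rw [raiseLine_sum]
    simp only [raiseLine_mul_left]
  have e2 : raiseLine n s.elem.src (fun z => s.op n f (l ++ (z ++ r))) m =
      s.elem.op n (fun y => raiseLine n s.elem.tgt (fun z => f (l ++ (z ++ r))) y) m := by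
    rw [raiseLine_congr hm fun z hz => Slice.op_append s f hl hz hr]
    exact Elem.op_comm s.elem _ hm
  -- When `E` acts to the right of the piece, the coproduct puts `G` on the strands of the piece;
  -- conservation of weight moves it to the other side.
  have e3 : T (2 * lineWeight n s.elem.src m)
        * raiseLine n s.right (fun z => s.op n f (l ++ (m ++ z))) r =
      s.elem.op n (fun y => T (2 * lineWeight n s.elem.tgt y)
        * raiseLine n s.right (fun z => f (l ++ (y ++ z))) r) m := by
    rw [raiseLine_congr hr fun z hz => Slice.op_append s f hl hm hz]
    simp only [Elem.op]
    rw [raiseLine_sum, Finset.mul_sum]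
    simp only [raiseLine_mul_left]
    refine Finset.sum_congr rfl fun y hy => ?_
    by_cases h : s.elem.weight n m y = 0
    · simp [h]
    · rw [Elem.lineWeight_eq s.elem hm hy h]; ring
  rw [e1, e2, e3]
  simp only [Elem.op, ← Finset.sum_add_distrib, Finset.mul_sum]
  refine Finset.sum_congr rfl fun y hy => ?_
  rw [raiseLine_append n _ (mem_colorings.1 hl).1, raiseLine_append n _ (mem_colorings.1 hy).1]
  ring

theorem Slice.lineWeight_eq {n : ℕ} (s : Slice) {x y : List ℕ}
    (hx : x ∈ colorings n s.src.length) (hy : y ∈ colorings n s.tgt.length)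
    (h : s.weight n x y ≠ 0) : lineWeight n s.src x = lineWeight n s.tgt y := by
  obtain ⟨l, hl, m, hm, r, hr, rfl⟩ := Slice.exists_of_mem_colorings_src hx
  obtain ⟨l', hl', m', hm', r', hr', rfl⟩ := Slice.exists_of_mem_colorings_tgt hy
  rw [Slice.weight_append n s (mem_colorings.1 hl).1 (mem_colorings.1 hl').1
    (mem_colorings.1 hm).1 (mem_colorings.1 hm').1] at h
  obtain ⟨⟨rfl, rfl⟩, hw⟩ := ite_ne_right_iff.1 h
  rw [Slice.src_eq, Slice.tgt_eq, lineWeight_append n (mem_colorings.1 hl).1,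
    lineWeight_append n (mem_colorings.1 hl).1, lineWeight_append n (mem_colorings.1 hm).1,
    lineWeight_append n (mem_colorings.1 hm').1, Elem.lineWeight_eq s.elem hm hm' hw]

theorem stateSum_cons (n : ℕ) (s : Slice) (D : List Slice) (x y : List ℕ) :
    stateSum n (s :: D) x y =
      ∑ z ∈ colorings n s.tgt.length, s.weight n x z * stateSum n D z y := by
  rw [stateSum, ← sum_ofFn_eq_sum_colorings]

theorem stateSum_append {n : ℕ} {s t : List Dir} {D : List Slice} (hD : Composable s D t)
    (D' : List Slice) {x : List ℕ} (hx : x ∈ colorings n s.length) (y : List ℕ) :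
    stateSum n (D ++ D') x y =
      ∑ z ∈ colorings n t.length, stateSum n D x z * stateSum n D' z y := by
  induction D generalizing s x with
  | nil =>
    obtain rfl : s = t := hD
    simp [stateSum, hx]
  | cons σ D ih =>
    obtain ⟨rfl, hD⟩ := hD
    rw [List.cons_append, stateSum_cons]
    simp only [stateSum_cons, Finset.sum_mul]
    rw [Finset.sum_comm]
    refine Finset.sum_congr rfl fun z hz => ?_
    rw [ih hD hz, Finset.mul_sum]
    simp only [mul_assoc]

theorem stateSum_comm {n : ℕ} {s t : List Dir} {D : List Slice} (hD : Composable s D t)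
    (f : List ℕ → ℤ[T;T⁻¹]) {x : List ℕ} (hx : x ∈ colorings n s.length) :
    raiseLine n s (fun z => ∑ y ∈ colorings n t.length, stateSum n D z y * f y) x =
      ∑ y ∈ colorings n t.length, stateSum n D x y * raiseLine n t f y := by
  induction D generalizing s x with
  | nil =>
    obtain rfl : s = t := hD
    have h : ∀ g : List ℕ → ℤ[T;T⁻¹], ∀ z ∈ colorings n s.length,
        ∑ y ∈ colorings n s.length, stateSum n [] z y * g y = g z := by
      intro g z hz
      simp [stateSum, hz]
    rw [h _ x hx]
    exact raiseLine_congr hx fun z hz => h f z hz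
  | cons σ D ih =>
    obtain ⟨rfl, hD⟩ := hD
    have h : ∀ g : List ℕ → ℤ[T;T⁻¹], ∀ z,
        ∑ y ∈ colorings n t.length, stateSum n (σ :: D) z y * g y =
          σ.op n (fun w => ∑ y ∈ colorings n t.length, stateSum n D w y * g y) z := by
      intro g z
      simp only [stateSum_cons, Slice.op, Finset.sum_mul, Finset.mul_sum]
      rw [Finset.sum_comm]
      simp only [mul_assoc]
    simp only [h]
    rw [Slice.op_comm σ _ hx]
    refine Finset.sum_congr rfl fun z hz => ?_
    rw [ih hD hz]

theorem stateSum_lineWeight_eq {n : ℕ} {s t : List Dir} {D : List Slice} (hD : Composable s D t)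
    {x y : List ℕ} (hx : x ∈ colorings n s.length) (h : stateSum n D x y ≠ 0) :
    lineWeight n s x = lineWeight n t y := by
  induction D generalizing s x with
  | nil =>
    obtain rfl : s = t := hD
    rw [(ite_ne_right_iff.1 h).1]
  | cons σ D ih =>
    obtain ⟨rfl, hD⟩ := hD
    rw [stateSum_cons] at h
    obtain ⟨z, hz, h⟩ := Finset.exists_ne_zero_of_sum_ne_zero h
    rw [Slice.lineWeight_eq σ hx hz (left_ne_zero_of_mul h), ih hD hz (right_ne_zero_of_mul h)]

/-! ### Partial traces of equivariant operators -/

theorem raiseLine_eq_sum {n : ℕ} {s : List Dir} (f : List ℕ → ℤ[T;T⁻¹]) {x : List ℕ}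
    (hx : x ∈ colorings n s.length) :
    raiseLine n s f x = ∑ y ∈ colorings n s.length,
      raiseLine n s (fun z => if z = y then 1 else 0) x * f y := by
  have h : ∀ z ∈ colorings n s.length,
      f z = ∑ y ∈ colorings n s.length, f y * (if z = y then 1 else 0) := by
    intro z hz
    simp only [mul_ite, mul_one, mul_zero, Finset.sum_ite_eq, hz, if_true]
  rw [raiseLine_congr hx h, raiseLine_sum]
  simp only [raiseLine_mul_left, mul_comm]

/-- If `B` commutes with `E`, then `B [Y, E]` is a commutator up to cyclic permutation and has trace
zero. It is applied to a `Y` for which `[Y, E]` is diagonal, with entries `δ`. -/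
theorem trace_commutator_eq_zero {n : ℕ} {s : List Dir} {B Y : List ℕ → List ℕ → ℤ[T;T⁻¹]}
    {δ : List ℕ → ℤ[T;T⁻¹]}
    (hB : ∀ f, ∀ x ∈ colorings n s.length,
      raiseLine n s (fun z => ∑ y ∈ colorings n s.length, B z y * f y) x =
        ∑ y ∈ colorings n s.length, B x y * raiseLine n s f y)
    (hY : ∀ f, ∀ x ∈ colorings n s.length,
      ∑ y ∈ colorings n s.length, Y x y * raiseLine n s f y
        - raiseLine n s (fun z => ∑ y ∈ colorings n s.length, Y z y * f y) x = δ x * f x) :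
    ∑ x ∈ colorings n s.length, δ x * B x x = 0 := by
  let ι := {x // x ∈ colorings n s.length}
  let MB : Matrix ι ι ℤ[T;T⁻¹] := Matrix.of fun x y => B x y
  let MY : Matrix ι ι ℤ[T;T⁻¹] := Matrix.of fun x y => Y x y
  let ME : Matrix ι ι ℤ[T;T⁻¹] :=
    Matrix.of fun x y => raiseLine n s (fun z => if z = (y : List ℕ) then 1 else 0) x
  have hsum : ∀ F : List ℕ → ℤ[T;T⁻¹], ∑ x ∈ colorings n s.length, F x = ∑ x : ι, F x :=
    fun F => (Finset.sum_coe_sort _ F).symm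
  have hδ : ∀ (A : List ℕ → List ℕ → ℤ[T;T⁻¹]) (z : List ℕ) (y : ι),
      ∑ w ∈ colorings n s.length, A z w * (if w = (y : List ℕ) then 1 else 0) = A z y := by
    intro A z y
    rw [Finset.sum_eq_single_of_mem _ y.2 fun w _ hw => by rw [if_neg hw, mul_zero],
      if_pos rfl, mul_one]
  have h1 : MB * ME = ME * MB := by
    ext1 x y
    have := hB (fun z => if z = (y : List ℕ) then 1 else 0) x x.2
    simp only [hδ] at this
    rw [raiseLine_eq_sum _ x.2, hsum, hsum] at this
    exact this.symm
  have h2 : MY * ME - ME * MY = Matrix.diagonal fun x : ι => δ x := by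
    ext1 x y
    have := hY (fun z => if z = (y : List ℕ) then 1 else 0) x x.2
    simp only [hδ] at this
    rw [raiseLine_eq_sum (fun z => Y z y) x.2, hsum, hsum] at this
    refine this.trans ?_
    by_cases h : x = y
    · rw [h, if_pos rfl, mul_one, Matrix.diagonal_apply_eq]
    · rw [if_neg (fun h' => h (Subtype.ext h')), mul_zero, Matrix.diagonal_apply_ne _ h]
  have h3 : Matrix.trace (MB * (MY * ME - ME * MY)) = 0 := by
    rw [Matrix.mul_sub, Matrix.trace_sub, ← Matrix.mul_assoc, ← Matrix.mul_assoc, h1,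
      Matrix.trace_mul_comm, Matrix.mul_assoc ME, sub_self]
  rw [h2, Matrix.trace] at h3
  rw [hsum, ← h3]
  refine Finset.sum_congr rfl fun x _ => ?_
  rw [Matrix.diag_apply, Matrix.mul_diagonal, mul_comm]
  rfl

/-- A matrix unit opposite to `E` between the colors `a` and `a + 1`: its commutator with `E` is
diagonal, with opposite nonzero entries at these two colors. On a downward strand `E` moves colors
the other way, so `b` and `b'` are exchanged. -/
theorem exists_strand_commutator {n a : ℕ} (d : Dir) (ha : a + 1 < n) :
    ∃ b < n, ∃ b' < n, ∃ θ : ℤ[T;T⁻¹], θ ≠ 0 ∧ strandWeight n d b = strandWeight n d b' + 2 ∧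
      ∀ (g : ℕ → ℤ[T;T⁻¹]) (c : ℕ),
        (if c = b then raiseStrand n d g b' else 0)
          - raiseStrand n d (fun z => if z = b then g b' else 0) c =
        (if c = a then θ else if c = a + 1 then -θ else 0) * g c := by
  have h0 : qInt ((n : ℤ) - (a + 1 : ℕ)) ≠ 0 := qInt_ne_zero (by omega)
  cases d with
  | up =>
    refine ⟨a, by omega, a + 1, ha, _, h0, by simp only [strandWeight]; push_cast; ring, ?_⟩
    intro g c
    cases c with
    | zero =>
      simp only [raiseStrand]
      by_cases h : 0 = a
      · subst h; simp
      · simp [h]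
    | succ c =>
      simp only [raiseStrand]
      by_cases h : c + 1 = a
      · subst h; simp
      · by_cases h' : c = a
        · subst h'; simp
        · simp [h, h']
  | down =>
    refine ⟨a + 1, ha, a, by omega, _, mul_ne_zero (LaurentPolynomial.isUnit_T
      (-(2 * ((n : ℤ) - 1 - 2 * a)))).ne_zero h0,
      by simp only [strandWeight]; push_cast; ring, ?_⟩
    intro g c
    simp only [raiseStrand]
    by_cases h : c = a
    · subst h; simp
    · by_cases h' : c = a + 1
      · subst h'; simp
      · simp [h, h']

theorem raiseStrand_T_mul (n : ℕ) (d : Dir) (g : ℕ → ℤ[T;T⁻¹]) (a : ℕ) :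
    raiseStrand n d (fun b => T (-(2 * strandWeight n d b)) * g b) a =
      T (-(2 * strandWeight n d a) - 4) * raiseStrand n d g a := by
  cases d with
  | up =>
    cases a with
    | zero => simp [raiseStrand]
    | succ a =>
      simp only [raiseStrand, strandWeight]
      rw [mul_left_comm]
      congr 2; push_cast; ring
  | down =>
    simp only [raiseStrand, strandWeight]
    have e : -(2 * -((n : ℤ) - 1 - 2 * (a + 1 : ℕ))) = -(2 * -((n : ℤ) - 1 - 2 * a)) - 4 := by
      push_cast; ring
    rw [e]
    ring

/-- `G⁻¹` commutes with `E` up to `v ^ (-2)`, which is `T (-4)`, since `E` changes the weight by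
`2`. -/
theorem raiseLine_T_mul (n : ℕ) (s : List Dir) (f : List ℕ → ℤ[T;T⁻¹]) (x : List ℕ) :
    raiseLine n s (fun y => T (-(2 * lineWeight n s y)) * f y) x =
      T (-(2 * lineWeight n s x) - 4) * raiseLine n s f x := by
  induction s generalizing f x with
  | nil => simp [raiseLine]
  | cons d s ih =>
    cases x with
    | nil => simp [raiseLine]
    | cons a x =>
      simp only [raiseLine, lineWeight, mul_add, neg_add, LaurentPolynomial.T_add, mul_assoc]
      have h1 : raiseStrand n d (fun b => T (-(2 * strandWeight n d b)) *
          (T (-(2 * lineWeight n s x)) * f (b :: x))) a =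
          T (-(2 * strandWeight n d a) - 4) * (T (-(2 * lineWeight n s x)) *
            raiseStrand n d (fun b => f (b :: x)) a) := by
        rw [raiseStrand_T_mul n d (fun b => T (-(2 * lineWeight n s x)) * f (b :: x)),
          raiseStrand_mul_left]
      rw [h1, raiseLine_mul_left, ih]
      simp only [sub_eq_add_neg, LaurentPolynomial.T_add]
      ring

/-- The partial trace of an operator over all strands but one, on which it takes the diagonal
entry of the color `a`: the left quantum trace over the strands `s` to the left, and the right
quantum trace over the strands `t` to the right. -/
def partialTrace (n : ℕ) (s t : List Dir) (B : List ℕ → List ℕ → ℤ[T;T⁻¹]) (a : ℕ) : ℤ[T;T⁻¹] :=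
  ∑ x ∈ colorings n s.length, ∑ y ∈ colorings n t.length,
    T (2 * lineWeight n s x) * T (-(2 * lineWeight n t y)) * B (x ++ a :: y) (x ++ a :: y)

/-- Take `Y` to be the identity on `s`, the matrix unit of `exists_strand_commutator` on the middle
strand and `G⁻¹` on `t`. Then `[Y, E]` is diagonal and carries the twists of the partial trace, so
`trace_commutator_eq_zero` compares the two colors. -/
theorem partialTrace_succ {n : ℕ} {s t : List Dir} {d : Dir} {B : List ℕ → List ℕ → ℤ[T;T⁻¹]}
    (hB : ∀ f, ∀ x ∈ colorings n (s ++ d :: t).length,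
      raiseLine n (s ++ d :: t) (fun z => ∑ y ∈ colorings n (s ++ d :: t).length, B z y * f y) x =
        ∑ y ∈ colorings n (s ++ d :: t).length, B x y * raiseLine n (s ++ d :: t) f y)
    {a : ℕ} (ha : a + 1 < n) : partialTrace n s t B (a + 1) = partialTrace n s t B a := by
  obtain ⟨b, hb, b', hb', θ, hθ, hw, hcomm⟩ := exists_strand_commutator d ha
  let p := s.length
  let Yc : List ℕ → ℤ[T;T⁻¹] := fun x =>
    if x.getD p 0 = b then T (-(2 * lineWeight n t (x.drop (p + 1)))) else 0
  -- `Y` has at most one nonzero entry in each row `x`: the value `Yc x` in the column `τ x`, where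
  -- the middle color is replaced by `b'`.
  let τ : List ℕ → List ℕ := fun x => x.take p ++ b' :: x.drop (p + 1)
  let δ : List ℕ → ℤ[T;T⁻¹] := fun x =>
    T (2 * lineWeight n s (x.take p)) * T (-(2 * lineWeight n t (x.drop (p + 1)))) *
      (if x.getD p 0 = a then θ else if x.getD p 0 = a + 1 then -θ else 0)
  have hget : ∀ (x : List ℕ) (c : ℕ) (y : List ℕ), x.length = s.length →
      (x ++ c :: y).getD p 0 = c ∧ (x ++ c :: y).take p = x ∧ (x ++ c :: y).drop (p + 1) = y := by
    intro x c y hx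
    have hp : p = x.length := hx.symm
    rw [hp]
    simp [List.drop_append, List.drop_eq_nil_of_le]
  have hYc : ∀ (x : List ℕ) (c : ℕ) (y : List ℕ), x.length = s.length →
      Yc (x ++ c :: y) = if c = b then T (-(2 * lineWeight n t y)) else 0 := by
    intro x c y hx
    obtain ⟨h1, h2, h3⟩ := hget x c y hx
    simp only [Yc]
    rw [h1, h3]
  have hτ : ∀ (x : List ℕ) (c : ℕ) (y : List ℕ), x.length = s.length →
      τ (x ++ c :: y) = x ++ b' :: y := by
    intro x c y hx
    obtain ⟨h1, h2, h3⟩ := hget x c y hx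
    simp only [τ]
    rw [h2, h3]
  have hδ : ∀ (x : List ℕ) (c : ℕ) (y : List ℕ), x.length = s.length →
      δ (x ++ c :: y) = T (2 * lineWeight n s x) * T (-(2 * lineWeight n t y)) *
        (if c = a then θ else if c = a + 1 then -θ else 0) := by
    intro x c y hx
    obtain ⟨h1, h2, h3⟩ := hget x c y hx
    simp only [δ]
    rw [h1, h2, h3]
  have hmem : ∀ x ∈ colorings n (s ++ d :: t).length, ∃ y ∈ colorings n s.length, ∃ c < n,
      ∃ z ∈ colorings n t.length, x = y ++ c :: z := by
    intro x hx
    rw [List.length_append, List.length_cons] at hx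
    obtain ⟨y, hy, z, hz, rfl⟩ := exists_append_of_mem_colorings hx
    cases z with
    | nil => simp [mem_colorings] at hz
    | cons c z =>
      rw [cons_mem_colorings] at hz
      exact ⟨y, hy, c, hz.1, z, hz.2, rfl⟩
  have hmem' : ∀ y ∈ colorings n s.length, ∀ c < n, ∀ z ∈ colorings n t.length,
      y ++ c :: z ∈ colorings n (s ++ d :: t).length := by
    intro y hy c hc z hz
    rw [List.length_append, List.length_cons]
    exact append_mem_colorings hy (cons_mem_colorings.2 ⟨hc, hz⟩)
  have hYsum : ∀ f : List ℕ → ℤ[T;T⁻¹], ∀ x ∈ colorings n (s ++ d :: t).length,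
      ∑ y ∈ colorings n (s ++ d :: t).length, (Yc x * if y = τ x then 1 else 0) * f y =
        Yc x * f (τ x) := by
    intro f x hx
    obtain ⟨y, hy, c, hc, z, hz, rfl⟩ := hmem x hx
    rw [Finset.sum_eq_single_of_mem (τ (y ++ c :: z))]
    · rw [if_pos rfl, mul_one]
    · rw [hτ _ _ _ (mem_colorings.1 hy).1]
      exact hmem' y hy b' hb' z hz
    · intro w _ hw
      rw [if_neg hw, mul_zero, zero_mul]
  have key := trace_commutator_eq_zero (Y := fun x y => Yc x * if y = τ x then 1 else 0)
    (δ := δ) hB (by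
      intro f x hx
      rw [hYsum _ x hx, raiseLine_congr hx fun z hz => hYsum f z hz]
      obtain ⟨y, hy, c, hc, z, hz, rfl⟩ := hmem x hx
      have ly := (mem_colorings.1 hy).1
      rw [hYc y c z ly, hτ y c z ly, hδ y c z ly, raiseLine_append n _ ly, raiseLine_append n _ ly]
      simp only [raiseLine]
      have e1 : raiseLine n s (fun w => Yc (w ++ c :: z) * f (τ (w ++ c :: z))) y =
          raiseLine n s (fun w => (if c = b then T (-(2 * lineWeight n t z)) else 0) *
            f (w ++ b' :: z)) y :=
        raiseLine_congr hy fun w hw => by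
          rw [hYc w c z (mem_colorings.1 hw).1, hτ w c z (mem_colorings.1 hw).1]
      rw [e1]
      simp only [hYc _ _ _ ly, hτ _ _ _ ly]
      have hc2 : ∀ w, raiseStrand n d (fun c => (if c = b then T (-(2 * lineWeight n t z)) else 0) *
          f (y ++ b' :: z)) w = T (-(2 * lineWeight n t z)) *
          raiseStrand n d (fun c => if c = b then f (y ++ b' :: z) else 0) w := by
        intro w
        rw [← raiseStrand_mul_left]
        congr 1; funext c
        split_ifs <;> simp
      have hcm := hcomm (fun w => f (y ++ w :: z)) c
      rw [raiseLine_mul_left, hc2, mul_assoc, ← hcm]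
      by_cases h : c = b
      · subst h
        simp only [if_true]
        rw [raiseLine_T_mul, hw]
        -- The terms in which `E` acts on `t` cancel: the factor `v ^ (-2)` from exchanging `E` with
        -- `G⁻¹` is compensated by the weight difference `2` of the colors `b` and `b'`.
        have e : (T (2 * (strandWeight n d b' + 2)) * T (-(2 * lineWeight n t z) - 4) : ℤ[T;T⁻¹]) =
            T (2 * strandWeight n d b') * T (-(2 * lineWeight n t z)) := by
          rw [← LaurentPolynomial.T_add, ← LaurentPolynomial.T_add]; congr 1; ring
        linear_combination (-T (2 * lineWeight n s y) *
          raiseLine n t (fun w => f (y ++ b' :: w)) z) * e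
      · simp only [h, if_false, zero_mul]
        have h0 : raiseLine n t (fun _ => (0 : ℤ[T;T⁻¹])) z = 0 := by
          simpa using raiseLine_mul_left n t 0 (fun _ => (0 : ℤ[T;T⁻¹])) z
        rw [h0]
        ring)
  rw [List.length_append, List.length_cons, sum_colorings_add] at key
  simp only [sum_colorings_succ] at key
  have hn : (Finset.range n).sum (fun c => ∑ x ∈ colorings n s.length,
      ∑ y ∈ colorings n t.length, δ (x ++ c :: y) * B (x ++ c :: y) (x ++ c :: y)) = 0 := by
    rw [Finset.sum_comm]; exact key
  have hval : ∀ c, ∑ x ∈ colorings n s.length,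
      ∑ y ∈ colorings n t.length, δ (x ++ c :: y) * B (x ++ c :: y) (x ++ c :: y) =
      (if c = a then θ else if c = a + 1 then -θ else 0) * partialTrace n s t B c := by
    intro c
    rw [partialTrace, Finset.mul_sum]
    refine Finset.sum_congr rfl fun x hx => ?_
    rw [Finset.mul_sum]
    refine Finset.sum_congr rfl fun y _ => ?_
    rw [hδ x c y (mem_colorings.1 hx).1]
    ring
  simp only [hval] at hn
  -- Only the colors `a` and `a + 1` survive, with coefficients `θ` and `-θ`, and `θ` can be
  -- cancelled.
  rw [Finset.sum_eq_add_of_mem a (a + 1) (by simp; omega) (by simpa using ha) (by omega)] at hn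
  · simp only [if_true, Nat.succ_ne_self, if_false] at hn
    refine (mul_left_cancel₀ hθ ?_).symm
    linear_combination hn
  · intro c _ hc
    simp [hc.1, hc.2]

theorem partialTrace_eq {n : ℕ} {s t : List Dir} {d : Dir} {B : List ℕ → List ℕ → ℤ[T;T⁻¹]}
    (hB : ∀ f, ∀ x ∈ colorings n (s ++ d :: t).length,
      raiseLine n (s ++ d :: t) (fun z => ∑ y ∈ colorings n (s ++ d :: t).length, B z y * f y) x =
        ∑ y ∈ colorings n (s ++ d :: t).length, B x y * raiseLine n (s ++ d :: t) f y)
    {a : ℕ} (ha : a < n) : partialTrace n s t B a = partialTrace n s t B 0 := by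
  induction a with
  | zero => rfl
  | succ a ih => rw [partialTrace_succ hB ha, ih (by omega)]

/-! ### Quantum dimension and full quantum traces -/

/-- The quantum dimension `[n]` of the color. -/
def qDim (n : ℕ) : ℤ[T;T⁻¹] := ∑ c ∈ Finset.range n, T (2 * ((n : ℤ) - 1 - 2 * c))

theorem sum_T_neg (n : ℕ) :
    ∑ c ∈ Finset.range n, (T (-(2 * ((n : ℤ) - 1 - 2 * c))) : ℤ[T;T⁻¹]) = qDim n := by
  rw [qDim, ← Finset.sum_range_reflect]
  refine Finset.sum_congr rfl fun c hc => ?_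
  have := Finset.mem_range.1 hc
  congr 1
  omega

theorem sum_T_strandWeight (n : ℕ) (d : Dir) :
    ∑ c ∈ Finset.range n, (T (2 * strandWeight n d c) : ℤ[T;T⁻¹]) = qDim n := by
  cases d with
  | up => rfl
  | down => rw [← sum_T_neg]; simp only [strandWeight, mul_neg]

theorem sum_T_neg_strandWeight (n : ℕ) (d : Dir) :
    ∑ c ∈ Finset.range n, (T (-(2 * strandWeight n d c)) : ℤ[T;T⁻¹]) = qDim n := by
  cases d with
  | up => exact sum_T_neg n
  | down => simp only [strandWeight, mul_neg, neg_neg]; rfl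

/-- Multiplication by `{1}` makes the sum telescope to `{n}`. -/
theorem qDim_ne_zero {n : ℕ} (hn : 1 ≤ n) : qDim n ≠ 0 := by
  intro h
  have h1 : qInt 1 * qDim n = qInt n := by
    rw [qDim, Finset.mul_sum, qInt]
    have := Finset.sum_range_sub' (fun c : ℕ => (T (2 * ((n : ℤ) - 2 * c)) : ℤ[T;T⁻¹])) n
    rw [qInt]
    refine Eq.trans (Finset.sum_congr rfl fun c _ => ?_) (this.trans ?_)
    · rw [sub_mul, ← LaurentPolynomial.T_add, ← LaurentPolynomial.T_add]
      congr 2 <;> push_cast <;> ring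
    · congr 2
      ring
  rw [h, mul_zero] at h1
  exact qInt_ne_zero (by omega) h1.symm

/-- The trace of an operator, with the left quantum trace over the strands `s` and the right
quantum trace over the strands `t`. -/
def mixedTrace (n : ℕ) (s t : List Dir) (B : List ℕ → List ℕ → ℤ[T;T⁻¹]) : ℤ[T;T⁻¹] :=
  ∑ x ∈ colorings n s.length, ∑ y ∈ colorings n t.length,
    T (2 * lineWeight n s x) * T (-(2 * lineWeight n t y)) * B (x ++ y) (x ++ y)

theorem mixedTrace_cons (n : ℕ) (s t : List Dir) (d : Dir) (B : List ℕ → List ℕ → ℤ[T;T⁻¹]) :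
    mixedTrace n s (d :: t) B =
      ∑ a ∈ Finset.range n, T (-(2 * strandWeight n d a)) * partialTrace n s t B a := by
  simp only [mixedTrace, partialTrace, List.length_cons, sum_colorings_succ, Finset.mul_sum]
  rw [Finset.sum_comm]
  refine Finset.sum_congr rfl fun a _ => Finset.sum_congr rfl fun x _ =>
    Finset.sum_congr rfl fun y _ => ?_
  simp only [lineWeight, mul_add, neg_add, LaurentPolynomial.T_add]
  ring

theorem mixedTrace_concat (n : ℕ) (s t : List Dir) (d : Dir) (B : List ℕ → List ℕ → ℤ[T;T⁻¹]) :
    mixedTrace n (s ++ [d]) t B =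
      ∑ a ∈ Finset.range n, T (2 * strandWeight n d a) * partialTrace n s t B a := by
  simp only [mixedTrace, partialTrace, List.length_append, List.length_cons, List.length_nil,
    sum_colorings_add, zero_add, sum_colorings_one, Finset.mul_sum]
  rw [Finset.sum_comm]
  refine Finset.sum_congr rfl fun a _ => Finset.sum_congr rfl fun x hx =>
    Finset.sum_congr rfl fun y _ => ?_
  rw [lineWeight_append n (mem_colorings.1 hx).1, List.append_assoc]
  simp only [lineWeight, mul_add, LaurentPolynomial.T_add, add_zero, List.singleton_append]
  ring

/-- Since the partial trace does not depend on the color, closing the remaining strand on either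
side multiplies it by the quantum dimension. Hence a strand may be moved from the left trace to the
right one. -/
theorem mixedTrace_eq_qDim_mul {n : ℕ} {r : List Dir}
    {B : List ℕ → List ℕ → ℤ[T;T⁻¹]}
    (hB : ∀ f, ∀ x ∈ colorings n r.length,
      raiseLine n r (fun z => ∑ y ∈ colorings n r.length, B z y * f y) x =
        ∑ y ∈ colorings n r.length, B x y * raiseLine n r f y)
    {s t : List Dir} {d : Dir} (hr : s ++ d :: t = r) :
    mixedTrace n s (d :: t) B = qDim n * partialTrace n s t B 0 ∧
      mixedTrace n (s ++ [d]) t B = qDim n * partialTrace n s t B 0 := by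
  subst hr
  constructor
  · rw [mixedTrace_cons, ← sum_T_neg_strandWeight n d, Finset.sum_mul]
    exact Finset.sum_congr rfl fun a ha => by rw [partialTrace_eq hB (Finset.mem_range.1 ha)]
  · rw [mixedTrace_concat, ← sum_T_strandWeight n d, Finset.sum_mul]
    exact Finset.sum_congr rfl fun a ha => by rw [partialTrace_eq hB (Finset.mem_range.1 ha)]

theorem mixedTrace_eq {n : ℕ} {r : List Dir} {B : List ℕ → List ℕ → ℤ[T;T⁻¹]}
    (hB : ∀ f, ∀ x ∈ colorings n r.length,
      raiseLine n r (fun z => ∑ y ∈ colorings n r.length, B z y * f y) x =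
        ∑ y ∈ colorings n r.length, B x y * raiseLine n r f y)
    {s t : List Dir} (hr : s ++ t = r) : mixedTrace n s t B = mixedTrace n [] r B := by
  induction s using List.reverseRecOn generalizing t with
  | nil => rw [← hr]; rfl
  | append_singleton s d ih =>
    have hr' : s ++ d :: t = r := by simpa using hr
    rw [(mixedTrace_eq_qDim_mul hB hr').2, ← (mixedTrace_eq_qDim_mul hB hr').1, ih hr']

/-! ### Moving the cut -/

/-- The state sum of a long knot, with color `0` at the ends, can be computed by breaking the
knot at any other point, colored by any color. -/
theorem stateSum_eq_cut {n : ℕ} {s t : List Dir} {d : Dir} {D D' : List Slice}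
    (hD : Composable [Dir.up] D (s ++ d :: t)) (hD' : Composable (s ++ d :: t) D' [Dir.up])
    {a : ℕ} (ha : a < n) :
    stateSum n (D ++ D') [0] [0] = partialTrace n s t
      (fun x y => ∑ c ∈ Finset.range n, stateSum n D' x [c] * stateSum n D [c] y) a := by
  have hn : 1 ≤ n := by omega
  have hcomp : Composable [Dir.up] (D ++ D') [Dir.up] := by
    clear ha
    revert hD
    generalize [Dir.up] = u at hD' ⊢
    intro hD
    have : ∀ v, Composable v D (s ++ d :: t) → Composable v (D ++ D') u := by
      clear hD
      induction D with
      | nil => rintro v rfl; exact hD'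
      | cons x D ih => rintro v ⟨rfl, h⟩; exact ⟨rfl, ih _ h⟩
    exact this u hD
  set B : List ℕ → List ℕ → ℤ[T;T⁻¹] :=
    fun x y => ∑ c ∈ Finset.range n, stateSum n D' x [c] * stateSum n D [c] y with hBdef
  have hB : ∀ f, ∀ x ∈ colorings n (s ++ d :: t).length,
      raiseLine n (s ++ d :: t) (fun z => ∑ y ∈ colorings n (s ++ d :: t).length, B z y * f y) x =
        ∑ y ∈ colorings n (s ++ d :: t).length, B x y * raiseLine n (s ++ d :: t) f y := by
    intro f x hx
    have h : ∀ g : List ℕ → ℤ[T;T⁻¹], ∀ z,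
        ∑ y ∈ colorings n (s ++ d :: t).length, B z y * g y =
          ∑ w ∈ colorings n [Dir.up].length, stateSum n D' z w *
            ∑ y ∈ colorings n (s ++ d :: t).length, stateSum n D w y * g y := by
      intro g z
      simp only [hBdef, Finset.sum_mul, Finset.mul_sum, List.length_singleton, sum_colorings_one]
      rw [Finset.sum_comm]
      simp only [mul_assoc]
    simp only [h]
    rw [stateSum_comm hD' _ hx]
    exact Finset.sum_congr rfl fun w hw => by rw [stateSum_comm hD _ hw]
  have hA : ∀ f, ∀ x ∈ colorings n ([] ++ Dir.up :: []).length,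
      raiseLine n ([] ++ Dir.up :: []) (fun z => ∑ y ∈ colorings n ([] ++ Dir.up :: []).length,
        stateSum n (D ++ D') z y * f y) x =
        ∑ y ∈ colorings n ([] ++ Dir.up :: []).length,
          stateSum n (D ++ D') x y * raiseLine n ([] ++ Dir.up :: []) f y :=
    fun f x hx => stateSum_comm hcomp f hx
  rw [partialTrace_eq hB ha]
  -- After multiplication by the quantum dimension both sides are full quantum traces, one over the
  -- middle line and one over the end line.
  refine mul_left_cancel₀ (qDim_ne_zero hn) ?_
  rw [← (mixedTrace_eq_qDim_mul hB rfl).1, mixedTrace_eq hB rfl]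
  have h1 := (mixedTrace_eq_qDim_mul hA rfl).1
  have h2 : partialTrace n [] [] (stateSum n (D ++ D')) 0 = stateSum n (D ++ D') [0] [0] := by
    simp [partialTrace, lineWeight]
  rw [← h2, ← h1]
  simp only [mixedTrace, List.length_nil, colorings_zero, Finset.sum_singleton, List.nil_append,
    lineWeight, mul_zero, LaurentPolynomial.T_zero, one_mul, List.length_singleton]
  rw [Finset.sum_congr rfl fun y hy => by rw [stateSum_append hD D' hy y]]
  rw [sum_colorings_one]
  simp only [hBdef, Finset.mul_sum]
  rw [Finset.sum_comm]
  refine Finset.sum_congr rfl fun x hx => Finset.sum_congr rfl fun c hc => ?_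
  -- Cyclicity of the quantum trace: where `D'` has a nonzero entry, the weights of the middle and
  -- of the end line agree, and so do the twists.
  by_cases h : stateSum n D' x [c] = 0
  · simp [h]
  · have := stateSum_lineWeight_eq hD' hx h
    rw [this]
    ring

/-! ### Crossings at which the coloring is forced -/

/-- `term h` is the first labelled arc met from `h` on, `h` included. It exists because the forward
orbit of `h` is closed under `σ` and hence contains every arc. Colors do not change before the first
label. -/
theorem exists_next_labelled {H L : Type*} (σ : H → H) (lab : H → Option L)
    (htrans : ∀ S : Set H, S.Nonempty → (∀ h ∈ S, σ h ∈ S) → ∀ h, h ∈ S)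
    (hex : ∃ h, lab h ≠ none) :
    ∃ term : H → H, (∀ h, lab (term h) ≠ none) ∧ (∀ h, lab h ≠ none → term h = h) ∧
      (∀ h, lab h = none → term (σ h) = term h) ∧
      ∀ (col : H → ℕ), (∀ h, lab h = none → col (σ h) = col h) → ∀ h, col (term h) = col h := by
  let R : H → H → Prop := fun h t =>
    ∃ m : ℕ, t = σ^[m] h ∧ lab t ≠ none ∧ ∀ i < m, lab (σ^[i] h) = none
  have hR : ∀ h, ∃ t, R h t := by
    intro h
    obtain ⟨p, hp⟩ := hex
    have hm : p ∈ {x | ∃ m, x = σ^[m] h} := by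
      refine htrans {x | ∃ m, x = σ^[m] h} ⟨h, 0, rfl⟩ ?_ p
      rintro _ ⟨m, rfl⟩
      exact ⟨m + 1, (Function.iterate_succ_apply' σ m h).symm⟩
    obtain ⟨m, rfl⟩ := hm
    have hex' : ∃ m, lab (σ^[m] h) ≠ none := ⟨m, hp⟩
    classical
    refine ⟨_, Nat.find hex', rfl, Nat.find_spec hex', fun i hi => ?_⟩
    simpa using Nat.find_min hex' hi
  have huniq : ∀ h t t', R h t → R h t' → t = t' := by
    rintro h _ _ ⟨m, rfl, h1, h2⟩ ⟨m', rfl, h1', h2'⟩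
    rcases Nat.lt_trichotomy m m' with h | h | h
    · exact absurd (h2' _ h) h1
    · rw [h]
    · exact absurd (h2 _ h) h1'
  choose term hterm using hR
  refine ⟨term, fun h => (hterm h).choose_spec.2.1, fun h hh => ?_, fun h hh => ?_, ?_⟩
  · exact huniq h _ _ (hterm h) ⟨0, rfl, hh, by simp⟩
  · refine huniq h _ _ ?_ (hterm h)
    obtain ⟨m, h1, h2, h3⟩ := hterm (σ h)
    refine ⟨m + 1, by rw [h1]; rfl, h2, fun i hi => ?_⟩
    cases i with
    | zero => exact hh
    | succ i => exact h3 i (by omega)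
  · intro col hcol h
    obtain ⟨m, h1, -, h3⟩ := hterm h
    rw [h1]
    clear h1
    induction m with
    | zero => rfl
    | succ m ih =>
      rw [Function.iterate_succ_apply', hcol _ (h3 m (by omega)),
        ih fun i hi => h3 i (by omega)]

/-- A knot runs through its arcs by a map `σ`, whose steps are labelled by the crossings they
pass, with `true` where the color decreases and with `false` where it increases.  There are an arc
and an extremal color of it that force two crossings to leave all colors unchanged. -/
theorem exists_forcing {H C : Type*} (σ : H → H) (lab : H → Option (C × Bool))
    (htrans : ∀ S : Set H, S.Nonempty → (∀ h ∈ S, σ h ∈ S) → ∀ h, h ∈ S)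
    (huniq : ∀ h h' p, lab h = some p → lab h' = some p → h = h')
    {c₁ c₂ : C} (hne : c₁ ≠ c₂) (h₁ : ∀ b, ∃ h, lab h = some (c₁, b))
    (h₂ : ∀ b, ∃ h, lab h = some (c₂, b)) :
    ∃ (e : H) (top : Bool) (c c' : C), c ≠ c' ∧ (∃ h b, lab h = some (c, b)) ∧
      (∃ h b, lab h = some (c', b)) ∧
      ∀ (m : ℕ) (col : H → ℕ) (k : C → ℕ), (∀ h, col h ≤ m) →
        (∀ h, lab h = none → col (σ h) = col h) →
        (∀ h c, lab h = some (c, true) → col (σ h) + k c = col h) →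
        (∀ h c, lab h = some (c, false) → col (σ h) = col h + k c) →
        col e = (if top then m else 0) → k c = 0 ∧ k c' = 0 := by
  obtain ⟨p₁, hp₁⟩ := h₁ true
  obtain ⟨term, ht1, ht2, ht3, ht4⟩ := exists_next_labelled σ lab htrans ⟨p₁, by simp [hp₁]⟩
  -- Transitivity passes to the labelled arcs, with the return map `h ↦ term (σ h)`.
  have hclosed : ∀ Q : Set H, (∃ h ∈ Q, lab h ≠ none) →
      (∀ h ∈ Q, lab h ≠ none → term (σ h) ∈ Q) → ∀ h, lab h ≠ none → h ∈ Q := by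
    rintro Q ⟨h₀, hQ₀, hl₀⟩ hQ h hl
    have := htrans {x | term x ∈ Q} ⟨h₀, by simpa [ht2 h₀ hl₀] using hQ₀⟩ (by
      intro x hx
      by_cases hlx : lab x = none
      · simpa [ht3 x hlx] using hx
      · have hx' : term x ∈ Q := hx
        rw [ht2 x hlx] at hx'
        exact hQ x hx' hlx) h
    simpa [ht2 h hl] using this
  -- An increase followed by a decrease at another crossing: color `0` in between can neither result
  -- from a positive increase nor decrease further.
  by_cases hA : ∃ h c' c, lab h = some (c', false) ∧ lab (term (σ h)) = some (c, true) ∧ c ≠ c'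
  · obtain ⟨h, c', c, e1, e2, hcc⟩ := hA
    refine ⟨σ h, false, c, c', hcc, ⟨_, _, e2⟩, ⟨_, _, e1⟩, ?_⟩
    intro m col k _ hn ht hf he
    have a1 := hf h c' e1
    have a2 := ht _ c e2
    rw [ht4 col hn] at a2
    simp only [Bool.false_eq_true, if_false] at he
    omega
  -- The mirror situation, with the largest color `m` in between.
  by_cases hB : ∃ h c' c, lab h = some (c', true) ∧ lab (term (σ h)) = some (c, false) ∧ c ≠ c'
  · obtain ⟨h, c', c, e1, e2, hcc⟩ := hB
    refine ⟨σ h, true, c, c', hcc, ⟨_, _, e2⟩, ⟨_, _, e1⟩, ?_⟩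
    intro m col k hm hn ht hf he
    have a1 := ht h c' e1
    have a2 := hf _ c e2
    have a3 := hm h
    have a4 := hm (σ (term (σ h)))
    rw [ht4 col hn] at a2
    simp only [if_true] at he
    omega
  -- Otherwise the arcs with a decrease would be closed under the return map, leaving no room for an
  -- increase.
  have hflip : ∃ h c c', lab h = some (c, true) ∧ lab (term (σ h)) = some (c', false) := by
    by_contra hcon
    obtain ⟨q, hq⟩ := h₁ false
    obtain ⟨c, hc⟩ : ∃ c, lab q = some (c, true) := by
      refine hclosed {h | ∃ c, lab h = some (c, true)} ⟨p₁, ⟨c₁, hp₁⟩, by simp [hp₁]⟩ ?_ q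
        (by simp [hq])
      rintro h ⟨c, hc⟩ _
      obtain ⟨⟨c', b⟩, hl⟩ := Option.ne_none_iff_exists'.1 (ht1 (σ h))
      cases b with
      | true => exact ⟨c', hl⟩
      | false => exact absurd ⟨h, c, c', hc, hl⟩ hcon
    rw [hq] at hc
    simp at hc
  obtain ⟨h, c, c', e1, e2⟩ := hflip
  obtain rfl : c' = c := by
    by_contra hcc
    exact hB ⟨h, c, c', e1, e2, hcc⟩
  set q := term (σ h) with hq
  obtain ⟨⟨c₃, b⟩, e3⟩ := Option.ne_none_iff_exists'.1 (ht1 (σ q))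
  -- A closed set of labelled arcs inside `{h, q}` would contain all labels, but these two arcs
  -- belong to the single crossing `c'`.
  have hall : ∀ Q : Set H, Q ⊆ {h, q} → (∃ h ∈ Q, lab h ≠ none) →
      (∀ h ∈ Q, lab h ≠ none → term (σ h) ∈ Q) → False := by
    intro Q hQ hQ1 hQ2
    have hQall := hclosed Q hQ1 hQ2
    have hc : ∀ c b, (∃ x, lab x = some (c, b)) → c = c' := by
      rintro c b ⟨x, hx⟩
      rcases hQ (hQall x (by simp [hx])) with rfl | rfl
      · rw [e1] at hx; simp at hx; exact hx.1.symm
      · rw [e2] at hx; simp at hx; exact hx.1.symm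
    exact hne ((hc c₁ true (h₁ true)).trans (hc c₂ true (h₂ true)).symm)
  cases b with
  | true =>
    obtain rfl : c₃ = c' := by
      by_contra hcc
      exact hA ⟨q, c', c₃, e2, e3, hcc⟩
    -- A decrease after `q` is again at `c'`, hence is the passage `h`, and the knot closes up after
    -- one crossing.
    have hback : term (σ q) = h := huniq _ _ _ e3 e1
    refine (hall {h, q} subset_rfl ⟨h, by simp, by simp [e1]⟩ ?_).elim
    rintro x (rfl | rfl) _
    · exact Or.inr rfl
    · exact Or.inl hback
  | false =>
    have hcc : c₃ ≠ c' := by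
      rintro rfl
      have hfix : term (σ q) = q := huniq _ _ _ e3 e2
      refine hall {q} (by simp) ⟨q, rfl, by simp [e2]⟩ ?_
      rintro x rfl _
      exact hfix
    -- Color `m` after the decrease at `c'` forces the change there to be zero; the color is then
    -- still `m` after the increase at `c'`, so it cannot grow at `c₃`.
    refine ⟨σ h, true, c₃, c', hcc, ⟨_, _, e3⟩, ⟨_, _, e2⟩, ?_⟩
    intro m col k hm hn ht hf he
    have a1 := ht h c' e1
    have a2 := hf _ c' e2
    have a3 := hm h
    have a5 := hf _ c₃ e3
    have a6 := hm (σ (term (σ q)))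
    have a7 := ht4 col hn (σ h)
    rw [ht4 col hn] at a5
    rw [← hq] at a7
    simp only [if_true] at he
    omega

/-! ### Half-edges of a diagram

The triple `(i, b, j)` stands for the `j`-th point on the lower (`b = false`) or upper (`b = true`)
boundary line of the slice `i`. -/

/-- The strands through one of the boundary lines of a slice. -/
def Slice.boundary (x : Slice) (b : Bool) : List Dir := if b then x.tgt else x.src

/-- The direction, on a boundary line, of the strands that enter a slice. -/
def inDir (b : Bool) : Dir := if b then Dir.down else Dir.up

/-- The direction, on a boundary line, of the strands that leave a slice. -/
def outDir (b : Bool) : Dir := if b then Dir.up else Dir.down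

/-- The strands through one of the boundary lines of an elementary piece. -/
def Elem.boundary (e : Elem) (b : Bool) : List Dir := if b then e.tgt else e.src

theorem Elem.length_boundary (e : Elem) (b : Bool) :
    (e.boundary b).length = 2 ∧ (e.boundary !b).length = 2 ∨
      (e.boundary b).length = 2 ∧ (e.boundary !b).length = 0 ∨
      (e.boundary b).length = 0 ∧ (e.boundary !b).length = 2 := by
  cases e <;> cases b <;> simp [Elem.boundary, Elem.src, Elem.tgt]

theorem Slice.boundary_eq (x : Slice) (b : Bool) :
    x.boundary b = x.left ++ (x.elem.boundary b ++ x.right) := by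
  cases b
  · exact Slice.src_eq x
  · exact Slice.tgt_eq x

/-- The other end of the strand that starts in a boundary point of a slice. -/
def Slice.across (x : Slice) (p : Bool × ℕ) : Bool × ℕ :=
  if p.2 < x.left.length then (!p.1, p.2)
  else if p.2 < x.left.length + (x.elem.boundary p.1).length then
    -- The reflection exchanges the positions `x.left.length` and `x.left.length + 1`, which
    -- describes crossings, caps and cups alike.
    (if (x.elem.boundary !p.1).length = 0 then p.1 else !p.1, 2 * x.left.length + 1 - p.2)
  else (!p.1, p.2 - (x.elem.boundary p.1).length + (x.elem.boundary !p.1).length)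

theorem Slice.across_left (x : Slice) (b : Bool) {j : ℕ} (h : j < x.left.length) :
    x.across (b, j) = (!b, j) := if_pos h

theorem Slice.across_turn (x : Slice) {b : Bool} {j : ℕ} (h : x.left.length ≤ j)
    (h' : j < x.left.length + (x.elem.boundary b).length)
    (hb : (x.elem.boundary !b).length = 0) :
    x.across (b, j) = (b, 2 * x.left.length + 1 - j) := by
  rw [Slice.across, if_neg (by simpa using h), if_pos h', if_pos hb]

theorem Slice.across_through (x : Slice) {b : Bool} {j : ℕ} (h : x.left.length ≤ j)
    (h' : j < x.left.length + (x.elem.boundary b).length)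
    (hb : (x.elem.boundary !b).length ≠ 0) :
    x.across (b, j) = (!b, 2 * x.left.length + 1 - j) := by
  rw [Slice.across, if_neg (by simpa using h), if_pos h', if_neg hb]

theorem Slice.across_right (x : Slice) {b : Bool} {j : ℕ}
    (h : x.left.length + (x.elem.boundary b).length ≤ j) :
    x.across (b, j) = (!b, j - (x.elem.boundary b).length + (x.elem.boundary !b).length) := by
  rw [Slice.across, if_neg (by dsimp only; omega), if_neg (by simpa using h)]

theorem Slice.across_across (x : Slice) (p : Bool × ℕ) : x.across (x.across p) = p := by
  obtain ⟨b, j⟩ := p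
  have h := x.elem.length_boundary b
  rcases Nat.lt_or_ge j x.left.length with h1 | h1
  · rw [x.across_left b h1, x.across_left _ h1, Bool.not_not]
  rcases Nat.lt_or_ge j (x.left.length + (x.elem.boundary b).length) with h2 | h2
  · by_cases h3 : (x.elem.boundary !b).length = 0
    · rw [x.across_turn h1 h2 h3, x.across_turn (by omega) (by omega) h3]
      congr 1; omega
    · rw [x.across_through h1 h2 h3, x.across_through (by omega) (by omega)
        (by rw [Bool.not_not]; omega), Bool.not_not]
      congr 1; omega
  · rw [x.across_right h2, x.across_right (by omega), Bool.not_not]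
    congr 1; omega

theorem dir_cases (d : Dir) (b : Bool) : d = inDir b ∨ d = outDir b := by
  cases d <;> cases b <;> simp [inDir, outDir]

theorem inDir_ne_outDir (b : Bool) : inDir b ≠ outDir b := by
  cases b <;> simp [inDir, outDir]

theorem inDir_not (b : Bool) : inDir (!b) = outDir b := by cases b <;> rfl

theorem outDir_not (b : Bool) : outDir (!b) = inDir b := by cases b <;> rfl

/-- The opposite direction. -/
def Dir.flip : Dir → Dir
  | Dir.up => Dir.down
  | Dir.down => Dir.up

theorem flip_inDir (b : Bool) : (inDir b).flip = outDir b := by cases b <;> rfl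

theorem flip_outDir (b : Bool) : (outDir b).flip = inDir b := by cases b <;> rfl

theorem Elem.boundary_turn (e : Elem) {b : Bool} {j : ℕ} {d : Dir} (hj : j < 2)
    (h : (e.boundary b)[j]? = some d) (hb : (e.boundary !b).length = 0) :
    (e.boundary b)[1 - j]? = some d.flip := by
  obtain rfl | rfl : j = 0 ∨ j = 1 := by omega
  all_goals
    cases e <;> cases b <;> cases d <;> simp_all [Elem.boundary, Elem.src, Elem.tgt, Dir.flip]

theorem Elem.boundary_through (e : Elem) {b : Bool} {j : ℕ} {d : Dir} (hj : j < 2)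
    (h : (e.boundary b)[j]? = some d) (hb : (e.boundary !b).length ≠ 0) :
    (e.boundary !b)[1 - j]? = some d := by
  obtain rfl | rfl : j = 0 ∨ j = 1 := by omega
  all_goals cases e <;> cases b <;> cases d <;> simp_all [Elem.boundary, Elem.src, Elem.tgt]

/-- A strand that turns back meets the same boundary line in the opposite direction; one that passes
through keeps its direction. Hence incoming half-edges are matched with outgoing ones. -/
theorem Slice.boundary_across (x : Slice) {b : Bool} {j : ℕ} {d : Dir}
    (h : (x.boundary b)[j]? = some d) :
    (x.boundary (x.across (b, j)).1)[(x.across (b, j)).2]? =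
      some (if (x.across (b, j)).1 = b then d.flip else d) := by
  have hl := x.elem.length_boundary b
  have hb : (!b) ≠ b := by cases b <;> simp
  simp only [Slice.boundary_eq] at h ⊢
  rcases Nat.lt_or_ge j x.left.length with h1 | h1
  · rw [x.across_left b h1]
    rw [List.getElem?_append_left h1] at h ⊢
    rw [h, if_neg hb]
  rw [List.getElem?_append_right h1] at h
  rcases Nat.lt_or_ge j (x.left.length + (x.elem.boundary b).length) with h2 | h2
  · rw [List.getElem?_append_left (by omega)] at h
    by_cases h3 : (x.elem.boundary !b).length = 0
    · rw [x.across_turn h1 h2 h3]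
      dsimp only
      rw [List.getElem?_append_right (by omega), List.getElem?_append_left (by omega),
        show 2 * x.left.length + 1 - j - x.left.length = 1 - (j - x.left.length) by omega,
        if_pos rfl]
      exact x.elem.boundary_turn (by omega) h h3
    · rw [x.across_through h1 h2 h3]
      dsimp only
      rw [List.getElem?_append_right (by omega), List.getElem?_append_left (by omega),
        show 2 * x.left.length + 1 - j - x.left.length = 1 - (j - x.left.length) by omega,
        if_neg hb]
      exact x.elem.boundary_through (by omega) h h3
  · rw [List.getElem?_append_right (by omega)] at h
    rw [x.across_right h2]
    dsimp only
    rw [List.getElem?_append_right (by omega), List.getElem?_append_right (by omega), if_neg hb,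
      ← h]
    congr 1; omega

theorem Slice.across_in (x : Slice) {b : Bool} {j : ℕ} (h : (x.boundary b)[j]? = some (inDir b)) :
    (x.boundary (x.across (b, j)).1)[(x.across (b, j)).2]? =
      some (outDir (x.across (b, j)).1) := by
  rw [x.boundary_across h]
  split_ifs with hb
  · rw [hb, flip_inDir]
  · rw [Bool.eq_not_of_ne hb, outDir_not]

theorem Slice.across_out (x : Slice) {b : Bool} {j : ℕ}
    (h : (x.boundary b)[j]? = some (outDir b)) :
    (x.boundary (x.across (b, j)).1)[(x.across (b, j)).2]? =
      some (inDir (x.across (b, j)).1) := by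
  rw [x.boundary_across h]
  split_ifs with hb
  · rw [hb, flip_outDir]
  · rw [Bool.eq_not_of_ne hb, inDir_not]

/-! ### Consecutive slices and the gluing of half-edges -/

theorem Composable.split {s t : List Dir} {D : List Slice} (h : Composable s D t) {i : ℕ}
    {x : Slice} (hx : D[i]? = some x) :
    Composable s (D.take i) x.src ∧ Composable x.src (D.drop i) t := by
  induction D generalizing s i with
  | nil => simp at hx
  | cons y D ih =>
    obtain ⟨rfl, h'⟩ := h
    cases i with
    | zero =>
      obtain rfl : y = x := by simpa using hx
      exact ⟨rfl, rfl, h'⟩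
    | succ i =>
      have := ih h' (by simpa using hx)
      exact ⟨⟨rfl, this.1⟩, this.2⟩

theorem Composable.src_zero {s t : List Dir} {D : List Slice} (h : Composable s D t)
    {x : Slice} (hx : D[0]? = some x) : x.src = s := by
  cases D with
  | nil => simp at hx
  | cons y D =>
    obtain rfl : y = x := by simpa using hx
    exact h.1

theorem Composable.tgt_eq_src {s t : List Dir} {D : List Slice} (h : Composable s D t) {i : ℕ}
    {x y : Slice} (hx : D[i]? = some x) (hy : D[i + 1]? = some y) : x.tgt = y.src := by
  have h1 := (h.split hx).2
  obtain ⟨hi, rfl⟩ := List.getElem?_eq_some_iff.1 hx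
  rw [List.drop_eq_getElem_cons hi] at h1
  exact (h1.2.src_zero (by simpa using hy)).symm

theorem Composable.tgt_last {s t : List Dir} {D : List Slice} (h : Composable s D t) {i : ℕ}
    {x : Slice} (hx : D[i]? = some x) (hi : i + 1 = D.length) : x.tgt = t := by
  have h1 := (h.split hx).2
  obtain ⟨hi', rfl⟩ := List.getElem?_eq_some_iff.1 hx
  rw [List.drop_eq_getElem_cons hi', List.drop_eq_nil_of_le (by omega)] at h1
  exact h1.2

/-- The half-edges whose strand has the given direction. -/
def IsHalfEdge (D : List Slice) (dir : Bool → Dir) (h : ℕ × Bool × ℕ) : Prop :=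
  ∃ x, D[h.1]? = some x ∧ (x.boundary h.2.1)[h.2.2]? = some (dir h.2.1)

/-- The other end of the strand through a slice. -/
def crossSlice (D : List Slice) (h : ℕ × Bool × ℕ) : ℕ × Bool × ℕ :=
  match D[h.1]? with
  | some x => (h.1, x.across h.2)
  | none => h

/-- The half-edge at the same point, in the neighboring slice; the upper end of the long knot is
closed up with its lower end. -/
def glue (N : ℕ) : ℕ × Bool × ℕ → ℕ × Bool × ℕ
  | (i, true, j) => (if i + 1 < N then i + 1 else 0, false, j)
  | (i, false, j) => (if i = 0 then N - 1 else i - 1, true, j)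

theorem crossSlice_eq {D : List Slice} {i : ℕ} {x : Slice} (hx : D[i]? = some x) (p : Bool × ℕ) :
    crossSlice D (i, p) = (i, x.across p) := by
  simp [crossSlice, hx]

theorem crossSlice_in {D : List Slice} {h : ℕ × Bool × ℕ} (hh : IsHalfEdge D inDir h) :
    IsHalfEdge D outDir (crossSlice D h) := by
  obtain ⟨x, hx, hb⟩ := hh
  obtain ⟨i, b, j⟩ := h
  rw [crossSlice_eq hx]
  exact ⟨x, hx, x.across_in hb⟩

theorem crossSlice_out {D : List Slice} {h : ℕ × Bool × ℕ} (hh : IsHalfEdge D outDir h) :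
    IsHalfEdge D inDir (crossSlice D h) := by
  obtain ⟨x, hx, hb⟩ := hh
  obtain ⟨i, b, j⟩ := h
  rw [crossSlice_eq hx]
  exact ⟨x, hx, x.across_out hb⟩

theorem crossSlice_crossSlice {D : List Slice} {dir : Bool → Dir} {h : ℕ × Bool × ℕ}
    (hh : IsHalfEdge D dir h) : crossSlice D (crossSlice D h) = h := by
  obtain ⟨x, hx, hb⟩ := hh
  obtain ⟨i, p⟩ := h
  rw [crossSlice_eq hx, crossSlice_eq hx, x.across_across]

theorem IsHalfEdge.lt {D : List Slice} {dir : Bool → Dir} {h : ℕ × Bool × ℕ}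
    (hh : IsHalfEdge D dir h) : h.1 < D.length := by
  obtain ⟨x, hx, -⟩ := hh
  exact (List.getElem?_eq_some_iff.1 hx).1

theorem glue_glue {N : ℕ} {h : ℕ × Bool × ℕ} (hh : h.1 < N) : glue N (glue N h) = h := by
  obtain ⟨i, b, j⟩ := h
  dsimp only at hh
  cases b with
  | true =>
    simp only [glue]
    by_cases h1 : i + 1 < N
    · simp [h1]
    · simp [h1]; omega
  | false =>
    simp only [glue]
    by_cases h1 : i = 0
    · simp [h1, show ¬ N - 1 + 1 < N by omega]
    · simp [h1, show i - 1 + 1 < N by omega]; omega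

/-- Both ends of the long knot are one upward strand, so the passage from the last slice to the
first respects directions like any inner line. -/
theorem exists_glue {D : List Slice} (hD : Composable [Dir.up] D [Dir.up]) {i : ℕ} {x : Slice}
    (hx : D[i]? = some x) (b : Bool) (j : ℕ) :
    ∃ i' y, glue D.length (i, b, j) = (i', !b, j) ∧ D[i']? = some y ∧
      y.boundary (!b) = x.boundary b := by
  have hi := (List.getElem?_eq_some_iff.1 hx).1
  cases b with
  | true =>
    simp only [glue, Slice.boundary]
    by_cases h1 : i + 1 < D.length
    · have hy : D[i + 1]? = some D[i + 1] := List.getElem?_eq_getElem h1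
      exact ⟨i + 1, _, by simp [h1], hy, by simpa using (hD.tgt_eq_src hx hy).symm⟩
    · have h0 : 0 < D.length := by omega
      have hy : D[0]? = some D[0] := List.getElem?_eq_getElem h0
      exact ⟨0, _, by simp [h1], hy, by
        simpa using (hD.src_zero hy).trans (hD.tgt_last hx (by omega)).symm⟩
  | false =>
    simp only [glue, Slice.boundary]
    by_cases h1 : i = 0
    · subst h1
      have h0 : D.length - 1 < D.length := by omega
      have hy : D[D.length - 1]? = some D[D.length - 1] := List.getElem?_eq_getElem h0
      exact ⟨D.length - 1, _, by simp, hy, by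
        simpa using (hD.tgt_last hy (by omega)).trans (hD.src_zero hx).symm⟩
    · have h0 : i - 1 < D.length := by omega
      have hy : D[i - 1]? = some D[i - 1] := List.getElem?_eq_getElem h0
      exact ⟨i - 1, _, by simp [h1], hy, by
        simpa using hD.tgt_eq_src hy (by rw [Nat.sub_add_cancel (by omega)]; exact hx)⟩

theorem glue_in {D : List Slice} (hD : Composable [Dir.up] D [Dir.up]) {h : ℕ × Bool × ℕ}
    (hh : IsHalfEdge D inDir h) : IsHalfEdge D outDir (glue D.length h) := by
  obtain ⟨x, hx, hb⟩ := hh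
  obtain ⟨i, b, j⟩ := h
  obtain ⟨i', y, h1, h2, h3⟩ := exists_glue hD hx b j
  rw [h1]
  exact ⟨y, h2, by dsimp only at hb ⊢; rw [h3, outDir_not, hb]⟩

theorem glue_out {D : List Slice} (hD : Composable [Dir.up] D [Dir.up]) {h : ℕ × Bool × ℕ}
    (hh : IsHalfEdge D outDir h) : IsHalfEdge D inDir (glue D.length h) := by
  obtain ⟨x, hx, hb⟩ := hh
  obtain ⟨i, b, j⟩ := h
  obtain ⟨i', y, h1, h2, h3⟩ := exists_glue hD hx b j
  rw [h1]
  exact ⟨y, h2, by dsimp only at hb ⊢; rw [h3, inDir_not, hb]⟩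

/-! ### The traversal of the closed knot -/

/-- The next half-edge along the closure of the knot. -/
def nextHalfEdge (D : List Slice) (h : ℕ × Bool × ℕ) : ℕ × Bool × ℕ :=
  glue D.length (crossSlice D h)

theorem nextHalfEdge_in {D : List Slice} (hD : Composable [Dir.up] D [Dir.up]) {h : ℕ × Bool × ℕ}
    (hh : IsHalfEdge D inDir h) : IsHalfEdge D inDir (nextHalfEdge D h) :=
  glue_out hD (crossSlice_in hh)

theorem not_in_of_out {D : List Slice} {h : ℕ × Bool × ℕ} (h1 : IsHalfEdge D outDir h) :
    ¬ IsHalfEdge D inDir h := by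
  rintro ⟨y, hy, hb⟩
  obtain ⟨x, hx, hb'⟩ := h1
  rw [hx] at hy
  obtain rfl := Option.some.inj hy
  rw [hb'] at hb
  exact inDir_ne_outDir _ (Option.some.inj hb).symm

theorem finite_isHalfEdge (D : List Slice) (dir : Bool → Dir) :
    {h | IsHalfEdge D dir h}.Finite := by
  refine (Set.finite_range fun q : (Σ i : Fin D.length, Σ b : Bool, Fin (D[i].boundary b).length) =>
    ((q.1 : ℕ), q.2.1, (q.2.2 : ℕ))).subset ?_
  rintro ⟨i, b, j⟩ ⟨x, hx, hb⟩
  obtain ⟨hi, rfl⟩ := List.getElem?_eq_some_iff.1 hx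
  exact ⟨⟨⟨i, hi⟩, b, ⟨j, (List.getElem?_eq_some_iff.1 hb).1⟩⟩, rfl⟩

/-- One component means one orbit. Membership in a closed set is transported along strand pieces,
after being extended to outgoing half-edges, and `single_component` connects everything to the lower
end. -/
theorem LongKnotDiagram.halfEdge_mem_of_closed (K : LongKnotDiagram) {S : Set (ℕ × Bool × ℕ)}
    (hS : ∀ h ∈ S, IsHalfEdge K.slices inDir h) (hne : S.Nonempty)
    (hcl : ∀ h ∈ S, nextHalfEdge K.slices h ∈ S) {h : ℕ × Bool × ℕ}
    (hh : IsHalfEdge K.slices inDir h) : h ∈ S := by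
  set D := K.slices with hDdef
  have hD : Composable [Dir.up] D [Dir.up] := K.composable
  have hback : ∀ h, IsHalfEdge D inDir h → nextHalfEdge D h ∈ S → h ∈ S := by
    intro h hh hn
    have hfin : S.Finite := (finite_isHalfEdge D inDir).subset hS
    have hinj : ∀ a, IsHalfEdge D inDir a → ∀ b, IsHalfEdge D inDir b →
        nextHalfEdge D a = nextHalfEdge D b → a = b := by
      intro a ha b hb hab
      have h1 := congrArg (glue D.length) hab
      rw [nextHalfEdge, nextHalfEdge, glue_glue (crossSlice_in ha).lt,
        glue_glue (crossSlice_in hb).lt] at h1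
      rw [← crossSlice_crossSlice ha, h1, crossSlice_crossSlice hb]
    -- An injective self-map of a finite set is onto, so `S` is also closed backwards; this is
    -- needed because strand pieces are related without regard to orientation.
    have hsurj : nextHalfEdge D '' S = S := by
      refine Set.eq_of_subset_of_ncard_le (Set.image_subset_iff.2 hcl) ?_ hfin
      rw [Set.InjOn.ncard_image fun a ha b hb => hinj a (hS a ha) b (hS b hb)]
    rw [← hsurj] at hn
    obtain ⟨a, ha, hab⟩ := hn
    rw [← hinj a (hS a ha) h hh hab]
    exact ha
  -- An outgoing half-edge is counted through the incoming one at the same point.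
  let P : ℕ × Bool × ℕ → Prop := fun h =>
    h ∈ S ∨ (IsHalfEdge D outDir h ∧ glue D.length h ∈ S)
  have hPin : ∀ h, IsHalfEdge D inDir h → (P h ↔ h ∈ S) := fun h hh =>
    ⟨fun hp => hp.resolve_right fun h' => not_in_of_out h'.1 hh, Or.inl⟩
  have hPout : ∀ h, IsHalfEdge D outDir h → (P h ↔ glue D.length h ∈ S) := fun h hh =>
    ⟨fun hp => (hp.resolve_left fun h' => not_in_of_out hh (hS h h')).2, fun h' => Or.inr ⟨hh, h'⟩⟩
  have hcross : ∀ h, IsHalfEdge D inDir h → (P h ↔ P (crossSlice D h)) := fun h hh => by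
    rw [hPin h hh, hPout _ (crossSlice_in hh)]
    exact ⟨hcl h, hback h hh⟩
  have hvalid : ∀ i x b j, D[i]? = some x → j < (x.boundary b).length →
      IsHalfEdge D inDir (i, b, j) ∨ IsHalfEdge D outDir (i, b, j) := by
    intro i x b j hx hj
    have hget : (x.boundary b)[j]? = some (x.boundary b)[j] := List.getElem?_eq_getElem hj
    rcases dir_cases (x.boundary b)[j] b with hd | hd
    · exact Or.inl ⟨x, hx, by dsimp only; rw [hget, hd]⟩
    · exact Or.inr ⟨x, hx, by dsimp only; rw [hget, hd]⟩
  have hcross' : ∀ i x b j, D[i]? = some x → j < (x.boundary b).length →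
      (P (i, b, j) ↔ P (i, x.across (b, j))) := by
    intro i x b j hx hj
    rw [← crossSlice_eq hx]
    rcases hvalid i x b j hx hj with hv | hv
    · exact hcross _ hv
    · rw [hcross _ (crossSlice_out hv), crossSlice_crossSlice hv]
  have hglue : ∀ i x b j, D[i]? = some x → j < (x.boundary b).length →
      (P (i, b, j) ↔ P (glue D.length (i, b, j))) := by
    intro i x b j hx hj
    rcases hvalid i x b j hx hj with hv | hv
    · rw [hPin _ hv, hPout _ (glue_in hD hv), glue_glue hv.lt]
    · rw [hPout _ hv, hPin _ (glue_out hD hv)]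
  -- The same property for points of the diagram; the top line is identified with line `0`, as in
  -- the closure.
  let Q : ℕ × ℕ → Prop := fun p => P (if p.1 < D.length then p.1 else 0, false, p.2)
  have hQ : ∀ i x b j, D[i]? = some x → j < (x.boundary b).length →
      (P (i, b, j) ↔ Q (i + if b then 1 else 0, j)) := by
    intro i x b j hx hj
    have hi := (List.getElem?_eq_some_iff.1 hx).1
    cases b with
    | false => simp [Q, hi]
    | true => rw [hglue i x true j hx hj]; simp [Q, glue]
  have hstep : ∀ i x b j b' j', D[i]? = some x → j < (x.boundary b).length →
      x.across (b, j) = (b', j') →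
      (Q (i + if b then 1 else 0, j) ↔ Q (i + if b' then 1 else 0, j')) := by
    intro i x b j b' j' hx hj hac
    have hj' : j' < (x.boundary b').length := by
      rcases hvalid i x b j hx hj with hv | hv
      · have := crossSlice_in hv
        rw [crossSlice_eq hx, hac] at this
        obtain ⟨y, hy, hl⟩ := this
        rw [hx] at hy
        obtain rfl := Option.some.inj hy
        exact (List.getElem?_eq_some_iff.1 hl).1
      · have := crossSlice_out hv
        rw [crossSlice_eq hx, hac] at this
        obtain ⟨y, hy, hl⟩ := this
        rw [hx] at hy
        obtain rfl := Option.some.inj hy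
        exact (List.getElem?_eq_some_iff.1 hl).1
    rw [← hQ i x b j hx hj, hcross' i x b j hx hj, hac, hQ i x b' j' hx hj']
  have hpiece : ∀ p q, StrandPiece D p q → (Q p ↔ Q q) := by
    intro p q hpq
    cases hpq with
    | @left i j x hx hj =>
      exact hstep i x false j true j hx (by simp [Slice.boundary_eq]; omega) (x.across_left _ hj)
    | @right i j x hx hj =>
      refine hstep i x false _ true _ hx (by simp [Slice.boundary_eq, Elem.boundary]; omega) ?_
      rw [x.across_right (by simp [Elem.boundary])]
      simp [Elem.boundary]; omega
    | @crossingRight i x hx hc =>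
      have hl : (x.elem.boundary false).length = 2 ∧ (x.elem.boundary true).length = 2 := by
        rcases hc with hc | hc <;> rw [hc] <;> simp [Elem.boundary, Elem.src, Elem.tgt]
      refine hstep i x false _ true _ hx (by simp [Slice.boundary_eq, hl]) ?_
      rw [x.across_through le_rfl (by omega) (by simp [hl])]
      simp; omega
    | @crossingLeft i x hx hc =>
      have hl : (x.elem.boundary false).length = 2 ∧ (x.elem.boundary true).length = 2 := by
        rcases hc with hc | hc <;> rw [hc] <;> simp [Elem.boundary, Elem.src, Elem.tgt]
      refine hstep i x false _ true _ hx (by simp [Slice.boundary_eq, hl]; omega) ?_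
      rw [x.across_through (by omega) (by omega) (by simp [hl])]
      simp; omega
    | @cap i x hx hc =>
      have hl : (x.elem.boundary false).length = 2 ∧ (x.elem.boundary true).length = 0 := by
        rcases hc with hc | hc <;> rw [hc] <;> simp [Elem.boundary, Elem.src, Elem.tgt]
      refine hstep i x false _ false _ hx (by simp [Slice.boundary_eq, hl]) ?_
      rw [x.across_turn le_rfl (by omega) (by simp [hl])]
      simp; omega
    | @cup i x hx hc =>
      have hl : (x.elem.boundary false).length = 0 ∧ (x.elem.boundary true).length = 2 := by
        rcases hc with hc | hc <;> rw [hc] <;> simp [Elem.boundary, Elem.src, Elem.tgt]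
      refine hstep i x true _ true _ hx (by simp [Slice.boundary_eq, hl]) ?_
      rw [x.across_turn le_rfl (by omega) (by simp [hl])]
      simp; omega
  have heqv : ∀ p q, Relation.EqvGen (StrandPiece D) p q → (Q p ↔ Q q) := by
    intro p q hpq
    induction hpq with
    | rel _ _ h => exact hpiece _ _ h
    | refl _ => rfl
    | symm _ _ _ ih => exact ih.symm
    | trans _ _ _ _ _ ih1 ih2 => exact ih1.trans ih2
  have hall : ∀ i x b j, D[i]? = some x → j < (x.boundary b).length →
      (P (i, b, j) ↔ Q (0, 0)) := by
    have hf : ∀ i x j, D[i]? = some x → j < (x.boundary false).length →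
        (P (i, false, j) ↔ Q (0, 0)) := by
      intro i x j hx hj
      rw [hQ i x false j hx hj]
      exact (heqv _ _ (K.single_component i j x hx (by simpa [Slice.boundary] using hj))).symm
    intro i x b j hx hj
    cases b with
    | false => exact hf i x j hx hj
    | true =>
      obtain ⟨i', y, h1, h2, h3⟩ := exists_glue hD hx true j
      rw [hglue i x true j hx hj, h1]
      rw [← h3] at hj
      exact hf i' y j h2 hj
  obtain ⟨e, he⟩ := hne
  obtain ⟨x, hx, hb⟩ := hS e he
  have h0 : Q (0, 0) :=
    (hall e.1 x e.2.1 e.2.2 hx (List.getElem?_eq_some_iff.1 hb).1).1 (Or.inl he)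
  rw [← hPin h hh]
  obtain ⟨y, hy, hb'⟩ := hh
  exact (hall h.1 y h.2.1 h.2.2 hy (List.getElem?_eq_some_iff.1 hb').1).2 h0

/-! ### States of the closed diagram -/

/-- Whether the color decreases (`true`) or increases (`false`) on the strand that starts in a lower
boundary point of a crossing. -/
def Elem.label : Elem → ℕ → Option Bool
  | posCrossing, 0 => some true
  | posCrossing, 1 => some false
  | negCrossing, 0 => some false
  | negCrossing, 1 => some true
  | _, _ => none

/-- The label of a strand through a slice. -/
def Slice.label (x : Slice) (p : Bool × ℕ) : Option Bool :=
  if p.1 = false ∧ x.left.length ≤ p.2 then x.elem.label (p.2 - x.left.length) else none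

/-- The label of the strand that starts in a half-edge, with the number of its slice. -/
def halfEdgeLabel (D : List Slice) (h : ℕ × Bool × ℕ) : Option (ℕ × Bool) :=
  match D[h.1]? with
  | some x => (x.label h.2).map fun b => (h.1, b)
  | none => none

theorem Elem.label_eq_iff {e : Elem} {j j' : ℕ} {b : Bool} (h : e.label j = some b)
    (h' : e.label j' = some b) : j = j' := by
  match e, j, j', h, h' with
  | posCrossing, 0, 0, _, _ => rfl
  | posCrossing, 1, 1, _, _ => rfl
  | negCrossing, 0, 0, _, _ => rfl
  | negCrossing, 1, 1, _, _ => rfl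
  | posCrossing, 0, 1, h, h' => rw [← h'] at h; simp [Elem.label] at h
  | posCrossing, 1, 0, h, h' => rw [← h'] at h; simp [Elem.label] at h
  | negCrossing, 0, 1, h, h' => rw [← h'] at h; simp [Elem.label] at h
  | negCrossing, 1, 0, h, h' => rw [← h'] at h; simp [Elem.label] at h

/-- Together with `exists_halfEdgeLabel`: each crossing is passed exactly once with a decrease and
once with an increase of the color. -/
theorem halfEdgeLabel_injective {D : List Slice} {h h' : ℕ × Bool × ℕ} {q : ℕ × Bool}
    (e : halfEdgeLabel D h = some q) (e' : halfEdgeLabel D h' = some q) : h = h' := by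
  obtain ⟨i, b, j⟩ := h
  obtain ⟨i', b', j'⟩ := h'
  simp only [halfEdgeLabel] at e e'
  cases hx : D[i]? with
  | none => rw [hx] at e; simp at e
  | some x =>
    cases hx' : D[i']? with
    | none => rw [hx'] at e'; simp at e'
    | some x' =>
      rw [hx] at e
      rw [hx'] at e'
      obtain ⟨c, hc, rfl⟩ := Option.map_eq_some_iff.1 e
      obtain ⟨c', hc', hcc⟩ := Option.map_eq_some_iff.1 e'
      simp only [Prod.mk.injEq] at hcc
      obtain ⟨rfl, rfl⟩ := hcc
      rw [hx] at hx'
      obtain rfl := Option.some.inj hx'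
      simp only [Slice.label] at hc hc'
      split_ifs at hc hc' with h1 h2
      have := Elem.label_eq_iff hc hc'
      obtain ⟨rfl, h1⟩ := h1
      obtain ⟨rfl, h2⟩ := h2
      congr 2; omega

theorem exists_halfEdgeLabel {D : List Slice} {i : ℕ} {x : Slice} (hx : D[i]? = some x)
    (hc : x.elem.crossings ≠ 0) (b : Bool) :
    ∃ h, IsHalfEdge D inDir h ∧ halfEdgeLabel D h = some (i, b) := by
  have hup : ∀ j < 2, IsHalfEdge D inDir (i, false, x.left.length + j) := by
    intro j hj
    refine ⟨x, hx, ?_⟩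
    simp only [Slice.boundary_eq]
    rw [List.getElem?_append_right (by omega), Nat.add_sub_cancel_left]
    obtain rfl | rfl : j = 0 ∨ j = 1 := by omega
    all_goals
      cases he : x.elem <;> simp [he, Elem.crossings, Elem.boundary, Elem.src, inDir] at hc ⊢
  have hlab : ∀ j, halfEdgeLabel D (i, false, x.left.length + j) =
      (x.elem.label j).map fun b => (i, b) := by
    intro j
    simp [halfEdgeLabel, hx, Slice.label]
  have : ∃ j < 2, x.elem.label j = some b := by
    cases he : x.elem <;> simp [he, Elem.crossings] at hc
    · cases b
      exacts [⟨1, by omega, rfl⟩, ⟨0, by omega, rfl⟩]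
    · cases b
      exacts [⟨0, by omega, rfl⟩, ⟨1, by omega, rfl⟩]
  obtain ⟨j, hj, hl⟩ := this
  exact ⟨_, hup j hj, by rw [hlab, hl]; rfl⟩

theorem halfEdgeLabel_some {D : List Slice} {h : ℕ × Bool × ℕ} {i : ℕ} {b : Bool}
    (e : halfEdgeLabel D h = some (i, b)) :
    h.1 = i ∧ ∃ x, D[i]? = some x ∧ x.elem.crossings ≠ 0 := by
  obtain ⟨i', b', j⟩ := h
  simp only [halfEdgeLabel] at e
  cases hx : D[i']? with
  | none => rw [hx] at e; simp at e
  | some x =>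
    rw [hx] at e
    obtain ⟨c, hc, he⟩ := Option.map_eq_some_iff.1 e
    simp only [Prod.mk.injEq] at he
    obtain ⟨rfl, rfl⟩ := he
    refine ⟨rfl, x, hx, ?_⟩
    simp only [Slice.label] at hc
    split_ifs at hc
    cases he : x.elem <;> simp [he, Elem.label, Elem.crossings] at hc ⊢

/-! ### Colors along a strand through a slice -/

/-- The amount by which the colors change at an elementary piece. -/
def Elem.shift : Elem → List ℕ → List ℕ → ℕ
  | posCrossing, x, y => x.getD 0 0 - y.getD 1 0
  | negCrossing, x, y => y.getD 1 0 - x.getD 0 0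
  | _, _, _ => 0

/-- The amount by which the colors change at the crossing of a slice. -/
def Slice.shift (s : Slice) (x y : List ℕ) : ℕ :=
  s.elem.shift (x.drop s.left.length) (y.drop s.left.length)

theorem Elem.color_turn {n : ℕ} (e : Elem) {m m' : List ℕ} (hm : m ∈ colorings n e.src.length)
    (hm' : m' ∈ colorings n e.tgt.length) (hw : e.weight n m m' ≠ 0) {b : Bool} {j : ℕ} (hj : j < 2)
    (hb : (e.boundary !b).length = 0) :
    (if b then m' else m).getD (1 - j) 0 = (if b then m' else m).getD j 0 := by
  have key : ∀ a c : ℕ, a = c → [a, c].getD (1 - j) 0 = [a, c].getD j 0 := by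
    rintro a _ rfl
    obtain rfl | rfl : j = 0 ∨ j = 1 := by omega
    all_goals rfl
  have hcap : ∀ e : Elem, e.src.length = 2 → e.tgt.length = 0 →
      (∀ a c, e.weight n [a, c] [] ≠ 0 → a = c) → m ∈ colorings n e.src.length →
      m' ∈ colorings n e.tgt.length → e.weight n m m' ≠ 0 → m.getD (1 - j) 0 = m.getD j 0 := by
    intro e h2 h0 hac hm hm' hw
    rw [h2] at hm
    rw [h0] at hm'
    obtain ⟨a, -, c, -, rfl⟩ := mem_colorings_two.1 hm
    obtain rfl : m' = [] := List.length_eq_zero_iff.1 (mem_colorings.1 hm').1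
    exact key a c (hac a c hw)
  have hcup : ∀ e : Elem, e.src.length = 0 → e.tgt.length = 2 →
      (∀ a c, e.weight n [] [a, c] ≠ 0 → a = c) → m ∈ colorings n e.src.length →
      m' ∈ colorings n e.tgt.length → e.weight n m m' ≠ 0 → m'.getD (1 - j) 0 = m'.getD j 0 := by
    intro e h0 h2 hac hm hm' hw
    rw [h2] at hm'
    rw [h0] at hm
    obtain ⟨a, -, c, -, rfl⟩ := mem_colorings_two.1 hm'
    obtain rfl : m = [] := List.length_eq_zero_iff.1 (mem_colorings.1 hm).1
    exact key a c (hac a c hw)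
  cases b
  · rw [if_neg (by decide)]
    cases e with
    | posCrossing => exact absurd hb (by decide)
    | negCrossing => exact absurd hb (by decide)
    | cupUpDown => exact absurd hb (by decide)
    | cupDownUp => exact absurd hb (by decide)
    | capUpDown =>
      exact hcap capUpDown rfl rfl (fun a c h => by
        simp only [Elem.weight] at h; exact (ite_ne_right_iff.1 h).1) hm hm' hw
    | capDownUp =>
      exact hcap capDownUp rfl rfl (fun a c h => by
        simp only [Elem.weight] at h; exact (ite_ne_right_iff.1 h).1) hm hm' hw
  · rw [if_pos rfl]
    cases e with
    | posCrossing => exact absurd hb (by decide)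
    | negCrossing => exact absurd hb (by decide)
    | capUpDown => exact absurd hb (by decide)
    | capDownUp => exact absurd hb (by decide)
    | cupUpDown =>
      exact hcup cupUpDown rfl rfl (fun a c h => by
        simp only [Elem.weight] at h; exact (ite_ne_right_iff.1 h).1) hm hm' hw
    | cupDownUp =>
      exact hcup cupDownUp rfl rfl (fun a c h => by
        simp only [Elem.weight] at h; exact (ite_ne_right_iff.1 h).1) hm hm' hw

theorem Elem.color_crossing {n : ℕ} (e : Elem) {m m' : List ℕ} (hm : m ∈ colorings n e.src.length)
    (hm' : m' ∈ colorings n e.tgt.length) (hw : e.weight n m m' ≠ 0) {j : ℕ} {b : Bool}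
    (hb : e.label j = some b) :
    if b then m'.getD (1 - j) 0 + e.shift m m' = m.getD j 0
      else m'.getD (1 - j) 0 = m.getD j 0 + e.shift m m' := by
  match e, j, hb with
  | posCrossing, 0, hb =>
    obtain rfl : true = b := Option.some.inj hb
    obtain ⟨a, ha, a', ha', rfl⟩ := mem_colorings_two.1 hm
    obtain ⟨c, hc, d, hd, rfl⟩ := mem_colorings_two.1 hm'
    rw [weight_posCrossing hc, posMatrix] at hw
    have := (ite_ne_right_iff.1 hw).1
    simp [Elem.shift]; omega
  | posCrossing, 1, hb =>
    obtain rfl : false = b := Option.some.inj hb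
    obtain ⟨a, ha, a', ha', rfl⟩ := mem_colorings_two.1 hm
    obtain ⟨c, hc, d, hd, rfl⟩ := mem_colorings_two.1 hm'
    rw [weight_posCrossing hc, posMatrix] at hw
    have := (ite_ne_right_iff.1 hw).1
    simp [Elem.shift]; omega
  | negCrossing, 0, hb =>
    obtain rfl : false = b := Option.some.inj hb
    obtain ⟨a, ha, a', ha', rfl⟩ := mem_colorings_two.1 hm
    obtain ⟨c, hc, d, hd, rfl⟩ := mem_colorings_two.1 hm'
    rw [weight_negCrossing ha', negMatrix] at hw
    have := (ite_ne_right_iff.1 hw).1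
    simp [Elem.shift]; omega
  | negCrossing, 1, hb =>
    obtain rfl : true = b := Option.some.inj hb
    obtain ⟨a, ha, a', ha', rfl⟩ := mem_colorings_two.1 hm
    obtain ⟨c, hc, d, hd, rfl⟩ := mem_colorings_two.1 hm'
    rw [weight_negCrossing ha', negMatrix] at hw
    have := (ite_ne_right_iff.1 hw).1
    simp [Elem.shift]; omega

/-- Only crossings have strands passing through them, and these point upwards, so they enter from
below and carry a label. -/
theorem Elem.label_of_through {e : Elem} {b : Bool} {j : ℕ} (hj : j < 2)
    (hd : (e.boundary b)[j]? = some (inDir b)) (hb : (e.boundary !b).length ≠ 0) :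
    b = false ∧ ∃ c, e.label j = some c := by
  obtain rfl | rfl : j = 0 ∨ j = 1 := by omega
  all_goals
    cases e <;> cases b <;> simp_all [Elem.boundary, Elem.src, Elem.tgt, inDir, Elem.label]

theorem Elem.label_lt {e : Elem} {j : ℕ} {b : Bool} (h : e.label j = some b) :
    j < 2 ∧ (e.boundary false).length = 2 ∧ (e.boundary true).length = 2 := by
  match e, j, h with
  | posCrossing, 0, _ => simp [Elem.boundary, Elem.src, Elem.tgt]
  | posCrossing, 1, _ => simp [Elem.boundary, Elem.src, Elem.tgt]
  | negCrossing, 0, _ => simp [Elem.boundary, Elem.src, Elem.tgt]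
  | negCrossing, 1, _ => simp [Elem.boundary, Elem.src, Elem.tgt]

theorem Slice.shift_append (s : Slice) {n : ℕ} {l m m' r r' : List ℕ}
    (hl : l.length = s.left.length) (hm : m ∈ colorings n s.elem.src.length)
    (hm' : m' ∈ colorings n s.elem.tgt.length) :
    s.shift (l ++ (m ++ r)) (l ++ (m' ++ r')) = s.elem.shift m m' := by
  simp only [Slice.shift, ← hl, List.drop_left]
  cases he : s.elem <;> simp only [Elem.shift]
  all_goals
    rw [he] at hm hm'
    obtain ⟨a, ha, a', ha', rfl⟩ := mem_colorings_two.1 hm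
    obtain ⟨c, hc, d, hd, rfl⟩ := mem_colorings_two.1 hm'
    rfl

/-- The change of the color along a strand through a slice. -/
theorem Slice.color_across {n : ℕ} (s : Slice) {x y : List ℕ}
    (hx : x ∈ colorings n s.src.length) (hy : y ∈ colorings n s.tgt.length)
    (hw : s.weight n x y ≠ 0) {p : Bool × ℕ} (hp : (s.boundary p.1)[p.2]? = some (inDir p.1)) :
    match s.label p with
    | none => (if (s.across p).1 then y else x).getD (s.across p).2 0 =
        (if p.1 then y else x).getD p.2 0
    | some true => (if (s.across p).1 then y else x).getD (s.across p).2 0 + s.shift x y =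
        (if p.1 then y else x).getD p.2 0
    | some false => (if (s.across p).1 then y else x).getD (s.across p).2 0 =
        (if p.1 then y else x).getD p.2 0 + s.shift x y := by
  obtain ⟨b, j⟩ := p
  obtain ⟨l, hl, m, hm, r, hr, rfl⟩ := Slice.exists_of_mem_colorings_src hx
  obtain ⟨l', hl', m', hm', r', hr', rfl⟩ := Slice.exists_of_mem_colorings_tgt hy
  have ll := (mem_colorings.1 hl).1
  rw [Slice.weight_append n s ll (mem_colorings.1 hl').1 (mem_colorings.1 hm).1
    (mem_colorings.1 hm').1] at hw
  obtain ⟨⟨rfl, rfl⟩, hw'⟩ := ite_ne_right_iff.1 hw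
  have hlen : ∀ b : Bool, (if b then m' else m).length = (s.elem.boundary b).length := by
    intro b
    cases b
    exacts [(mem_colorings.1 hm).1, (mem_colorings.1 hm').1]
  have hside : ∀ b : Bool, (if b then l ++ (m' ++ r) else l ++ (m ++ r)) =
      l ++ ((if b then m' else m) ++ r) := by intro b; cases b <;> rfl
  have hshift : s.shift (l ++ (m ++ r)) (l ++ (m' ++ r)) = s.elem.shift m m' :=
    s.shift_append ll hm hm'
  simp only [hside, hshift]
  dsimp only at hp
  have hlb := s.elem.length_boundary b
  rw [Slice.boundary_eq] at hp
  rcases Nat.lt_or_ge j s.left.length with h1 | h1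
  · have hlab : s.label (b, j) = none := by
      rw [Slice.label, if_neg (by dsimp only; omega)]
    rw [hlab, s.across_left b h1]
    simp only [List.getD_eq_getElem?_getD]
    rw [List.getElem?_append_left (by omega), List.getElem?_append_left (by omega)]
  rw [List.getElem?_append_right h1] at hp
  rcases Nat.lt_or_ge j (s.left.length + (s.elem.boundary b).length) with h2 | h2
  · rw [List.getElem?_append_left (by omega)] at hp
    have hmid : ∀ (b' : Bool) (j' : ℕ), s.left.length ≤ j' →
        j' < s.left.length + (s.elem.boundary b').length →
        (l ++ ((if b' then m' else m) ++ r)).getD j' 0 =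
          (if b' then m' else m).getD (j' - s.left.length) 0 := by
      intro b' j' hj1 hj2
      simp only [List.getD_eq_getElem?_getD]
      rw [List.getElem?_append_right (by omega), ll,
        List.getElem?_append_left (by rw [hlen]; omega)]
    by_cases h3 : (s.elem.boundary !b).length = 0
    · have hlab : s.label (b, j) = none := by
        rw [Slice.label]
        split_ifs with hc
        · obtain ⟨rfl, _⟩ := hc
          by_contra hne
          obtain ⟨c, hc⟩ := Option.ne_none_iff_exists'.1 hne
          have := (Elem.label_lt hc).2.2
          simp only [Bool.not_false] at h3
          omega
        · rfl
      rw [hlab, s.across_turn h1 h2 h3]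
      dsimp only
      rw [hmid b _ (by omega) (by omega), hmid b j h1 h2,
        show 2 * s.left.length + 1 - j - s.left.length = 1 - (j - s.left.length) by omega]
      exact Elem.color_turn s.elem hm hm' hw' (by omega) h3
    · obtain ⟨rfl, c, hc⟩ := Elem.label_of_through (by omega) hp h3
      have hlab : s.label (false, j) = some c := by
        rw [Slice.label, if_pos ⟨rfl, h1⟩, hc]
      have h4 := Elem.label_lt hc
      rw [hlab, s.across_through h1 h2 h3]
      have key := Elem.color_crossing s.elem hm hm' hw' hc
      have e1 := hmid true (2 * s.left.length + 1 - j) (by omega) (by omega)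
      have e2 := hmid false j h1 h2
      rw [show 2 * s.left.length + 1 - j - s.left.length = 1 - (j - s.left.length) by omega] at e1
      cases c
      · simp only [Bool.not_false, Bool.false_eq_true, if_false, if_true] at key e1 e2 ⊢
        rw [e1, e2, key]
      · simp only [Bool.not_false, Bool.false_eq_true, if_false, if_true] at key e1 e2 ⊢
        rw [e1, e2, key]
  · have hlab : s.label (b, j) = none := by
      rw [Slice.label]
      split_ifs with hc
      · obtain ⟨rfl, _⟩ := hc
        by_contra hne
        obtain ⟨c, hc⟩ := Option.ne_none_iff_exists'.1 hne
        have h5 := Elem.label_lt hc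
        dsimp only at h5
        omega
      · rfl
    rw [hlab, s.across_right h2]
    dsimp only
    simp only [List.getD_eq_getElem?_getD]
    have hr' : ∀ (b' : Bool) (j' : ℕ), (l ++ ((if b' then m' else m) ++ r))[
        s.left.length + (s.elem.boundary b').length + j']? = r[j']? := by
      intro b' j'
      rw [List.getElem?_append_right (by omega), List.getElem?_append_right (by rw [hlen]; omega),
        hlen, ll]
      congr 1; omega
    have e1 := hr' b (j - (s.left.length + (s.elem.boundary b).length))
    rw [Nat.add_sub_cancel' h2] at e1
    rw [e1, ← hr' (!b) (j - (s.left.length + (s.elem.boundary b).length))]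
    congr 2; omega

/-! ### States, and how they are forced and determined -/

/-- A state of the closure of a diagram: a coloring of all its horizontal lines with nonzero
weights. -/
structure IsState (n : ℕ) (D : List Slice) (X : ℕ → List ℕ) : Prop where
  src_mem : ∀ (i : ℕ) (x : Slice), D[i]? = some x → X i ∈ colorings n x.src.length
  tgt_mem : ∀ (i : ℕ) (x : Slice), D[i]? = some x → X (i + 1) ∈ colorings n x.tgt.length
  weight_ne_zero : ∀ (i : ℕ) (x : Slice), D[i]? = some x →
    x.weight n (X i) (X (i + 1)) ≠ 0
  closed : X D.length = X 0

/-- The color of a half-edge in a state. -/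
def halfEdgeColor (X : ℕ → List ℕ) (h : ℕ × Bool × ℕ) : ℕ :=
  (if h.2.1 then X (h.1 + 1) else X h.1).getD h.2.2 0

/-- The amount by which the colors change in a slice. -/
def stateShift (D : List Slice) (X : ℕ → List ℕ) (i : ℕ) : ℕ :=
  match D[i]? with
  | some x => x.shift (X i) (X (i + 1))
  | none => 0

theorem IsState.color_glue {n : ℕ} {D : List Slice} {X : ℕ → List ℕ} (hX : IsState n D X)
    {h : ℕ × Bool × ℕ} (hh : h.1 < D.length) :
    halfEdgeColor X (glue D.length h) = halfEdgeColor X h := by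
  obtain ⟨i, b, j⟩ := h
  dsimp only at hh
  cases b with
  | true =>
    simp only [glue, halfEdgeColor]
    by_cases h1 : i + 1 < D.length
    · simp [h1]
    · have : i + 1 = D.length := by omega
      simp [this, hX.closed]
  | false =>
    simp only [glue, halfEdgeColor]
    by_cases h1 : i = 0
    · simp [h1, show D.length - 1 + 1 = D.length by omega, hX.closed]
    · simp [h1, show i - 1 + 1 = i by omega]

/-- These are the rules for `col` and `k` required by the abstract `exists_forcing`, with `k` the
shift of the slice. -/
theorem IsState.color_next {n : ℕ} {D : List Slice} {X : ℕ → List ℕ} (hX : IsState n D X)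
    {h : ℕ × Bool × ℕ} (hh : IsHalfEdge D inDir h) :
    match halfEdgeLabel D h with
    | none => halfEdgeColor X (nextHalfEdge D h) = halfEdgeColor X h
    | some (i, true) =>
      halfEdgeColor X (nextHalfEdge D h) + stateShift D X i = halfEdgeColor X h
    | some (i, false) =>
      halfEdgeColor X (nextHalfEdge D h) = halfEdgeColor X h + stateShift D X i := by
  rw [nextHalfEdge, hX.color_glue (crossSlice_in hh).lt]
  obtain ⟨x, hx, hb⟩ := hh
  obtain ⟨i, p⟩ := h
  have key := x.color_across (hX.src_mem i x hx) (hX.tgt_mem i x hx) (hX.weight_ne_zero i x hx) hb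
  have hs : stateShift D X i = x.shift (X i) (X (i + 1)) := by simp [stateShift, hx]
  have hlab : halfEdgeLabel D (i, p) = (x.label p).map fun b => (i, b) := by
    simp [halfEdgeLabel, hx]
  dsimp only at hx
  rw [crossSlice_eq hx, hlab]
  cases hl : x.label p with
  | none => rw [hl] at key; exact key
  | some b =>
    rw [hl] at key
    cases b with
    | true => simp only [Option.map_some, hs]; exact key
    | false => simp only [Option.map_some, hs]; exact key

theorem IsState.color_lt {n : ℕ} {D : List Slice} {X : ℕ → List ℕ} (hX : IsState n D X)
    {dir : Bool → Dir} {h : ℕ × Bool × ℕ} (hh : IsHalfEdge D dir h) : halfEdgeColor X h < n := by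
  obtain ⟨x, hx, hb⟩ := hh
  obtain ⟨i, b, j⟩ := h
  have hj := (List.getElem?_eq_some_iff.1 hb).1
  have hmem : (if b then X (i + 1) else X i) ∈ colorings n (x.boundary b).length := by
    cases b
    exacts [hX.src_mem i x hx, hX.tgt_mem i x hx]
  rw [mem_colorings] at hmem
  refine hmem.2 _ ?_
  simp only [halfEdgeColor]
  rw [List.getD_eq_getElem _ _ (by rw [hmem.1]; exact hj)]
  exact List.getElem_mem _

/-- There are a half-edge and an extremal color that force the colors not to change at two of the
crossings. -/
theorem LongKnotDiagram.exists_forcing (K : LongKnotDiagram) {i₁ i₂ : ℕ} {x₁ x₂ : Slice}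
    (hne : i₁ ≠ i₂) (h₁ : K.slices[i₁]? = some x₁) (h₂ : K.slices[i₂]? = some x₂)
    (hc₁ : x₁.elem.crossings ≠ 0) (hc₂ : x₂.elem.crossings ≠ 0) :
    ∃ (e : ℕ × Bool × ℕ) (top : Bool) (p p' : ℕ), IsHalfEdge K.slices inDir e ∧ p ≠ p' ∧
      (∃ x, K.slices[p]? = some x ∧ x.elem.crossings ≠ 0) ∧
      (∃ x, K.slices[p']? = some x ∧ x.elem.crossings ≠ 0) ∧
      ∀ (n : ℕ) (X : ℕ → List ℕ), IsState n K.slices X →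
        halfEdgeColor X e = (if top then n - 1 else 0) →
        stateShift K.slices X p = 0 ∧ stateShift K.slices X p' = 0 := by
  let H := {h // IsHalfEdge K.slices inDir h}
  let σ : H → H := fun h => ⟨nextHalfEdge K.slices h, nextHalfEdge_in K.composable h.2⟩
  let lab : H → Option (ℕ × Bool) := fun h => halfEdgeLabel K.slices h
  have htrans : ∀ S : Set H, S.Nonempty → (∀ h ∈ S, σ h ∈ S) → ∀ h, h ∈ S := by
    rintro S ⟨s, hs⟩ hcl h
    have := K.halfEdge_mem_of_closed (S := Subtype.val '' S) (by rintro _ ⟨a, _, rfl⟩; exact a.2)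
      ⟨_, s, hs, rfl⟩ (by rintro _ ⟨a, ha, rfl⟩; exact ⟨σ a, hcl a ha, rfl⟩) h.2
    obtain ⟨a, ha, hah⟩ := this
    rwa [← Subtype.ext hah]
  have hex : ∀ i x, K.slices[i]? = some x → x.elem.crossings ≠ 0 → ∀ b, ∃ h : H,
      lab h = some (i, b) := by
    intro i x hx hc b
    obtain ⟨h, hh, hl⟩ := exists_halfEdgeLabel hx hc b
    exact ⟨⟨h, hh⟩, hl⟩
  obtain ⟨e, top, c, c', hcc, ⟨h, b, hb⟩, ⟨h', b', hb'⟩, hforce⟩ :=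
    ColoredJones.exists_forcing σ lab htrans
      (fun h h' p hp hp' => Subtype.ext (halfEdgeLabel_injective hp hp')) hne
      (hex i₁ x₁ h₁ hc₁) (hex i₂ x₂ h₂ hc₂)
  refine ⟨e, top, c, c', e.2, hcc, (halfEdgeLabel_some hb).2, (halfEdgeLabel_some hb').2, ?_⟩
  intro n X hX hcol
  refine hforce (n - 1) (fun h => halfEdgeColor X h) (stateShift K.slices X) ?_ ?_ ?_ ?_ hcol
  · intro h
    have := hX.color_lt h.2
    omega
  · intro h hl
    have := hX.color_next h.2
    simp only [lab] at hl
    rw [hl] at this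
    exact this
  · intro h c hl
    have := hX.color_next h.2
    simp only [lab] at hl
    rw [hl] at this
    exact this
  · intro h c hl
    have := hX.color_next h.2
    simp only [lab] at hl
    rw [hl] at this
    exact this

/-- A state is determined by its color on one half-edge and by the changes at the crossings. -/
theorem LongKnotDiagram.state_unique (K : LongKnotDiagram) {n : ℕ} {X X' : ℕ → List ℕ}
    (hX : IsState n K.slices X) (hX' : IsState n K.slices X')
    (hshift : ∀ i, stateShift K.slices X i = stateShift K.slices X' i) {e : ℕ × Bool × ℕ}
    (he : IsHalfEdge K.slices inDir e) (hcol : halfEdgeColor X e = halfEdgeColor X' e) {i : ℕ}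
    (hi : i < K.slices.length) : X i = X' i := by
  have hall : ∀ h, IsHalfEdge K.slices inDir h → halfEdgeColor X h = halfEdgeColor X' h := by
    intro h hh
    have := K.halfEdge_mem_of_closed
      (S := {h | IsHalfEdge K.slices inDir h ∧ halfEdgeColor X h = halfEdgeColor X' h})
      (fun a ha => ha.1) ⟨e, he, hcol⟩ ?_ hh
    · exact this.2
    · rintro a ⟨ha, hac⟩
      refine ⟨nextHalfEdge_in K.composable ha, ?_⟩
      have h1 := hX.color_next ha
      have h2 := hX'.color_next ha
      rcases hl : halfEdgeLabel K.slices a with _ | ⟨i, b⟩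
      · rw [hl] at h1 h2
        dsimp only at h1 h2
        rw [h1, h2, hac]
      · rw [hl] at h1 h2
        have := hshift i
        cases b <;> dsimp only at h1 h2 <;> omega
  have hx : K.slices[i]? = some K.slices[i] := List.getElem?_eq_getElem hi
  set x := K.slices[i]
  have m1 := mem_colorings.1 (hX.src_mem i x hx)
  have m2 := mem_colorings.1 (hX'.src_mem i x hx)
  refine List.ext_getElem (m1.1.trans m2.1.symm) fun j hj hj' => ?_
  have hjx : j < (x.boundary false).length := by rw [m1.1] at hj; exact hj
  have hc : halfEdgeColor X (i, false, j) = halfEdgeColor X' (i, false, j) := by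
    rcases dir_cases (x.boundary false)[j] false with hd | hd
    · exact hall _ ⟨x, hx, by dsimp only; rw [List.getElem?_eq_getElem hjx, hd]⟩
    · have hout : IsHalfEdge K.slices outDir (i, false, j) :=
        ⟨x, hx, by dsimp only; rw [List.getElem?_eq_getElem hjx, hd]⟩
      -- The traversal only sees incoming half-edges; an outgoing one has the color of the incoming
      -- half-edge glued to it.
      rw [← hX.color_glue hout.lt, ← hX'.color_glue hout.lt]
      exact hall _ (glue_out K.composable hout)
  simp only [halfEdgeColor, Bool.false_eq_true, if_false] at hc
  rwa [List.getD_eq_getElem _ _ hj, List.getD_eq_getElem _ _ hj'] at hc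

/-! ### Expansion of the state sum -/

/-- The colorings with nonzero weights of the lines above the lowest one, from `x` to `y`. -/
def paths (n : ℕ) : List Slice → List ℕ → List ℕ → Finset (List (List ℕ))
  | [], x, y => if x = y then {[]} else ∅
  | s :: D, x, y =>
      ((colorings n s.tgt.length).filter fun z => s.weight n x z ≠ 0).biUnion fun z =>
        (paths n D z y).image (List.cons z)

/-- The product of the norms of the weights of the slices. -/
def pathNorm (n : ℕ) : List Slice → List ℕ → List (List ℕ) → ℤ
  | s :: D, x, z :: Z => l1Norm (s.weight n x z) * pathNorm n D z Z
  | _, _, _ => 1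

/-- Discarding colorings with a zero weight loses nothing in the sum and makes the remaining closed
paths states, so that the forcing results apply to them. -/
theorem l1Norm_stateSum_le (n : ℕ) (D : List Slice) (x y : List ℕ) :
    l1Norm (stateSum n D x y) ≤ ∑ Z ∈ paths n D x y, pathNorm n D x Z := by
  induction D generalizing x with
  | nil =>
    simp only [stateSum, paths]
    split_ifs <;> simp [pathNorm]
  | cons s D ih =>
    rw [stateSum_cons, paths, Finset.sum_biUnion]
    · rw [← Finset.sum_filter_of_ne (p := fun z => s.weight n x z ≠ 0)
        (fun z _ h => left_ne_zero_of_mul h)]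
      refine (l1Norm_sum_le _ _).trans (Finset.sum_le_sum fun z _ => ?_)
      rw [Finset.sum_image (fun _ _ _ _ h => (List.cons.inj h).2)]
      simp only [pathNorm]
      rw [← Finset.mul_sum]
      exact (l1Norm_mul_le _ _).trans (mul_le_mul_of_nonneg_left (ih z) (l1Norm_nonneg _))
    · intro z _ z' _ hne
      simp only [Function.onFun]
      rw [Finset.disjoint_left]
      intro Z hZ hZ'
      obtain ⟨_, _, rfl⟩ := Finset.mem_image.1 hZ
      obtain ⟨_, _, h⟩ := Finset.mem_image.1 hZ'
      exact hne (List.cons.inj h).1.symm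

theorem mem_paths_cons {n : ℕ} {s : Slice} {D : List Slice} {x y : List ℕ} {Z : List (List ℕ)} :
    Z ∈ paths n (s :: D) x y ↔ ∃ z ∈ colorings n s.tgt.length, s.weight n x z ≠ 0 ∧
      ∃ Z' ∈ paths n D z y, Z = z :: Z' := by
  simp only [paths, Finset.mem_biUnion, Finset.mem_filter, Finset.mem_image, and_assoc, eq_comm]

theorem mem_paths_nil {n : ℕ} {x y : List ℕ} {Z : List (List ℕ)} :
    Z ∈ paths n [] x y ↔ x = y ∧ Z = [] := by
  simp only [paths]
  split_ifs with h <;> simp [h]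

theorem append_mem_paths {n : ℕ} {D D' : List Slice} {x y z : List ℕ} {Z Z' : List (List ℕ)}
    (hZ : Z ∈ paths n D x y) (hZ' : Z' ∈ paths n D' y z) : Z ++ Z' ∈ paths n (D ++ D') x z := by
  induction D generalizing x Z with
  | nil =>
    obtain ⟨rfl, rfl⟩ := mem_paths_nil.1 hZ
    exact hZ'
  | cons s D ih =>
    obtain ⟨w, hw, hne, Z₁, hZ₁, rfl⟩ := mem_paths_cons.1 hZ
    exact mem_paths_cons.2 ⟨w, hw, hne, _, ih hZ₁, rfl⟩

theorem pathNorm_append {n : ℕ} {D : List Slice} (D' : List Slice) {x y : List ℕ}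
    {Z : List (List ℕ)} (hZ : Z ∈ paths n D x y) (Z' : List (List ℕ)) :
    pathNorm n (D ++ D') x (Z ++ Z') = pathNorm n D x Z * pathNorm n D' y Z' := by
  induction D generalizing x Z with
  | nil =>
    obtain ⟨rfl, rfl⟩ := mem_paths_nil.1 hZ
    simp [pathNorm]
  | cons s D ih =>
    obtain ⟨w, hw, hne, Z₁, hZ₁, rfl⟩ := mem_paths_cons.1 hZ
    simp only [List.cons_append, pathNorm]
    rw [ih hZ₁, mul_assoc]

theorem length_of_mem_paths {n : ℕ} {D : List Slice} {x y : List ℕ} {Z : List (List ℕ)}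
    (hZ : Z ∈ paths n D x y) : Z.length = D.length := by
  induction D generalizing x Z with
  | nil =>
    obtain ⟨rfl, rfl⟩ := mem_paths_nil.1 hZ
    rfl
  | cons s D ih =>
    obtain ⟨w, hw, hne, Z₁, hZ₁, rfl⟩ := mem_paths_cons.1 hZ
    simp [ih hZ₁]

theorem getD_length_of_mem_paths {n : ℕ} {D : List Slice} {x y : List ℕ} {Z : List (List ℕ)}
    (hZ : Z ∈ paths n D x y) : (x :: Z).getD D.length [] = y := by
  induction D generalizing x Z with
  | nil =>
    obtain ⟨rfl, rfl⟩ := mem_paths_nil.1 hZ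
    rfl
  | cons s D ih =>
    obtain ⟨w, hw, hne, Z₁, hZ₁, rfl⟩ := mem_paths_cons.1 hZ
    rw [List.length_cons, List.getD_cons_succ]
    exact ih hZ₁

theorem getD_of_mem_paths {n : ℕ} {s t : List Dir} {D : List Slice} (hD : Composable s D t)
    {x y : List ℕ} (hx : x ∈ colorings n s.length) {Z : List (List ℕ)} (hZ : Z ∈ paths n D x y)
    {i : ℕ} {u : Slice} (hu : D[i]? = some u) :
    (x :: Z).getD i [] ∈ colorings n u.src.length ∧
      (x :: Z).getD (i + 1) [] ∈ colorings n u.tgt.length ∧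
      u.weight n ((x :: Z).getD i []) ((x :: Z).getD (i + 1) []) ≠ 0 := by
  induction D generalizing s x Z i with
  | nil => simp at hu
  | cons v D ih =>
    obtain ⟨w, hw, hne, Z₁, hZ₁, rfl⟩ := mem_paths_cons.1 hZ
    obtain ⟨rfl, hD'⟩ := hD
    cases i with
    | zero =>
      obtain rfl : v = u := by simpa using hu
      exact ⟨hx, hw, hne⟩
    | succ i =>
      simp only [List.getD_cons_succ]
      exact ih hD' hw hZ₁ (by simpa using hu)

theorem pathNorm_le {n : ℕ} {D : List Slice} {x : List ℕ} {Z : List (List ℕ)}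
    (hZ : Z.length = D.length) {B : ℕ → ℤ}
    (hB : ∀ i u, D[i]? = some u →
      l1Norm (u.weight n ((x :: Z).getD i []) ((x :: Z).getD (i + 1) [])) ≤ B i) :
    pathNorm n D x Z ≤ ∏ i ∈ Finset.range D.length, B i := by
  induction D generalizing x Z B with
  | nil => simp [pathNorm]
  | cons s D ih =>
    cases Z with
    | nil => simp at hZ
    | cons z Z =>
      rw [List.length_cons, Finset.prod_range_succ', mul_comm, pathNorm]
      have h0 := hB 0 s rfl
      have h1 := ih (x := z) (Z := Z) (B := fun i => B (i + 1)) (by simpa using hZ)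
        (fun i u hu => hB (i + 1) u (by simpa using hu))
      have hn : 0 ≤ pathNorm n D z Z := by
        clear ih h0 h1 hB hZ
        induction D generalizing z Z with
        | nil => simp [pathNorm]
        | cons s D ih =>
          cases Z with
          | nil => simp [pathNorm]
          | cons z Z => exact mul_nonneg (l1Norm_nonneg _) (ih _ _)
      exact mul_le_mul h0 h1 hn ((l1Norm_nonneg _).trans h0)

/-- A closed path is a state. -/
theorem isState_of_mem_paths {n : ℕ} {D : List Slice} {s t : List Dir} (hD : Composable s D t)
    {x : List ℕ} (hx : x ∈ colorings n s.length) {Z : List (List ℕ)} (hZ : Z ∈ paths n D x x) :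
    IsState n D fun i => (x :: Z).getD i [] where
  src_mem _ _ hu := (getD_of_mem_paths hD hx hZ hu).1
  tgt_mem _ _ hu := (getD_of_mem_paths hD hx hZ hu).2.1
  weight_ne_zero _ _ hu := (getD_of_mem_paths hD hx hZ hu).2.2
  closed := getD_length_of_mem_paths hZ

/-! ### Bounds for the weights -/

/-- When the weight of a crossing is nonzero, its shift is the index `k` of the `R`-matrix entry;
shift `0` gives a monomial. Extrema always have shift `0`. -/
theorem Elem.l1Norm_weight_le {n : ℕ} (e : Elem) {m m' : List ℕ}
    (hm : m ∈ colorings n e.src.length) (hm' : m' ∈ colorings n e.tgt.length) :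
    l1Norm (e.weight n m m') ≤ if e.shift m m' = 0 then 1 else 4 ^ n := by
  have hcap : ∀ (e : Elem), e.src.length = 2 → e.tgt.length = 0 → e.shift m m' = 0 →
      (∀ a b, l1Norm (e.weight n [a, b] []) ≤ 1) → m ∈ colorings n e.src.length →
      m' ∈ colorings n e.tgt.length →
      l1Norm (e.weight n m m') ≤ if e.shift m m' = 0 then 1 else 4 ^ n := by
    intro e h2 h0 hs hle hm hm'
    rw [h2] at hm
    rw [h0] at hm'
    obtain ⟨a, -, c, -, rfl⟩ := mem_colorings_two.1 hm
    obtain rfl : m' = [] := List.length_eq_zero_iff.1 (mem_colorings.1 hm').1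
    rw [if_pos hs]
    exact hle a c
  have hcup : ∀ (e : Elem), e.src.length = 0 → e.tgt.length = 2 → e.shift m m' = 0 →
      (∀ a b, l1Norm (e.weight n [] [a, b]) ≤ 1) → m ∈ colorings n e.src.length →
      m' ∈ colorings n e.tgt.length →
      l1Norm (e.weight n m m') ≤ if e.shift m m' = 0 then 1 else 4 ^ n := by
    intro e h0 h2 hs hle hm hm'
    rw [h0] at hm
    rw [h2] at hm'
    obtain ⟨a, -, c, -, rfl⟩ := mem_colorings_two.1 hm'
    obtain rfl : m = [] := List.length_eq_zero_iff.1 (mem_colorings.1 hm).1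
    rw [if_pos hs]
    exact hle a c
  cases e with
  | posCrossing =>
    obtain ⟨a, ha, b, hb, rfl⟩ := mem_colorings_two.1 hm
    obtain ⟨c, hc, d, hd, rfl⟩ := mem_colorings_two.1 hm'
    rw [weight_posCrossing hc, posMatrix]
    have hs : Elem.posCrossing.shift [a, b] [c, d] = a - d := rfl
    rw [hs]
    split_ifs with h1 h2
    · rw [show c - b = 0 by omega, l1Norm_Rplus_zero]
    · exact l1Norm_Rplus_le (by omega)
    · simp
    · simp
  | negCrossing =>
    obtain ⟨a, ha, b, hb, rfl⟩ := mem_colorings_two.1 hm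
    obtain ⟨c, hc, d, hd, rfl⟩ := mem_colorings_two.1 hm'
    rw [weight_negCrossing hb, negMatrix]
    have hs : Elem.negCrossing.shift [a, b] [c, d] = d - a := rfl
    rw [hs]
    split_ifs with h1 h2
    · rw [show b - c = 0 by omega, l1Norm_Rminus_zero]
    · exact l1Norm_Rminus_le (by omega)
    · simp
    · simp
  | capUpDown =>
    exact hcap capUpDown rfl rfl rfl (fun a b => by
      simp only [Elem.weight]; split_ifs <;> simp) hm hm'
  | capDownUp =>
    exact hcap capDownUp rfl rfl rfl (fun a b => by
      simp only [Elem.weight]; split_ifs <;> simp) hm hm'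
  | cupUpDown =>
    exact hcup cupUpDown rfl rfl rfl (fun a b => by
      simp only [Elem.weight]; split_ifs <;> simp) hm hm'
  | cupDownUp =>
    exact hcup cupDownUp rfl rfl rfl (fun a b => by
      simp only [Elem.weight]; split_ifs <;> simp) hm hm'

theorem Slice.l1Norm_weight_le {n : ℕ} (s : Slice) {x y : List ℕ}
    (hx : x ∈ colorings n s.src.length) (hy : y ∈ colorings n s.tgt.length) :
    l1Norm (s.weight n x y) ≤ if s.shift x y = 0 then 1 else 4 ^ n := by
  obtain ⟨l, hl, m, hm, r, hr, rfl⟩ := Slice.exists_of_mem_colorings_src hx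
  obtain ⟨l', hl', m', hm', r', hr', rfl⟩ := Slice.exists_of_mem_colorings_tgt hy
  have ll := (mem_colorings.1 hl).1
  rw [Slice.weight_append n s ll (mem_colorings.1 hl').1 (mem_colorings.1 hm).1
    (mem_colorings.1 hm').1]
  by_cases h : l = l' ∧ r = r'
  · obtain ⟨rfl, rfl⟩ := h
    rw [if_pos ⟨rfl, rfl⟩, s.shift_append ll hm hm']
    exact s.elem.l1Norm_weight_le hm hm'
  · rw [if_neg h, l1Norm_zero]
    split_ifs
    exacts [zero_le_one, by positivity]

theorem Slice.shift_lt {n : ℕ} (hn : 1 ≤ n) (s : Slice) {x y : List ℕ}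
    (hx : x ∈ colorings n s.src.length) (hy : y ∈ colorings n s.tgt.length) : s.shift x y < n := by
  have key : ∀ {m : ℕ} {z : List ℕ} (p q : ℕ), z ∈ colorings n m → (z.drop p).getD q 0 < n := by
    intro m z p q hz
    rcases Nat.lt_or_ge q (z.drop p).length with h | h
    · rw [List.getD_eq_getElem _ _ h]
      exact (mem_colorings.1 hz).2 _ (List.mem_of_mem_drop (List.getElem_mem h))
    -- The default color `0` is admissible because `1 ≤ n`.
    · rw [List.getD_eq_default _ _ h]
      exact hn
  rw [Slice.shift]
  cases s.elem with
  | posCrossing => exact (Nat.sub_le _ _).trans_lt (key s.left.length 0 hx)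
  | negCrossing => exact (Nat.sub_le _ _).trans_lt (key s.left.length 1 hy)
  | capUpDown => exact hn
  | capDownUp => exact hn
  | cupUpDown => exact hn
  | cupDownUp => exact hn

theorem Slice.shift_eq_zero {s : Slice} (hs : s.elem.crossings = 0) (x y : List ℕ) :
    s.shift x y = 0 := by
  rw [Slice.shift]
  cases he : s.elem <;> simp [he, Elem.crossings] at hs <;> rfl

theorem IsState.shift_lt {n : ℕ} (hn : 1 ≤ n) {D : List Slice} {X : ℕ → List ℕ}
    (hX : IsState n D X) (i : ℕ) : stateShift D X i < n := by
  rw [stateShift]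
  split
  next x hx => exact x.shift_lt hn (hX.src_mem i x hx) (hX.tgt_mem i x hx)
  next => exact hn

/-! ### Counting states -/

open Classical in
/-- The numbers of the slices that hold a crossing. -/
def crossingSlices (D : List Slice) : Finset ℕ :=
  (Finset.range D.length).filter fun i => ∃ x, D[i]? = some x ∧ x.elem.crossings ≠ 0

theorem mem_crossingSlices {D : List Slice} {i : ℕ} :
    i ∈ crossingSlices D ↔ ∃ x, D[i]? = some x ∧ x.elem.crossings ≠ 0 := by
  rw [crossingSlices, Finset.mem_filter, Finset.mem_range, and_iff_right_iff_imp]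
  rintro ⟨x, hx, -⟩
  exact (List.getElem?_eq_some_iff.1 hx).1

theorem card_crossingSlices (D : List Slice) :
    (crossingSlices D).card = (D.map fun x => x.elem.crossings).sum := by
  classical
  rw [crossingSlices, Finset.card_filter]
  induction D with
  | nil => rfl
  | cons s D ih =>
    rw [List.length_cons, Finset.sum_range_succ', List.map_cons, List.sum_cons, ← ih, add_comm]
    congr 1
    simp only [List.getElem?_cons_zero, Option.some.injEq, exists_eq_left']
    cases s.elem <;> rfl

theorem stateShift_eq_zero {D : List Slice} {i : ℕ} (hi : i ∉ crossingSlices D)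
    (X : ℕ → List ℕ) : stateShift D X i = 0 := by
  rw [stateShift]
  split
  next x hx =>
    refine Slice.shift_eq_zero ?_ _ _
    by_contra h
    exact hi (mem_crossingSlices.2 ⟨x, hx, h⟩)
  next => rfl

/-- A point of the diagram and an extremal color at this point that force the colors not to change
at two of the crossings. -/
theorem LongKnotDiagram.exists_forcing_point (K : LongKnotDiagram)
    (hK : 2 ≤ K.crossings) :
    ∃ (i : ℕ) (u : Slice) (s t : List Dir) (d : Dir) (top : Bool) (p p' : ℕ),
      K.slices[i]? = some u ∧ u.src = s ++ d :: t ∧ p ≠ p' ∧ p ∈ crossingSlices K.slices ∧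
      p' ∈ crossingSlices K.slices ∧ ∀ (n : ℕ) (X : ℕ → List ℕ), IsState n K.slices X →
        (X i).getD s.length 0 = (if top then n - 1 else 0) →
        (stateShift K.slices X p = 0 ∧ stateShift K.slices X p' = 0) ∧
        ∀ X', IsState n K.slices X' → (X' i).getD s.length 0 = (if top then n - 1 else 0) →
          (∀ k, stateShift K.slices X k = stateShift K.slices X' k) →
          ∀ k ≤ K.slices.length, X k = X' k := by
  rw [crossings, ← card_crossingSlices] at hK
  obtain ⟨i₁, hi₁, i₂, hi₂, hne⟩ := Finset.one_lt_card.1 hK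
  obtain ⟨x₁, h₁, hc₁⟩ := mem_crossingSlices.1 hi₁
  obtain ⟨x₂, h₂, hc₂⟩ := mem_crossingSlices.1 hi₂
  obtain ⟨e, top, p, p', he, hpp, hp, hp', hforce⟩ := K.exists_forcing hne h₁ h₂ hc₁ hc₂
  obtain ⟨i, u, j, hu, hj, hcol⟩ : ∃ i u j, K.slices[i]? = some u ∧ j < u.src.length ∧
      ∀ n X, IsState n K.slices X → halfEdgeColor X e = (X i).getD j 0 := by
    obtain ⟨x, hx, hb⟩ := id he
    have hlt := he.lt
    obtain ⟨i, b, j⟩ := e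
    have hj := (List.getElem?_eq_some_iff.1 hb).1
    cases b with
    | false => exact ⟨i, x, j, hx, hj, fun n X hX => rfl⟩
    | true =>
      -- The cut is made along the lower line of a slice, so a half-edge on an upper line is
      -- replaced by its glued neighbor.
      obtain ⟨i', y, hg, hy, hyx⟩ := exists_glue K.composable hx true j
      refine ⟨i', y, j, hy, ?_, fun n X hX => ?_⟩
      · dsimp only at hj
        rw [← hyx] at hj
        exact hj
      · rw [← hX.color_glue hlt, hg]
        rfl
  refine ⟨i, u, u.src.take j, u.src.drop (j + 1), u.src[j], top, p, p', hu, ?_, hpp,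
    mem_crossingSlices.2 hp, mem_crossingSlices.2 hp', ?_⟩
  · rw [← List.drop_eq_getElem_cons hj, List.take_append_drop]
  · rw [List.length_take_of_le hj.le]
    intro n X hX hXa
    rw [← hcol n X hX] at hXa
    refine ⟨hforce n X hX hXa, fun X' hX' hXa' hs k hk => ?_⟩
    rw [← hcol n X' hX'] at hXa'
    have hN : 0 < K.slices.length := (Nat.zero_le i).trans_lt (List.getElem?_eq_some_iff.1 hu).1
    rcases hk.lt_or_eq with hk | rfl
    · exact K.state_unique hX hX' hs he (hXa.trans hXa'.symm) hk
    -- The uppermost line is the lower line of no slice; closedness reduces it to line `0`.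
    · rw [hX.closed, hX'.closed]
      exact K.state_unique hX hX' hs he (hXa.trans hXa'.symm) hN

/-! ### The norm estimate -/

/-- The twists of the trace are monomials and disappear in the norm. The index consists of the other
colors on the cut line, the color at the joined ends, and a path through each of `D` and `D'`. -/
theorem l1Norm_partialTrace_le (n : ℕ) (s t : List Dir) (D D' : List Slice) (a : ℕ) :
    l1Norm (partialTrace n s t
      (fun x y => ∑ c ∈ Finset.range n, stateSum n D' x [c] * stateSum n D [c] y) a) ≤
    ∑ q ∈ ((colorings n s.length ×ˢ colorings n t.length) ×ˢ Finset.range n).sigma fun p =>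
        paths n D [p.2] (p.1.1 ++ a :: p.1.2) ×ˢ paths n D' (p.1.1 ++ a :: p.1.2) [p.2],
      pathNorm n D [q.1.2] q.2.1 * pathNorm n D' (q.1.1.1 ++ a :: q.1.1.2) q.2.2 := by
  rw [partialTrace, Finset.sum_sigma, Finset.sum_product, Finset.sum_product]
  refine (l1Norm_sum_le _ _).trans (Finset.sum_le_sum fun x _ => ?_)
  refine (l1Norm_sum_le _ _).trans (Finset.sum_le_sum fun y _ => ?_)
  rw [mul_assoc, l1Norm_T_mul, l1Norm_T_mul]
  refine (l1Norm_sum_le _ _).trans (Finset.sum_le_sum fun c _ => ?_)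
  -- The factors are exchanged so that the path through `D` comes first and the two paths
  -- concatenate to one through the whole diagram.
  rw [mul_comm, Finset.sum_product]
  dsimp only
  rw [← Finset.sum_mul_sum]
  have h1 := l1Norm_stateSum_le n D [c] (x ++ a :: y)
  have h2 := l1Norm_stateSum_le n D' (x ++ a :: y) [c]
  exact (l1Norm_mul_le _ _).trans
    (mul_le_mul h1 h2 (l1Norm_nonneg _) ((l1Norm_nonneg _).trans h1))

/-- All but two of the crossings contribute at most `n` colorings and a factor `4 ^ n`. -/
theorem LongKnotDiagram.l1Norm_coloredJones_le (K : LongKnotDiagram) {c n : ℕ} (hn : 1 ≤ n)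
    (hK : K.crossings = c + 2) : l1Norm (K.coloredJones n) ≤ (n : ℤ) ^ c * 4 ^ (c * n) := by
  obtain ⟨i, u, s, t, d, top, p, p', hu, hsrc, hpp, hp, hp', hforce⟩ :=
    K.exists_forcing_point (by omega)
  set a := if top then n - 1 else 0 with ha
  have han : a < n := by rw [ha]; split_ifs <;> omega
  obtain ⟨hD, hD'⟩ := K.composable.split hu
  rw [hsrc] at hD hD'
  have hi : i < K.slices.length := (List.getElem?_eq_some_iff.1 hu).1
  set D := K.slices.take i
  set D' := K.slices.drop i
  have hDD : D ++ D' = K.slices := List.take_append_drop _ _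
  have hDi : D.length = i := List.length_take_of_le hi.le
  -- The `c` crossings that are not forced; only these contribute to the number of states and to
  -- their norms.
  set C := ((crossingSlices K.slices).erase p).erase p' with hC
  have hCc : C.card = c := by
    rw [hC, Finset.card_erase_of_mem (Finset.mem_erase.2 ⟨hpp.symm, hp'⟩),
      Finset.card_erase_of_mem hp, card_crossingSlices]
    rw [LongKnotDiagram.crossings] at hK
    omega
  rw [LongKnotDiagram.coloredJones, l1Norm_T_mul, ← hDD, stateSum_eq_cut hD hD' han]
  refine (l1Norm_partialTrace_le n s t D D' a).trans ?_
  set I := ((colorings n s.length ×ˢ colorings n t.length) ×ˢ Finset.range n).sigma fun p =>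
        paths n D [p.2] (p.1.1 ++ a :: p.1.2) ×ˢ paths n D' (p.1.1 ++ a :: p.1.2) [p.2] with hI
  let X : (Σ _ : (List ℕ × List ℕ) × ℕ, List (List ℕ) × List (List ℕ)) → ℕ → List ℕ :=
    fun q k => ([q.1.2] :: (q.2.1 ++ q.2.2)).getD k []
  have hmem : ∀ q ∈ I, q.2.1 ++ q.2.2 ∈ paths n K.slices [q.1.2] [q.1.2] ∧
      [q.1.2] ∈ colorings n 1 ∧ q.1.1.1.length = s.length ∧
      X q i = q.1.1.1 ++ a :: q.1.1.2 ∧ q.2.1.length = i ∧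
      pathNorm n K.slices [q.1.2] (q.2.1 ++ q.2.2) =
        pathNorm n D [q.1.2] q.2.1 * pathNorm n D' (q.1.1.1 ++ a :: q.1.1.2) q.2.2 := by
    rintro ⟨⟨⟨x, y⟩, b⟩, Z, Z'⟩ hq
    simp only [hI, Finset.mem_sigma, Finset.mem_product, Finset.mem_range] at hq
    obtain ⟨⟨⟨hx, hy⟩, hb⟩, hZ, hZ'⟩ := hq
    have hlen := length_of_mem_paths hZ
    refine ⟨by rw [← hDD]; exact append_mem_paths hZ hZ', ?_, (mem_colorings.1 hx).1, ?_,
      hlen.trans hDi, by rw [← hDD]; exact pathNorm_append D' hZ Z'⟩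
    · exact mem_colorings.2 ⟨rfl, by simpa using hb⟩
    · have := getD_length_of_mem_paths hZ
      rw [hDi] at this
      dsimp only [X]
      rw [← List.cons_append, List.getD_append _ _ _ _ (by rw [List.length_cons]; omega)]
      exact this
  have hstate : ∀ q ∈ I, IsState n K.slices (X q) ∧ (X q i).getD s.length 0 = a := by
    intro q hq
    obtain ⟨h1, h2, h3, h4, -⟩ := hmem q hq
    refine ⟨isState_of_mem_paths K.composable h2 h1, ?_⟩
    rw [h4, ← h3, List.getD_append_right _ _ _ _ le_rfl, Nat.sub_self]
    rfl
  have hzero : ∀ q ∈ I, ∀ k ∉ C, stateShift K.slices (X q) k = 0 := by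
    intro q hq k hk
    obtain ⟨h1, h2⟩ := hstate q hq
    obtain ⟨⟨h3, h4⟩, -⟩ := hforce n _ h1 h2
    by_cases hkp : k = p
    · rw [hkp, h3]
    by_cases hkp' : k = p'
    · rw [hkp', h4]
    refine stateShift_eq_zero (fun h => hk ?_) _
    exact Finset.mem_erase.2 ⟨hkp', Finset.mem_erase.2 ⟨hkp, h⟩⟩
  have hcard : I.card ≤ n ^ c := by
    have hpi : (Fintype.piFinset fun _ : C => Finset.range n).card = n ^ c := by
      rw [Fintype.card_piFinset, Finset.prod_const, Finset.card_univ, Finset.card_range,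
        Fintype.card_coe, hCc]
    rw [← hpi]
    -- With the color at the cut fixed and all shifts outside `C` zero, a state is recovered from
    -- its shifts in `C`, each of which has at most `n` values.
    refine Finset.card_le_card_of_injOn (fun q k => stateShift K.slices (X q) k) ?_ ?_
    · intro q hq
      simp only [Finset.mem_coe, Fintype.mem_piFinset, Finset.mem_range]
      exact fun k => (hstate q hq).1.shift_lt hn k
    · intro q hq q' hq' h
      obtain ⟨h1, h2⟩ := hstate q hq
      obtain ⟨h1', h2'⟩ := hstate q' hq'
      have hX := (hforce n _ h1 h2).2 _ h1' h2' (fun k => by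
        by_cases hk : k ∈ C
        · exact congrFun h ⟨k, hk⟩
        · rw [hzero q hq k hk, hzero q' hq' k hk])
      obtain ⟨m1, -, m3, m4, m5, -⟩ := hmem q hq
      obtain ⟨m1', -, m3', m4', m5', -⟩ := hmem q' hq'
      have l1 := length_of_mem_paths m1
      have l1' := length_of_mem_paths m1'
      have e1 := hX i hi.le
      rw [m4, m4'] at e1
      have e2 : [q.1.2] :: (q.2.1 ++ q.2.2) = [q'.1.2] :: (q'.2.1 ++ q'.2.2) := by
        refine List.ext_getElem (by simp only [List.length_cons, l1, l1']) fun k hk hk' => ?_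
        have := hX k (by rw [List.length_cons, l1] at hk; omega)
        dsimp only [X] at this
        rwa [List.getD_eq_getElem _ _ hk, List.getD_eq_getElem _ _ hk'] at this
      obtain ⟨⟨⟨x, y⟩, b⟩, Z, Z'⟩ := q
      obtain ⟨⟨⟨x', y'⟩, b'⟩, W, W'⟩ := q'
      dsimp only at *
      obtain ⟨rfl, e3⟩ := List.append_inj e1 (m3.trans m3'.symm)
      obtain ⟨-, rfl⟩ := List.cons.inj e3
      obtain ⟨e4, e5⟩ := List.cons.inj e2
      obtain ⟨rfl, -⟩ := List.cons.inj e4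
      obtain ⟨rfl, rfl⟩ := List.append_inj e5 (m5.trans m5'.symm)
      rfl
  have hterm : ∀ q ∈ I, pathNorm n D [q.1.2] q.2.1 *
      pathNorm n D' (q.1.1.1 ++ a :: q.1.1.2) q.2.2 ≤ 4 ^ (c * n) := by
    intro q hq
    obtain ⟨m1, -, -, -, -, m6⟩ := hmem q hq
    obtain ⟨h1, -⟩ := hstate q hq
    rw [← m6]
    -- Outside `C` the shift vanishes, so the weight of the slice has norm at most `1`.
    refine (pathNorm_le (length_of_mem_paths m1) (B := fun k => if k ∈ C then 4 ^ n else 1)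
      fun k v hv => ?_).trans ?_
    · have hw := v.l1Norm_weight_le (h1.src_mem k v hv) (h1.tgt_mem k v hv)
      refine hw.trans ?_
      have hs : stateShift K.slices (X q) k = v.shift (X q k) (X q (k + 1)) := by
        simp [stateShift, hv]
      rw [← hs]
      by_cases hk : k ∈ C
      · rw [if_pos hk]
        split_ifs
        exacts [one_le_pow₀ (by norm_num), le_rfl]
      · rw [if_neg hk, hzero q hq k hk, if_pos rfl]
    · have hsub : (Finset.range K.slices.length).filter (· ∈ C) = C := by
        refine Finset.filter_mem_eq_inter.trans (Finset.inter_eq_right.2 fun k hk => ?_)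
        obtain ⟨v, hv, -⟩ := mem_crossingSlices.1
          (Finset.mem_of_mem_erase (Finset.mem_of_mem_erase hk))
        exact Finset.mem_range.2 (List.getElem?_eq_some_iff.1 hv).1
      rw [← Finset.prod_filter, hsub, Finset.prod_const, hCc, ← pow_mul, mul_comm c n]
  calc _ ≤ I.card • (4 : ℤ) ^ (c * n) := Finset.sum_le_card_nsmul _ _ _ hterm
    _ ≤ _ := by
      rw [nsmul_eq_mul]
      exact mul_le_mul_of_nonneg_right (by exact_mod_cast hcard) (by positivity)

end ColoredJones

end

theorem theorem3 (K : ColoredJones.LongKnotDiagram) (c n : ℕ) (hn : 1 ≤ n)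
    (hK : K.crossings = c + 2) :
    ColoredJones.l1Norm (K.coloredJones n) ≤ (n : ℤ) ^ c * 4 ^ (c * n) :=
  K.l1Norm_coloredJones_le hn hK
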